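/- Let $\Omega\subset\mathbb R^3$ be a contractible bounded Lipschitz domain and let $\mathcal T_h$ be a finite conforming tetrahedral mesh of $\Omega$: a finite geometric simplicial complex, each of whose simplices is a face of one of its tetrahedra, with $\bigcup_{K\in\mathcal T_h}K=\overline\Omega$. Let $r\ge 1$ and $k\ge 2$ be integers. Let $P_m$ denote the polynomials of degree at most $m$ (with $P_m=\{0\}$ for $m<0$) and $\tilde P_m$ the homogeneous ones of degree $m$. For a tetrahedron $K$ define the shape function spaces - $\Sigma_h^{r}(K)=P_r$; - $V_h^r(K)=(P_{r-1})^3\oplus\{p\in(\tilde P_r)^3:\ x\cdot p=0\}$; - $\Sigma_h^{+,k-1}(K)=P_{k-1}$ if $k\ge5$, and $\Sigma_h^{+,k-1}(K)=P_{k-1}\oplus\operatorname{span}\{\lambda_1\lambda_2\lambda_3\lambda_4\}$ if $k\in\{2,3,4\}$, where the $\lambda_i$ are the barycentric coordinates of $K$; - $W_h^{r-1,k}(K)=\nabla\times V_h^r(K)\oplus\mathfrak p\,\Sigma_h^{+,k-1}(K)$, where $(\mathfrak p u)(x)=\int_0^1t^2\,x\,u(tx)\,dt$. The global spaces consist of the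 families $u=(u_K)_{K\in\mathcal T_h}$ of shape functions $u_K$ (piecewise polynomials) for which the following degrees of freedom, attached to the vertices $v$, edges $e$ and faces $f$ of the mesh, take the same value on all tetrahedra that contain $v$, $e$ or $f$, respectively: - $\Sigma_h^r$ (Lagrange elements of degree $m=r$) and $\Sigma_h^{+,k-1}$ (Lagrange elements of degree $m=k-1$, possibly enriched by bubbles): $u(v)$; $\int_e u\,q\,ds$ for $q\in P_{m-2}$; $\int_f u\,q\,dA$ for $q\in P_{m-3}$; - $V_h^r$ (first-kind Nédélec elements): $\int_e (u\cdot\tau)\,q\,ds$ for $q\in P_{r-1}$; $\int_f u\cdot q\,dA$ for $q\in (P_{r-2})^3$ tangential to $f$; - $W_h^{r-1,k}$ (grad-div elements): $(\nabla\cdot u)(v)$; $\int_e(\nabla\cdot u)\,q\,ds$ for $q\in P_{k-3}$; $\int_f(\nabla\cdot u)\,q\,dA$ for $q\in P_{k-4}$; $\int_f (u\cdot n)\,q\,dA$ for $q\in P_{r-1}$. Here $\tau$ is a unit tangent of $e$ and $n$ a unit normal of $f$, chosen once for each edge and face of the mesh. (The interior degrees of freedom belong to a single tetrahedron and impose no matching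 condition.) **Theorem.** With the gradient, curl and divergence applied tetrahedron by tetrahedron, $$\mathbb R\xrightarrow{\ \subset\ }\Sigma_h^r\xrightarrow{\ \nabla\ }V_h^r\xrightarrow{\ \nabla\times\ }W_h^{r-1,k}\xrightarrow{\ \nabla\cdot\ }\Sigma_h^{+,k-1}\longrightarrow 0$$ is a well-defined exact complex: each operator maps its space into the next one, the inclusion of the constants is injective, the kernel of $\nabla$ on $\Sigma_h^r$ is the space of constants, the kernel of $\nabla\times$ on $V_h^r$ is $\nabla\Sigma_h^r$, the kernel of $\nabla\cdot$ on $W_h^{r-1,k}$ is $\nabla\times V_h^r$, and $\nabla\cdot:W_h^{r-1,k}\to\Sigma_h^{+,k-1}$ is surjective. -/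

import Mathlib

noncomputable section

namespace QuadDiv

/-! ### Lipschitz domains and tetrahedral meshes -/

/-- Euclidean space `ℝ³`. -/
abbrev E3 : Type := EuclideanSpace ℝ (Fin 3)

/-- A bounded Lipschitz domain of `ℝ³`: a bounded, connected, open set that, near each of its
boundary points and in suitable Cartesian coordinates, lies on one side of the graph of a
Lipschitz function. -/
structure IsLipschitzDomain (Ω : Set E3) : Prop where
  isOpen : IsOpen Ω
  isConnected : IsConnected Ω
  isBounded : Bornology.IsBounded Ω
  lipschitz_boundary : ∀ p ∈ frontier Ω,
    ∃ (A : E3 ≃ᵃⁱ[ℝ] E3) (g : EuclideanSpace ℝ (Fin 2) → ℝ) (L : NNReal), LipschitzWith L g ∧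
      ∃ U ∈ nhds p, ∀ x ∈ U, (x ∈ Ω ↔ g (!₂[A x 0, A x 1]) < A x 2)

/-- A (conforming, finite) tetrahedral mesh of `Ω`: a finite geometric simplicial complex, each of
whose simplices is a face of one of its tetrahedra, that fills the closure of `Ω`. -/
structure TetMesh (Ω : Set E3) extends Geometry.SimplicialComplex ℝ E3 where
  finite_faces : faces.Finite
  pure : ∀ s ∈ faces, ∃ K ∈ faces, s ⊆ K ∧ K.card = 4
  space_eq : toSimplicialComplex.space = closure Ω

/-- The tetrahedra (cells) of a mesh, each given by its set of four vertices. -/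
def TetMesh.Cell {Ω : Set E3} (T : TetMesh Ω) : Type := {K : Finset E3 // K ∈ T.faces ∧ K.card = 4}

/-- The set of vertices of a cell. -/
def TetMesh.Cell.verts {Ω : Set E3} {T : TetMesh Ω} (K : T.Cell) : Finset E3 := K.1

/-! ### Polynomials and differential operators -/

/-- Real polynomials in three variables. -/
abbrev Poly : Type := MvPolynomial (Fin 3) ℝ

/-- Polynomial vector fields on `ℝ³`. -/
abbrev VPoly : Type := Fin 3 → Poly

/-- The value of a polynomial at a point. -/
def ev (x : E3) : Poly →ₗ[ℝ] ℝ := (MvPolynomial.aeval (fun i => x i)).toLinearMap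

/-- The gradient. -/
def grad : Poly →ₗ[ℝ] VPoly := LinearMap.pi fun i => (MvPolynomial.pderiv i).toLinearMap

/-- The curl. -/
def curl : VPoly →ₗ[ℝ] VPoly where
  toFun v := ![MvPolynomial.pderiv 1 (v 2) - MvPolynomial.pderiv 2 (v 1),
               MvPolynomial.pderiv 2 (v 0) - MvPolynomial.pderiv 0 (v 2),
               MvPolynomial.pderiv 0 (v 1) - MvPolynomial.pderiv 1 (v 0)]
  map_add' u v := by
    ext1 i
    fin_cases i <;> simp <;> ring
  map_smul' c v := by
    ext1 i
    fin_cases i <;> simp [smul_sub]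

/-- The divergence. -/
def div : VPoly →ₗ[ℝ] Poly :=
  ∑ i : Fin 3, (MvPolynomial.pderiv i).toLinearMap ∘ₗ LinearMap.proj i

/-- The Poincaré operator `𝔭`, defined on monomials by
`𝔭 m = (deg m + 3)⁻¹ • (x₁ m, x₂ m, x₃ m)`; see `ev_poincare` for the integral formula
`(𝔭 u)(x) = ∫₀¹ t² x u(t x) dt`. -/
def poincare : Poly →ₗ[ℝ] VPoly :=
  LinearMap.pi fun i => (MvPolynomial.basisMonomials (Fin 3) ℝ).constr ℝ fun s =>
    MvPolynomial.monomial (s + Finsupp.single i 1) ((s.degree : ℝ) + 3)⁻¹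

theorem ev_monomial_smul (s : Fin 3 →₀ ℕ) (t : ℝ) (x : E3) :
    ev (t • x) (MvPolynomial.monomial s 1) = t ^ s.degree * ev x (MvPolynomial.monomial s 1) := by
  simp [ev, MvPolynomial.aeval_monomial, Finsupp.prod_fintype, mul_pow, Finset.prod_mul_distrib,
    Finset.prod_pow_eq_pow_sum, Finsupp.degree_eq_sum]

theorem continuous_ev (u : Poly) {X : Type*} [TopologicalSpace X] {f : X → E3}
    (hf : Continuous f) : Continuous fun x => ev (f x) u := by
  induction u using MvPolynomial.induction_on with
  | C a => simpa [ev] using continuous_const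
  | add p q hp hq => simp only [map_add]; exact Continuous.add hp hq
  | mul_X p i hp =>
    have h : Continuous fun x => f x i := by fun_prop
    have e : (fun x => ev (f x) (p * MvPolynomial.X i)) = fun x => ev (f x) p * f x i := by
      funext x; simp [ev]
    rw [e]; exact Continuous.mul hp h

/-- The defining formula `𝔭 u (x) = ∫₀¹ t² x u(t x) dt` of the Poincaré operator. -/
theorem ev_poincare (u : Poly) (x : E3) (i : Fin 3) :
    ev x (poincare u i) = ∫ t in (0 : ℝ)..1, t ^ 2 * x i * ev (t • x) u := by
  have hi : ∀ v : Poly, IntervalIntegrable (fun t : ℝ => t ^ 2 * x i * ev (t • x) v)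
      MeasureTheory.volume 0 1 := fun v => by
    have : Continuous fun t : ℝ => ev (t • x) v := continuous_ev v (by fun_prop)
    exact Continuous.intervalIntegrable (by fun_prop) _ _
  induction u using MvPolynomial.induction_on' with
  | monomial s a =>
    have h1 : (MvPolynomial.monomial s a : Poly) = a • MvPolynomial.monomial s 1 := by
      simp [MvPolynomial.smul_monomial]
    have h2 : poincare (MvPolynomial.monomial s 1) i =
        MvPolynomial.monomial (s + Finsupp.single i 1) ((s.degree : ℝ) + 3)⁻¹ := by
      have := (MvPolynomial.basisMonomials (Fin 3) ℝ).constr_basis ℝ (fun s =>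
        (MvPolynomial.monomial (s + Finsupp.single i 1) ((s.degree : ℝ) + 3)⁻¹ : Poly)) s
      simpa [poincare] using this
    have h3 : (MvPolynomial.monomial (s + Finsupp.single i 1) ((s.degree : ℝ) + 3)⁻¹ : Poly) =
        ((s.degree : ℝ) + 3)⁻¹ • (MvPolynomial.monomial s 1 * MvPolynomial.X i) := by
      rw [MvPolynomial.X, MvPolynomial.monomial_mul, MvPolynomial.smul_monomial]
      simp
    have h4 : ∀ t : ℝ, t ^ 2 * x i * ev (t • x) (MvPolynomial.monomial s a) =
        (x i * a * ev x (MvPolynomial.monomial s 1)) * t ^ (s.degree + 2) := fun t => by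
      rw [h1, map_smul, ev_monomial_smul, smul_eq_mul]; ring
    simp only [h4]
    rw [intervalIntegral.integral_const_mul, integral_pow, h1, map_smul, Pi.smul_apply, h2, h3,
      map_smul, map_smul]
    have h5 : ev x (MvPolynomial.monomial s 1 * MvPolynomial.X i) =
        ev x (MvPolynomial.monomial s 1) * x i := by simp [ev]
    rw [h5]
    have : (s.degree : ℝ) + 3 ≠ 0 := by positivity
    push_cast
    simp only [smul_eq_mul]
    field_simp
    ring
  | add p q hp hq =>
    simp only [map_add, Pi.add_apply, mul_add]
    rw [hp, hq, intervalIntegral.integral_add (hi p) (hi q)]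

/-! ### Integrals over edges and faces -/

/-- The mean value of `u` over the edge `[a, b]`, i.e. `(1 / length) ∫ u ds`. -/
def edgeInt (a b : E3) : Poly →ₗ[ℝ] ℝ where
  toFun u := ∫ t in (0 : ℝ)..1, ev (a + t • (b - a)) u
  map_add' u v := by
    simp only [map_add]
    exact intervalIntegral.integral_add
      (Continuous.intervalIntegrable (continuous_ev u (by fun_prop)) _ _)
      (Continuous.intervalIntegrable (continuous_ev v (by fun_prop)) _ _)
  map_smul' c u := by simp

theorem continuous_faceInt_aux (a b c : E3) (u : Poly) : Continuous fun s : ℝ =>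
    ∫ t in (0 : ℝ)..(1 - s), ev (a + s • (b - a) + t • (c - a)) u :=
  intervalIntegral.continuous_parametric_intervalIntegral_of_continuous
    (continuous_ev u (by fun_prop)) (by fun_prop)

/-- The integral of `u` over the triangle `[a, b, c]`, pulled back to the reference triangle
`{(s, t) : 0 ≤ s, 0 ≤ t, s + t ≤ 1}`, i.e. `(1 / (2 area)) ∫ u dA`. -/
def faceInt (a b c : E3) : Poly →ₗ[ℝ] ℝ where
  toFun u := ∫ s in (0 : ℝ)..1, ∫ t in (0 : ℝ)..(1 - s), ev (a + s • (b - a) + t • (c - a)) u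
  map_add' u v := by
    have h : ∀ s : ℝ, (∫ t in (0 : ℝ)..(1 - s), ev (a + s • (b - a) + t • (c - a)) (u + v)) =
        (∫ t in (0 : ℝ)..(1 - s), ev (a + s • (b - a) + t • (c - a)) u) +
        ∫ t in (0 : ℝ)..(1 - s), ev (a + s • (b - a) + t • (c - a)) v := fun s => by
      simp only [map_add]
      exact intervalIntegral.integral_add
        (Continuous.intervalIntegrable (continuous_ev u (by fun_prop)) _ _)
        (Continuous.intervalIntegrable (continuous_ev v (by fun_prop)) _ _)
    simp only [h]
    exact intervalIntegral.integral_add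
      ((continuous_faceInt_aux a b c u).intervalIntegrable _ _)
      ((continuous_faceInt_aux a b c v).intervalIntegrable _ _)
  map_smul' c u := by simp

/-- The component `d · u` of a polynomial vector field `u` along a fixed vector `d`. -/
def along (d : Fin 3 → ℝ) : VPoly →ₗ[ℝ] Poly := ∑ i : Fin 3, d i • LinearMap.proj i

/-- The vector `b - a` from `a` to `b`; it is `length • τ` with `τ` the unit tangent of the edge
`[a, b]`. -/
def tangent (a b : E3) : Fin 3 → ℝ := fun i => b i - a i

/-- The vector `(b - a) × (c - a)`; it is `(2 area) • n` with `n` a unit normal of the triangle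
`[a, b, c]`. -/
def normal (a b c : E3) : Fin 3 → ℝ := crossProduct (tangent a b) (tangent a c)

/-! ### Shape functions -/

/-- `P_r`: the polynomials of degree at most `r`. -/
def lagrangeShape (r : ℕ) : Submodule ℝ Poly := MvPolynomial.restrictTotalDegree (Fin 3) ℝ r

/-- The homogeneous vector polynomials `p` of degree `r` with `x · p = 0`. -/
def koszulShape (r : ℕ) : Submodule ℝ VPoly :=
  Submodule.pi Set.univ (fun _ => MvPolynomial.homogeneousSubmodule (Fin 3) ℝ r) ⊓
    LinearMap.ker (∑ i : Fin 3, LinearMap.mulLeft ℝ (MvPolynomial.X i : Poly) ∘ₗ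
      LinearMap.proj i : VPoly →ₗ[ℝ] Poly)

/-- The first-kind Nédélec shape functions `R_r = (P_{r-1})³ ⊕ {p ∈ (P̃_r)³ : x · p = 0}`
(for `r ≥ 1`). -/
def nedelecShape (r : ℕ) : Submodule ℝ VPoly :=
  Submodule.pi Set.univ (fun _ => lagrangeShape (r - 1)) ⊔ koszulShape r

/-- `B` is the bubble function of the tetrahedron with vertex set `K`: the product of the
barycentric coordinates, i.e. of the affine functions `lam v` with value `1` at the vertex `v` and
`0` at the other vertices. -/
def IsBubble (K : Finset E3) (B : Poly) : Prop :=
  ∃ lam : E3 → Poly, (∀ v ∈ K, (lam v).totalDegree ≤ 1 ∧ ev v (lam v) = 1 ∧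
    ∀ w ∈ K, w ≠ v → ev w (lam v) = 0) ∧ B = ∏ v ∈ K, lam v

/-- The shape functions of `Σ_h^{+,k-1}` on the tetrahedron with vertex set `K`: the polynomials of
degree at most `k - 1`, enriched with the bubble function if `k < 5` (for `k ≥ 2`). -/
def lagrangePlusShape (k : ℕ) (K : Finset E3) : Submodule ℝ Poly :=
  if 5 ≤ k then lagrangeShape (k - 1)
  else lagrangeShape (k - 1) ⊔ Submodule.span ℝ {B | IsBubble K B}

/-- The shape functions `∇ × R_r + 𝔭 Σ_h^{+,k-1}(K)` of `W_h^{r-1,k}` on the tetrahedron with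
vertex set `K`. -/
def gradDivShape (r k : ℕ) (K : Finset E3) : Submodule ℝ VPoly :=
  (nedelecShape r).map curl ⊔ (lagrangePlusShape k K).map poincare

/-! ### Gluing by degrees of freedom

A piecewise polynomial is a family of polynomials, one for each cell. The global finite element
spaces consist of the families of shape functions for which the degrees of freedom attached to a
vertex, edge or face agree on all the cells that contain this vertex, edge or face. (Interior degrees
of freedom are attached to a single cell, so there is nothing to glue.) -/

section Glue

variable {Ω : Set E3} (T : TetMesh Ω)

/-- Equality on all cells of the degrees of freedom of the Lagrange element of degree `m`: vertex
values, edge moments against `P_{m-2}` and face moments against `P_{m-3}`. -/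
def lagrangeGlue (m : ℕ) : Submodule ℝ (T.Cell → Poly) where
  carrier := {u | ∀ K K' : T.Cell,
    (∀ a ∈ K.verts, a ∈ K'.verts → ev a (u K) = ev a (u K')) ∧
    (∀ a b : E3, a ≠ b → {a, b} ⊆ K.verts → {a, b} ⊆ K'.verts →
      ∀ q : Poly, q.totalDegree + 2 ≤ m → edgeInt a b (u K * q) = edgeInt a b (u K' * q)) ∧
    (∀ a b c : E3, a ≠ b → a ≠ c → b ≠ c → {a, b, c} ⊆ K.verts → {a, b, c} ⊆ K'.verts →
      ∀ q : Poly, q.totalDegree + 3 ≤ m → faceInt a b c (u K * q) = faceInt a b c (u K' * q))}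
  add_mem' := by
    intro u v hu hv K K'
    obtain ⟨h1, h2, h3⟩ := hu K K'
    obtain ⟨g1, g2, g3⟩ := hv K K'
    refine ⟨fun a ha ha' => ?_, fun a b hab h h' q hq => ?_,
      fun a b c hab hac hbc h h' q hq => ?_⟩
    · simp only [Pi.add_apply, map_add, h1 a ha ha', g1 a ha ha']
    · simp only [Pi.add_apply, add_mul, map_add, h2 a b hab h h' q hq, g2 a b hab h h' q hq]
    · simp only [Pi.add_apply, add_mul, map_add, h3 a b c hab hac hbc h h' q hq,
        g3 a b c hab hac hbc h h' q hq]
  zero_mem' := fun K K' => by simp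
  smul_mem' := by
    intro r u hu K K'
    obtain ⟨h1, h2, h3⟩ := hu K K'
    refine ⟨fun a ha ha' => ?_, fun a b hab h h' q hq => ?_,
      fun a b c hab hac hbc h h' q hq => ?_⟩
    · simp only [Pi.smul_apply, map_smul, h1 a ha ha']
    · simp only [Pi.smul_apply, smul_mul_assoc, map_smul, h2 a b hab h h' q hq]
    · simp only [Pi.smul_apply, smul_mul_assoc, map_smul, h3 a b c hab hac hbc h h' q hq]

/-- Equality on all cells of the edge and face degrees of freedom of the first-kind Nédélec element:
tangential moments against `P_{r-1}` on edges, and moments against the tangential vector fields with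
coefficients in `P_{r-2}` on faces. (With all orderings of the vertices of a face, the fields
`q (b - a)`, `q ∈ P_{r-2}`, span the tangential vector fields of degree `r - 2`.) -/
def nedelecGlue (r : ℕ) : Submodule ℝ (T.Cell → VPoly) where
  carrier := {u | ∀ K K' : T.Cell,
    (∀ a b : E3, a ≠ b → {a, b} ⊆ K.verts → {a, b} ⊆ K'.verts →
      ∀ q : Poly, q.totalDegree + 1 ≤ r →
        edgeInt a b (along (tangent a b) (u K) * q) =
          edgeInt a b (along (tangent a b) (u K') * q)) ∧
    (∀ a b c : E3, a ≠ b → a ≠ c → b ≠ c → {a, b, c} ⊆ K.verts → {a, b, c} ⊆ K'.verts →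
      ∀ q : Poly, q.totalDegree + 2 ≤ r →
        faceInt a b c (along (tangent a b) (u K) * q) =
          faceInt a b c (along (tangent a b) (u K') * q))}
  add_mem' := by
    intro u v hu hv K K'
    obtain ⟨h2, h3⟩ := hu K K'
    obtain ⟨g2, g3⟩ := hv K K'
    refine ⟨fun a b hab h h' q hq => ?_, fun a b c hab hac hbc h h' q hq => ?_⟩
    · simp only [Pi.add_apply, add_mul, map_add, h2 a b hab h h' q hq, g2 a b hab h h' q hq]
    · simp only [Pi.add_apply, add_mul, map_add, h3 a b c hab hac hbc h h' q hq,
        g3 a b c hab hac hbc h h' q hq]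
  zero_mem' := fun K K' => by simp
  smul_mem' := by
    intro r u hu K K'
    obtain ⟨h2, h3⟩ := hu K K'
    refine ⟨fun a b hab h h' q hq => ?_, fun a b c hab hac hbc h h' q hq => ?_⟩
    · simp only [Pi.smul_apply, smul_mul_assoc, map_smul, h2 a b hab h h' q hq]
    · simp only [Pi.smul_apply, smul_mul_assoc, map_smul, h3 a b c hab hac hbc h h' q hq]

/-- Equality on all cells of the normal moments against `P_{r-1}` on faces. -/
def normalGlue (r : ℕ) : Submodule ℝ (T.Cell → VPoly) where
  carrier := {u | ∀ K K' : T.Cell,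
    ∀ a b c : E3, a ≠ b → a ≠ c → b ≠ c → {a, b, c} ⊆ K.verts → {a, b, c} ⊆ K'.verts →
      ∀ q : Poly, q.totalDegree + 1 ≤ r →
        faceInt a b c (along (normal a b c) (u K) * q) =
          faceInt a b c (along (normal a b c) (u K') * q)}
  add_mem' := by
    intro u v hu hv K K' a b c hab hac hbc h h' q hq
    simp only [Pi.add_apply, add_mul, map_add, hu K K' a b c hab hac hbc h h' q hq,
      hv K K' a b c hab hac hbc h h' q hq]
  zero_mem' := fun K K' => by simp
  smul_mem' := by
    intro r u hu K K' a b c hab hac hbc h h' q hq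
    simp only [Pi.smul_apply, smul_mul_assoc, map_smul, hu K K' a b c hab hac hbc h h' q hq]

/-! ### The global complex -/

/-- The inclusion of the constants into the piecewise polynomials. -/
def constH : ℝ →ₗ[ℝ] (T.Cell → Poly) := LinearMap.pi fun _ => Algebra.linearMap ℝ Poly

/-- The gradient, cell by cell. -/
def gradH : (T.Cell → Poly) →ₗ[ℝ] (T.Cell → VPoly) := grad.compLeft T.Cell

/-- The curl, cell by cell. -/
def curlH : (T.Cell → VPoly) →ₗ[ℝ] (T.Cell → VPoly) := curl.compLeft T.Cell

/-- The divergence, cell by cell. -/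
def divH : (T.Cell → VPoly) →ₗ[ℝ] (T.Cell → Poly) := div.compLeft T.Cell

/-- The Lagrange space `Σ_h^r`. -/
def lagrangeSpace (r : ℕ) : Submodule ℝ (T.Cell → Poly) :=
  Submodule.pi Set.univ (fun _ => lagrangeShape r) ⊓ lagrangeGlue T r

/-- The first-kind Nédélec space `V_h^r`. -/
def nedelecSpace (r : ℕ) : Submodule ℝ (T.Cell → VPoly) :=
  Submodule.pi Set.univ (fun _ => nedelecShape r) ⊓ nedelecGlue T r

/-- The grad-div space `W_h^{r-1,k}`: its vertex, edge and face degrees of freedom are those of the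
divergence in the Lagrange element of degree `k - 1` (vertex values, moments against `P_{k-3}` on
edges and `P_{k-4}` on faces), and the normal moments against `P_{r-1}` on faces. -/
def gradDivSpace (r k : ℕ) : Submodule ℝ (T.Cell → VPoly) :=
  Submodule.pi Set.univ (fun K => gradDivShape r k K.verts) ⊓
    (lagrangeGlue T (k - 1)).comap (divH T) ⊓ normalGlue T r

/-- The space `Σ_h^{+,k-1}`: Lagrange elements of degree `k - 1`, enriched with a bubble function on
each cell if `k < 5`. -/
def lagrangePlusSpace (k : ℕ) : Submodule ℝ (T.Cell → Poly) :=
  Submodule.pi Set.univ (fun K => lagrangePlusShape k K.verts) ⊓ lagrangeGlue T (k - 1)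

end Glue

end QuadDiv

end

noncomputable section

namespace QuadDiv

/-! ### Integration by parts for polynomials on edges and triangles -/

section Calculus

open MvPolynomial

/-! ### Evaluation and directional derivatives -/

/-! Each operator respects the gluing because integration by parts turns the moments of one space
into those of the next: the fundamental theorem of calculus on edges for the gradient, Stokes'
theorem on triangles (`faceInt_curl_mul`) for the curl. On one tetrahedron exactness is algebra:
Euler's identity gives polynomial potentials of curl-free fields, and `div_poincare` shows that a
divergence-free shape function is a curl. What remains is to glue the local preimages.

For the gradient, the local potentials differ by constants on common vertices. These differences
form a closed 1-cochain of the mesh, and `TetMesh.exists_potential` corrects them to agree at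
vertices; the other Lagrange moments then agree by `LagrangeVanish.of_grad`. For the curl, the edge
integrals of local preimages have the same sum around every common face, and
`TetMesh.exists_circulation` supplies edge values common to all cells. The freedom of adding
gradients is used to attain these values and to impose normalisations that depend on the edge or
face alone (`IsBarycentric.exists_gauge`). By `nedelecVanish_of_gauge` the curl and these data
determine all shared Nédélec moments.

The vanishing of the two cohomology groups is proved by hand. The closure is pushed into the domain
and contracted in small steps; points are labelled by vertices of their carriers, a discrete
simplicial approximation. The prism operator along the contraction writes a cocycle as a coboundary
on small simplices, and summation over an iterated subdivision carries this to the mesh simplices.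

For the divergence, `poincare` is a right inverse on each cell, but the normal moments do not match
across faces. A curl is added to replace them by moments common to both sides. On one cell the flux
moments of a curl can be prescribed on all faces as long as the total flux vanishes
(`IsBarycentric.exists_flux`). Common fluxes with the totals dictated by the divergence exist by
duality (`TetMesh.exists_bdry_eq`): a cellwise constant orthogonal to all total fluxes agrees across
faces, and the flux of the position field then shows that it is zero. -/

theorem ev_mul (x : E3) (p q : Poly) : ev x (p * q) = ev x p * ev x q := by simp [ev]

@[simp]
theorem ev_C (x : E3) (c : ℝ) : ev x (C c) = c := by simp [ev]

@[simp]
theorem ev_X (x : E3) (i : Fin 3) : ev x (X i) = x i := by simp [ev]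

/-- The derivative of a polynomial in the direction `d`. -/
def dirDeriv (d : Fin 3 → ℝ) : Derivation ℝ Poly Poly :=
  d 0 • pderiv 0 + d 1 • pderiv 1 + d 2 • pderiv 2

theorem dirDeriv_apply (d : Fin 3 → ℝ) (p : Poly) :
    dirDeriv d p = d 0 • pderiv 0 p + d 1 • pderiv 1 p + d 2 • pderiv 2 p := rfl

theorem along_apply (d : Fin 3 → ℝ) (v : VPoly) :
    along d v = d 0 • v 0 + d 1 • v 1 + d 2 • v 2 := by
  simp [along, Fin.sum_univ_three]

theorem grad_apply (p : Poly) (i : Fin 3) : grad p i = pderiv i p := rfl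

theorem along_grad (d : Fin 3 → ℝ) (p : Poly) : along d (grad p) = dirDeriv d p := by
  simp [along_apply, dirDeriv_apply, grad_apply]

theorem dirDeriv_mul (d : Fin 3 → ℝ) (p q : Poly) :
    dirDeriv d (p * q) = dirDeriv d p * q + p * dirDeriv d q := by
  rw [Derivation.leibniz, smul_eq_mul, smul_eq_mul]; ring

theorem dirDeriv_C (d : Fin 3 → ℝ) (c : ℝ) : dirDeriv d (C c) = 0 :=
  (dirDeriv d).map_algebraMap c

/-- The commutator of two derivations is a derivation, so it suffices that it kills the variables.
-/
theorem pderiv_comm (i j : Fin 3) (p : Poly) : pderiv i (pderiv j p) = pderiv j (pderiv i p) := by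
  have h : ⁅(pderiv i : Derivation ℝ Poly Poly), (pderiv j : Derivation ℝ Poly Poly)⁆ = 0 := by
    refine MvPolynomial.derivation_ext fun k => ?_
    rw [Derivation.commutator_apply]
    simp [pderiv_X, Pi.single_apply, apply_ite]
  have := congrArg (fun D : Derivation ℝ Poly Poly => D p) h
  simpa [Derivation.commutator_apply, sub_eq_zero] using this

theorem dirDeriv_comm (d e : Fin 3 → ℝ) (p : Poly) :
    dirDeriv d (dirDeriv e p) = dirDeriv e (dirDeriv d p) := by
  simp only [dirDeriv_apply, map_add, Derivation.map_smul, pderiv_comm 1 0, pderiv_comm 2 0, pderiv_comm 2 1]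
  module

theorem dirDeriv_add_left (d e : Fin 3 → ℝ) (p : Poly) :
    dirDeriv (d + e) p = dirDeriv d p + dirDeriv e p := by
  simp only [dirDeriv_apply, Pi.add_apply]; module

theorem dirDeriv_neg_left (d : Fin 3 → ℝ) (p : Poly) : dirDeriv (-d) p = -dirDeriv d p := by
  simp only [dirDeriv_apply, Pi.neg_apply]; module

theorem dirDeriv_sub_left (d e : Fin 3 → ℝ) (p : Poly) :
    dirDeriv (d - e) p = dirDeriv d p - dirDeriv e p := by
  simp only [dirDeriv_apply, Pi.sub_apply]; module

theorem along_neg_left (d : Fin 3 → ℝ) (v : VPoly) : along (-d) v = -along d v := by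
  simp only [along_apply, Pi.neg_apply]; module

theorem along_sub_left (d e : Fin 3 → ℝ) (v : VPoly) : along (d - e) v = along d v - along e v := by
  simp only [along_apply, Pi.sub_apply]; module

theorem tangent_swap (a b : E3) : tangent b a = -tangent a b := by
  ext i; simp [tangent]

theorem tangent_sub (a b c : E3) : tangent a c - tangent a b = tangent b c := by
  ext i; simp [tangent]

theorem tangent_self (a : E3) : tangent a a = 0 := by
  ext i; simp [tangent]

theorem totalDegree_pderiv_lt (i : Fin 3) (p : Poly) :
    pderiv i p = 0 ∨ (pderiv i p).totalDegree + 1 ≤ p.totalDegree := by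
  by_cases h : pderiv i p = 0
  · exact Or.inl h
  right
  obtain ⟨s, hs, hs'⟩ := (pderiv i p).support.exists_mem_eq_sup
    (by simpa [Finset.nonempty_iff_ne_empty] using h) (fun s => s.sum fun _ e => e)
  have h1 : (pderiv i p).totalDegree = s.sum fun _ e => e := hs'
  have h2 : s + Finsupp.single i 1 ∈ p.support := by
    rw [mem_support_iff] at hs ⊢
    intro h0
    rw [coeff_pderiv, h0] at hs
    simp at hs
  have h3 := le_totalDegree h2
  rw [Finsupp.sum_add_index' (by simp) (by simp), Finsupp.sum_single_index (by simp)] at h3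
  omega

theorem totalDegree_pderiv_le (i : Fin 3) (p : Poly) :
    (pderiv i p).totalDegree ≤ p.totalDegree - 1 := by
  rcases totalDegree_pderiv_lt i p with h | h
  · simp [h]
  · omega

theorem totalDegree_dirDeriv_le (d : Fin 3 → ℝ) (p : Poly) :
    (dirDeriv d p).totalDegree ≤ p.totalDegree - 1 := by
  rw [dirDeriv_apply]
  refine (totalDegree_add _ _).trans (max_le ((totalDegree_add _ _).trans (max_le ?_ ?_)) ?_) <;>
  exact (totalDegree_smul_le _ _).trans (totalDegree_pderiv_le _ p)

theorem dirDeriv_of_totalDegree_eq_zero (d : Fin 3 → ℝ) {p : Poly} (h : p.totalDegree = 0) :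
    dirDeriv d p = 0 := by
  rw [totalDegree_eq_zero_iff_eq_C.1 h, dirDeriv_C]

theorem totalDegree_dirDeriv_lt (d : Fin 3 → ℝ) (p : Poly) :
    dirDeriv d p = 0 ∨ (dirDeriv d p).totalDegree + 1 ≤ p.totalDegree := by
  by_cases h : p.totalDegree = 0
  · exact Or.inl (dirDeriv_of_totalDegree_eq_zero d h)
  · have := totalDegree_dirDeriv_le d p
    right; omega

theorem hasDerivAt_ev_line (x e : E3) (p : Poly) (t : ℝ) :
    HasDerivAt (fun t : ℝ => ev (x + t • e) p) (ev (x + t • e) (dirDeriv (fun i => e i) p)) t := by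
  induction p using MvPolynomial.induction_on with
  | C c => simpa [dirDeriv_C] using hasDerivAt_const t c
  | add p q hp hq => simp only [map_add]; exact hp.add hq
  | mul_X p i hp =>
    have h1 : HasDerivAt (fun t : ℝ => (x + t • e) i) (e i) t := by
      simpa using ((hasDerivAt_id t).mul_const (e i)).const_add (x i)
    have h2 : dirDeriv (fun i => e i) (X i) = C (e i) := by
      fin_cases i <;> simp [dirDeriv_apply, pderiv_X, smul_eq_C_mul]
    simp only [dirDeriv_mul, map_add, ev_mul, h2, ev_C, ev_X]
    exact hp.mul h1

theorem continuous_ev_line (x e : E3) (p : Poly) : Continuous fun t : ℝ => ev (x + t • e) p :=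
  continuous_ev p (by fun_prop)

theorem tangent_eq (a b : E3) : tangent a b = fun i => (b - a) i := rfl

/-! ### The fundamental theorem of calculus on edges and faces -/

theorem edgeInt_dirDeriv (a b : E3) (F : Poly) :
    edgeInt a b (dirDeriv (tangent a b) F) = ev b F - ev a F := by
  have h := intervalIntegral.integral_eq_sub_of_hasDerivAt
    (fun t _ => hasDerivAt_ev_line a (b - a) F t)
    ((continuous_ev_line a (b - a) _).intervalIntegrable 0 1)
  simp only [one_smul, zero_smul, add_zero, add_sub_cancel] at h
  exact h

theorem edgeInt_swap (a b : E3) (p : Poly) : edgeInt b a p = edgeInt a b p := by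
  have h := intervalIntegral.integral_comp_sub_left (a := 0) (b := 1)
    (fun t : ℝ => ev (a + t • (b - a)) p) 1
  simp only [sub_zero, sub_self] at h
  refine Eq.trans ?_ h
  change (∫ t in (0 : ℝ)..1, ev (b + t • (a - b)) p) = _
  congr 1
  funext t
  rw [show b + t • (a - b) = a + (1 - t) • (b - a) by module]

theorem faceInt_dirDeriv_inner (a b c : E3) (F : Poly) :
    faceInt a b c (dirDeriv (tangent a c) F) = edgeInt c b F - edgeInt a b F := by
  have h : ∀ s : ℝ, (∫ t in (0 : ℝ)..(1 - s),
      ev (a + s • (b - a) + t • (c - a)) (dirDeriv (tangent a c) F)) =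
      ev (c + s • (b - c)) F - ev (a + s • (b - a)) F := fun s => by
    have h := intervalIntegral.integral_eq_sub_of_hasDerivAt
      (fun t _ => hasDerivAt_ev_line (a + s • (b - a)) (c - a) F t)
      ((continuous_ev_line (a + s • (b - a)) (c - a) _).intervalIntegrable 0 (1 - s))
    have e1 : a + s • (b - a) + (1 - s) • (c - a) = c + s • (b - c) := by module
    rw [e1, zero_smul, add_zero] at h
    exact h
  change (∫ s in (0 : ℝ)..1, ∫ t in (0 : ℝ)..(1 - s), _) = _
  simp only [h]
  exact intervalIntegral.integral_sub ((continuous_ev_line _ _ _).intervalIntegrable _ _)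
    ((continuous_ev_line _ _ _).intervalIntegrable _ _)

/-! ### Antiderivatives of polynomials in a direction -/

/-- Repeated integration by parts: `D (l ^ (j + 1) * q) = (j + 1) l ^ j q + l ^ (j + 1) D q`, and
the last term is integrated by induction on the degree. The power `j` is there to let this induction
close. The clause on directions `e` says that the antiderivative depends on no variable on which `l`
and `q` do not depend. -/
theorem exists_dirDeriv_pow_mul_eq {d : Fin 3 → ℝ} {l : Poly} (hl : l.totalDegree ≤ 1)
    (hdl : dirDeriv d l = 1) (m : ℕ) : ∀ (q : Poly), q.totalDegree ≤ m → ∀ j : ℕ,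
    ∃ g : Poly, g.totalDegree ≤ m ∧ dirDeriv d (l ^ (j + 1) * g) = l ^ j * q ∧
      ∀ e : Fin 3 → ℝ, dirDeriv e l = 0 → dirDeriv e q = 0 → dirDeriv e g = 0 := by
  have hpow : ∀ j : ℕ, dirDeriv d (l ^ (j + 1)) = ((j : ℝ) + 1) • l ^ j := fun j => by
    rw [Derivation.leibniz_pow, hdl]
    simp [← Nat.cast_smul_eq_nsmul ℝ]
  have hj : ∀ j : ℕ, (j : ℝ) + 1 ≠ 0 := fun j => by positivity
  induction m with
  | zero =>
    intro q hq j
    refine ⟨((j : ℝ) + 1)⁻¹ • q, (totalDegree_smul_le _ _).trans hq, ?_, fun e _ he => by simp [he]⟩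
    rw [mul_smul_comm, Derivation.map_smul, dirDeriv_mul, hpow,
      dirDeriv_of_totalDegree_eq_zero d (Nat.le_zero.1 hq), mul_zero, add_zero, smul_mul_assoc,
      inv_smul_smul₀ (hj j)]
  | succ m ih =>
    intro q hq j
    obtain ⟨g, hg, hdg, hinv⟩ := ih (dirDeriv d q) ((totalDegree_dirDeriv_le d q).trans (by omega))
      (j + 1)
    refine ⟨((j : ℝ) + 1)⁻¹ • (q - l * g), (totalDegree_smul_le _ _).trans ?_, ?_, ?_⟩
    · refine (totalDegree_sub _ _).trans (max_le hq ((totalDegree_mul _ _).trans (by omega)))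
    · have e1 : l ^ (j + 1) * (q - l * g) = l ^ (j + 1) * q - l ^ (j + 1 + 1) * g := by ring
      rw [mul_smul_comm, Derivation.map_smul, e1, map_sub, hdg, dirDeriv_mul, hpow, add_sub_cancel_right,
        smul_mul_assoc, inv_smul_smul₀ (hj j)]
    · intro e hel heq
      have := hinv e hel (by rw [dirDeriv_comm, heq, map_zero])
      rw [Derivation.map_smul, map_sub, heq, dirDeriv_mul, hel, this]
      simp

theorem exists_linear_dirDeriv_eq_one {d : Fin 3 → ℝ} (hd : d ≠ 0) :
    ∃ l : Poly, l.totalDegree ≤ 1 ∧ dirDeriv d l = 1 := by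
  obtain ⟨i, hi⟩ := Function.ne_iff.1 hd
  refine ⟨(d i)⁻¹ • X i, (totalDegree_smul_le _ _).trans (totalDegree_X i).le, ?_⟩
  have h2 : dirDeriv d (X i) = d i • 1 := by
    fin_cases i <;> simp [dirDeriv_apply, pderiv_X]
  rw [Derivation.map_smul, h2, inv_smul_smul₀ hi]

theorem exists_dirDeriv_eq {d : Fin 3 → ℝ} (hd : d ≠ 0) (q : Poly) :
    ∃ Q : Poly, Q.totalDegree ≤ q.totalDegree + 1 ∧ dirDeriv d Q = q := by
  obtain ⟨l, hl, hdl⟩ := exists_linear_dirDeriv_eq_one hd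
  obtain ⟨g, hg, h, -⟩ := exists_dirDeriv_pow_mul_eq hl hdl _ q le_rfl 0
  refine ⟨l * g, (totalDegree_mul _ _).trans (by omega), by simpa using h⟩

/-- Needed on faces, where a test polynomial must be integrated in one direction and stay constant
in the other. -/
theorem exists_dirDeriv_eq_of_dirDeriv_eq_zero {d e : Fin 3 → ℝ} {l : Poly}
    (hl : l.totalDegree ≤ 1) (hdl : dirDeriv d l = 1) (hel : dirDeriv e l = 0) {q : Poly}
    (hq : dirDeriv e q = 0) :
    ∃ Q : Poly, Q.totalDegree ≤ q.totalDegree + 1 ∧ dirDeriv d Q = q ∧ dirDeriv e Q = 0 := by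
  obtain ⟨g, hg, h, h'⟩ := exists_dirDeriv_pow_mul_eq hl hdl _ q le_rfl 0
  refine ⟨l * g, (totalDegree_mul _ _).trans (by omega), by simpa using h, ?_⟩
  rw [dirDeriv_mul, hel, h' e hel hq]; simp

/-- Modulo multiples of `l`, every polynomial is constant in the direction `d`. -/
theorem exists_eq_add_mul {d : Fin 3 → ℝ} {l : Poly} (hl : l.totalDegree ≤ 1)
    (hdl : dirDeriv d l = 1) (q : Poly) :
    ∃ R g : Poly, q = R + l * g ∧ dirDeriv d R = 0 ∧ R.totalDegree ≤ q.totalDegree ∧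
      (g = 0 ∨ g.totalDegree + 1 ≤ q.totalDegree) := by
  rcases totalDegree_dirDeriv_lt d q with h | h
  · exact ⟨q, 0, by simp, h, le_rfl, Or.inl rfl⟩
  · obtain ⟨g, hg, hdg, -⟩ := exists_dirDeriv_pow_mul_eq hl hdl _ (dirDeriv d q) le_rfl 0
    simp only [zero_add, pow_one, pow_zero, one_mul] at hdg
    refine ⟨q - l * g, g, by ring, by rw [map_sub, hdg, sub_self], ?_, Or.inr (by omega)⟩
    exact (totalDegree_sub _ _).trans (max_le le_rfl ((totalDegree_mul _ _).trans (by omega)))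

/-! ### Stokes' theorem on a triangle -/

theorem tangent_ne_zero {a b : E3} (h : a ≠ b) : tangent a b ≠ 0 := by
  intro h0
  apply h
  ext i
  have := congrFun h0 i
  simp only [tangent, Pi.zero_apply] at this
  linarith

/-- Only the inner variable is directly accessible to the fundamental theorem of calculus. Writing
`F` as a derivative along `[a, c]` and commuting the derivatives reduces the outer direction to the
inner one, without exchanging integrals. -/
theorem faceInt_dirDeriv_outer {a c : E3} (b : E3) (hac : a ≠ c) (F : Poly) :
    faceInt a b c (dirDeriv (tangent a b) F) = edgeInt c b F - edgeInt a c F := by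
  obtain ⟨G, -, rfl⟩ := exists_dirDeriv_eq (tangent_ne_zero hac) F
  have h : dirDeriv (tangent a b) G =
      dirDeriv (tangent c b) G + dirDeriv (tangent a c) G := by
    rw [← dirDeriv_add_left]
    congr 2
    ext i
    simp [tangent]
  rw [dirDeriv_comm, faceInt_dirDeriv_inner, edgeInt_dirDeriv, edgeInt_dirDeriv, h, map_add,
    edgeInt_dirDeriv]
  ring

/-- Every polynomial is a derivative along `[a, b]`. That direction is outer for one ordering and
inner for the other, and both give the same edge integrals. -/
theorem faceInt_swap_right {a b c : E3} (hab : a ≠ b) (hac : a ≠ c) (p : Poly) :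
    faceInt a c b p = faceInt a b c p := by
  obtain ⟨F, -, rfl⟩ := exists_dirDeriv_eq (tangent_ne_zero hab) p
  rw [faceInt_dirDeriv_outer b hac, faceInt_dirDeriv_inner, edgeInt_swap]

theorem faceInt_swap_left {a b c : E3} (hab : a ≠ b) (hac : a ≠ c) (hbc : b ≠ c) (p : Poly) :
    faceInt b a c p = faceInt a b c p := by
  obtain ⟨F, -, rfl⟩ := exists_dirDeriv_eq (tangent_ne_zero hab) p
  rw [faceInt_dirDeriv_outer b hac, tangent_swap, dirDeriv_neg_left, map_neg,
    faceInt_dirDeriv_outer a hbc, edgeInt_swap, edgeInt_swap c b]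
  ring

theorem faceInt_perm {a b c a' b' c' : E3} (hab : a ≠ b) (hac : a ≠ c) (hbc : b ≠ c)
    (h : ({a', b', c'} : Finset E3) = {a, b, c}) (p : Poly) :
    faceInt a' b' c' p = faceInt a b c p := by
  have hcard : ({a', b', c'} : Finset E3).card = 3 := by
    rw [h]; exact Finset.card_eq_three.2 ⟨a, b, c, hab, hac, hbc, rfl⟩
  have hab' : a' ≠ b' := by
    rintro rfl
    rw [Finset.insert_eq_of_mem (Finset.mem_insert_self _ _)] at hcard
    have := Finset.card_le_two (a := a') (b := c')
    omega
  have hac' : a' ≠ c' := by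
    rintro rfl
    rw [Finset.insert_eq_of_mem (by simp)] at hcard
    have := Finset.card_le_two (a := b') (b := a')
    omega
  have hbc' : b' ≠ c' := by
    rintro rfl
    rw [Finset.pair_eq_singleton] at hcard
    have := Finset.card_le_two (a := a') (b := b')
    omega
  have ha' : a' ∈ ({a, b, c} : Finset E3) := h ▸ by simp
  have hb' : b' ∈ ({a, b, c} : Finset E3) := h ▸ by simp
  have hc' : c' ∈ ({a, b, c} : Finset E3) := h ▸ by simp
  simp only [Finset.mem_insert, Finset.mem_singleton] at ha' hb' hc'
  have r1 := faceInt_swap_right hab hac p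
  have r2 := faceInt_swap_right hab.symm hbc p
  have r3 := faceInt_swap_right hac.symm hbc.symm p
  have l1 := faceInt_swap_left hab hac hbc p
  have l2 := faceInt_swap_left hac hab hbc.symm p
  clear h hcard
  rcases ha' with rfl | rfl | rfl <;> rcases hb' with rfl | rfl | rfl <;>
    rcases hc' with rfl | rfl | rfl <;> first | contradiction | linarith

/-- The tangential form of Stokes' integrand. The normal is the unnormalised cross product, which
makes this a polynomial identity. -/
theorem along_normal_curl (a b c : E3) (v : VPoly) :
    along (normal a b c) (curl v) =
      dirDeriv (tangent a b) (along (tangent a c) v) -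
        dirDeriv (tangent a c) (along (tangent a b) v) := by
  have h0 : normal a b c 0 = tangent a b 1 * tangent a c 2 - tangent a b 2 * tangent a c 1 := by
    simp [normal, crossProduct]
  have h1 : normal a b c 1 = tangent a b 2 * tangent a c 0 - tangent a b 0 * tangent a c 2 := by
    simp [normal, crossProduct]
  have h2 : normal a b c 2 = tangent a b 0 * tangent a c 1 - tangent a b 1 * tangent a c 0 := by
    simp [normal, crossProduct]
  have c0 : curl v 0 = pderiv 1 (v 2) - pderiv 2 (v 1) := rfl
  have c1 : curl v 1 = pderiv 2 (v 0) - pderiv 0 (v 2) := rfl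
  have c2 : curl v 2 = pderiv 0 (v 1) - pderiv 1 (v 0) := rfl
  simp only [along_apply, dirDeriv_apply, map_add, Derivation.map_smul, h0, h1, h2, c0, c1, c2]
  module

/-- Stokes' theorem for the curl of a field on a triangle, with a test polynomial. -/
theorem faceInt_curl_mul {a b c : E3} (hac : a ≠ c) (v : VPoly) (q : Poly) :
    faceInt a b c (along (normal a b c) (curl v) * q) =
      edgeInt a b (along (tangent a b) v * q) + edgeInt b c (along (tangent b c) v * q) -
        edgeInt a c (along (tangent a c) v * q) -
        faceInt a b c (along (tangent a c) v * dirDeriv (tangent a b) q) +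
        faceInt a b c (along (tangent a b) v * dirDeriv (tangent a c) q) := by
  have h1 := faceInt_dirDeriv_outer b hac (along (tangent a c) v * q)
  have h2 := faceInt_dirDeriv_inner a b c (along (tangent a b) v * q)
  have h3 : edgeInt b c (along (tangent b c) v * q) =
      edgeInt c b (along (tangent a c) v * q) - edgeInt c b (along (tangent a b) v * q) := by
    rw [edgeInt_swap, ← tangent_sub a b c, along_sub_left, sub_mul, map_sub]
  rw [dirDeriv_mul, map_add] at h1 h2
  rw [along_normal_curl, sub_mul, map_sub, h3]
  linarith

end Calculus

/-! ### Local exactness and the passage of vanishing moments along the operators -/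

section Spaces

open MvPolynomial

/-! ### Local exactness -/

theorem curl_grad (p : Poly) : curl (grad p) = 0 := by
  have h : ∀ i j : Fin 3, pderiv i (grad p j) - pderiv j (grad p i) = 0 := fun i j => by
    rw [grad_apply, grad_apply, pderiv_comm, sub_self]
  ext1 i
  fin_cases i
  · exact h 1 2
  · exact h 2 0
  · exact h 0 1

theorem div_apply (v : VPoly) : div v = pderiv 0 (v 0) + pderiv 1 (v 1) + pderiv 2 (v 2) := by
  simp [div, Fin.sum_univ_three]

theorem div_curl (v : VPoly) : div (curl v) = 0 := by
  rw [div_apply]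
  change pderiv 0 (pderiv 1 (v 2) - pderiv 2 (v 1)) + pderiv 1 (pderiv 2 (v 0) - pderiv 0 (v 2)) +
    pderiv 2 (pderiv 0 (v 1) - pderiv 1 (v 0)) = 0
  simp only [map_sub, pderiv_comm 1 0, pderiv_comm 2 0, pderiv_comm 2 1]
  ring

theorem poincare_monomial (s : Fin 3 →₀ ℕ) (i : Fin 3) :
    poincare (monomial s 1) i = monomial (s + Finsupp.single i 1) ((s.degree : ℝ) + 3)⁻¹ := by
  have := (basisMonomials (Fin 3) ℝ).constr_basis ℝ (fun s =>
    (monomial (s + Finsupp.single i 1) ((s.degree : ℝ) + 3)⁻¹ : Poly)) s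
  simpa [poincare] using this

/-- Euler's identity: the divergence of `x m` is `(deg m + 3) m` for a monomial `m`, which the
factor in `poincare` cancels. -/
theorem div_poincare (p : Poly) : div (poincare p) = p := by
  have h : div ∘ₗ poincare = LinearMap.id := by
    refine (basisMonomials (Fin 3) ℝ).ext fun s => ?_
    have h3 : (s.degree : ℝ) + 3 ≠ 0 := by positivity
    have hd : (s.degree : ℝ) = s 0 + s 1 + s 2 := by
      rw [Finsupp.degree_eq_sum, Fin.sum_univ_three]; push_cast; ring
    simp only [coe_basisMonomials, LinearMap.comp_apply, div_apply, poincare_monomial,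
      pderiv_monomial, add_tsub_cancel_right, Finsupp.add_apply, Finsupp.single_eq_same,
      LinearMap.id_apply]
    rw [← map_add, ← map_add]
    congr 1
    push_cast
    field_simp
    rw [hd]; ring
  exact LinearMap.congr_fun h p

/-- The product `x · v`. -/
def posDot (v : VPoly) : Poly := X 0 * v 0 + X 1 * v 1 + X 2 * v 2

theorem totalDegree_posDot_le {v : VPoly} {m : ℕ} (h : ∀ i, (v i).totalDegree ≤ m) :
    (posDot v).totalDegree ≤ m + 1 := by
  have hi : ∀ i, (X i * v i : Poly).totalDegree ≤ m + 1 := fun i => by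
    refine (totalDegree_mul _ _).trans ?_
    rw [totalDegree_X]
    have := h i
    omega
  exact (totalDegree_add _ _).trans (max_le ((totalDegree_add _ _).trans
    (max_le (hi 0) (hi 1))) (hi 2))

theorem mem_koszulShape {r : ℕ} {v : VPoly} :
    v ∈ koszulShape r ↔ (∀ i, (v i).IsHomogeneous r) ∧ posDot v = 0 := by
  simp [koszulShape, posDot, Fin.sum_univ_three, Submodule.mem_pi]

theorem mem_lagrangeShape {r : ℕ} {p : Poly} : p ∈ lagrangeShape r ↔ p.totalDegree ≤ r :=
  mem_restrictTotalDegree _ _ _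

/-- The Nédélec shape functions are the fields `v` of degree at most `r` such that `x · v` has
degree at most `r`. -/
theorem mem_nedelecShape {r : ℕ} (hr : 1 ≤ r) {v : VPoly} :
    v ∈ nedelecShape r ↔ (∀ i, (v i).totalDegree ≤ r) ∧ (posDot v).totalDegree ≤ r := by
  obtain ⟨r, rfl⟩ := Nat.exists_eq_add_of_le' hr
  constructor
  · intro h
    obtain ⟨y, hy, z, hz, rfl⟩ := Submodule.mem_sup.1 h
    rw [mem_koszulShape] at hz
    have hy' : ∀ i, (y i).totalDegree ≤ r := fun i => by
      simpa [mem_lagrangeShape] using hy i (Set.mem_univ i)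
    refine ⟨fun i => (totalDegree_add _ _).trans (max_le ((hy' i).trans (by omega))
      (hz.1 i).totalDegree_le), ?_⟩
    have e : posDot (y + z) = posDot y + posDot z := by simp only [posDot, Pi.add_apply]; ring
    rw [e, hz.2, add_zero]
    exact totalDegree_posDot_le hy'
  · rintro ⟨hv, hx⟩
    -- The part of top degree is the only candidate for the Koszul summand.
    set z : VPoly := fun i => homogeneousComponent (r + 1) (v i) with hz
    have hzh : ∀ i, (z i).IsHomogeneous (r + 1) := fun i => homogeneousComponent_isHomogeneous _ _
    have hy : ∀ i, (v i - z i).totalDegree ≤ r := fun i => by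
      refine Finset.sup_le fun s hs => ?_
      rw [mem_support_iff, coeff_sub, hz, coeff_homogeneousComponent] at hs
      split_ifs at hs with h
      · simp at hs
      · have h1 := (le_totalDegree (p := v i) (mem_support_iff.2 (by simpa using hs))).trans (hv i)
        have h2 : s.degree = s.sum fun _ e => e := rfl
        omega
    have e : posDot v = posDot (v - z) + posDot z := by simp only [posDot, Pi.sub_apply]; ring
    -- `x · z` is homogeneous of degree `r + 2`, while it differs from `x · v` by a polynomial of
    -- degree at most `r + 1`.
    have hpz : posDot z = 0 := by
      by_contra hne
      have hh : (posDot z).IsHomogeneous (r + 1 + 1) := by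
        have hi : ∀ i, (X i * z i : Poly).IsHomogeneous (r + 1 + 1) := fun i => by
          rw [add_comm (r + 1)]; exact (isHomogeneous_X _ i).mul (hzh i)
        exact ((hi 0).add (hi 1)).add (hi 2)
      have h1 := hh.totalDegree hne
      have h2 : (posDot z).totalDegree ≤ r + 1 := by
        rw [show posDot z = posDot v - posDot (v - z) by rw [e]; ring]
        exact (totalDegree_sub _ _).trans (max_le hx (totalDegree_posDot_le hy))
      omega
    refine Submodule.mem_sup.2 ⟨v - z, fun i _ => ?_, z, mem_koszulShape.2 ⟨hzh, hpz⟩, by simp⟩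
    simpa [mem_lagrangeShape] using hy i

theorem grad_mem_nedelecShape {r : ℕ} {p : Poly} (hp : p.totalDegree ≤ r) :
    grad p ∈ nedelecShape r := by
  refine Submodule.mem_sup_left fun i _ => mem_lagrangeShape.2 ?_
  exact (totalDegree_pderiv_le i p).trans (by omega)

theorem coeff_X_mul_pderiv (i : Fin 3) (p : Poly) (s : Fin 3 →₀ ℕ) :
    coeff s (X i * pderiv i p) = s i * coeff s p := by
  induction p using MvPolynomial.induction_on' with
  | monomial m c =>
    rw [X_mul_pderiv_monomial, ← Nat.cast_smul_eq_nsmul ℝ, coeff_smul, coeff_monomial, smul_eq_mul]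
    split_ifs with h
    · rw [h]
    · simp
  | add p q hp hq => rw [map_add, mul_add, coeff_add, hp, hq, coeff_add]; ring

/-- A curl-free Nédélec shape function is the gradient of a polynomial of degree at most `r`. -/
theorem exists_grad_eq_of_curl_eq_zero {r : ℕ} (hr : 1 ≤ r) {v : VPoly}
    (hv : v ∈ nedelecShape r) (hc : curl v = 0) :
    ∃ p : Poly, p.totalDegree ≤ r ∧ grad p = v := by
  classical
  set q := posDot v with hq
  have hsymm : ∀ i j, pderiv i (v j) = pderiv j (v i) := by
    have h0 : pderiv 1 (v 2) - pderiv 2 (v 1) = 0 := congrFun hc 0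
    have h1 : pderiv 2 (v 0) - pderiv 0 (v 2) = 0 := congrFun hc 1
    have h2 : pderiv 0 (v 1) - pderiv 1 (v 0) = 0 := congrFun hc 2
    rw [sub_eq_zero] at h0 h1 h2
    intro i j
    fin_cases i <;> fin_cases j <;> first | rfl | assumption | (symm; assumption)
  -- Symmetry of the Jacobian turns `∂ᵢ (x · v)` into `vᵢ` plus its Euler derivative, which acts on
  -- each monomial as multiplication by its degree.
  have hdq : ∀ i, pderiv i q = v i + (X 0 * pderiv 0 (v i) + X 1 * pderiv 1 (v i) +
      X 2 * pderiv 2 (v i)) := fun i => by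
    simp only [hq, posDot, map_add, pderiv_mul, hsymm i]
    fin_cases i <;> simp [pderiv_X] <;> ring
  -- The radial primitive `∫₀¹ x · v(tx) dt`: each monomial of `x · v` is divided by its degree. The
  -- convention `0⁻¹ = 0` sets the constant term to zero.
  set p : Poly := ∑ s ∈ q.support, monomial s ((s.degree : ℝ)⁻¹ * coeff s q) with hp
  have hcoeff : ∀ s, coeff s p = (s.degree : ℝ)⁻¹ * coeff s q := fun s => by
    simp only [hp, coeff_sum, coeff_monomial]
    rw [Finset.sum_ite_eq']
    split_ifs with h
    · rfl
    · rw [notMem_support_iff.1 h, mul_zero]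
  refine ⟨p, (totalDegree_le_of_support_subset fun s hs => ?_).trans
    ((mem_nedelecShape hr).1 hv).2, funext fun i => ?_⟩
  · rw [mem_support_iff, hcoeff] at hs
    exact mem_support_iff.2 (right_ne_zero_of_mul hs)
  · ext s
    have h1 : coeff s (pderiv i q) = (s.degree + 1) * coeff s (v i) := by
      rw [hdq]
      simp only [coeff_add, coeff_X_mul_pderiv]
      rw [Finsupp.degree_eq_sum, Fin.sum_univ_three]
      push_cast
      ring
    have h2 : (s.degree : ℝ) + 1 ≠ 0 := by positivity
    rw [coeff_pderiv] at h1
    rw [grad_apply, coeff_pderiv, hcoeff, map_add, Finsupp.degree_single, mul_assoc, h1]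
    push_cast
    field_simp

theorem eq_C_of_grad_eq_zero {p : Poly} (h : grad p = 0) : p = C (coeff 0 p) := by
  ext s
  rw [coeff_C]
  split_ifs with hs
  · rw [hs]
  · obtain ⟨i, hi⟩ := Finsupp.ne_iff.1 (Ne.symm hs)
    have h1 := coeff_X_mul_pderiv i p s
    rw [show pderiv i p = 0 from congrFun h i, mul_zero, coeff_zero] at h1
    have h2 : (s i : ℝ) ≠ 0 := by exact_mod_cast hi
    exact (mul_eq_zero.1 h1.symm).resolve_left h2

/-! ### Moments of a single polynomial

The gluing conditions, for the difference `z` of two shape functions on the set `S` of common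
vertices of two cells. -/

/-- The Lagrange degrees of freedom of `z` vanish on the simplices with vertices in `S`. -/
def LagrangeVanish (m : ℕ) (S : Finset E3) (z : Poly) : Prop :=
  (∀ a ∈ S, ev a z = 0) ∧
  (∀ a b : E3, a ≠ b → a ∈ S → b ∈ S → ∀ q : Poly, q.totalDegree + 2 ≤ m →
    edgeInt a b (z * q) = 0) ∧
  (∀ a b c : E3, a ≠ b → a ≠ c → b ≠ c → a ∈ S → b ∈ S → c ∈ S →
    ∀ q : Poly, q.totalDegree + 3 ≤ m → faceInt a b c (z * q) = 0)

/-- The Nédélec degrees of freedom of `z` vanish on the simplices with vertices in `S`. -/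
def NedelecVanish (r : ℕ) (S : Finset E3) (z : VPoly) : Prop :=
  (∀ a b : E3, a ≠ b → a ∈ S → b ∈ S → ∀ q : Poly, q.totalDegree + 1 ≤ r →
    edgeInt a b (along (tangent a b) z * q) = 0) ∧
  (∀ a b c : E3, a ≠ b → a ≠ c → b ≠ c → a ∈ S → b ∈ S → c ∈ S →
    ∀ q : Poly, q.totalDegree + 2 ≤ r → faceInt a b c (along (tangent a b) z * q) = 0)

/-- The normal moments of `z` vanish on the triangles with vertices in `S`. -/
def NormalVanish (r : ℕ) (S : Finset E3) (z : VPoly) : Prop :=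
  ∀ a b c : E3, a ≠ b → a ≠ c → b ≠ c → a ∈ S → b ∈ S → c ∈ S →
    ∀ q : Poly, q.totalDegree + 1 ≤ r → faceInt a b c (along (normal a b c) z * q) = 0

/-- Integration by parts moves the derivative to the test polynomial, lowering its degree by one.
This is the drop from the Nédélec test degrees to the Lagrange ones; the boundary terms are moments
on vertices or edges. -/
theorem LagrangeVanish.grad {r : ℕ} {S : Finset E3} {z : Poly} (h : LagrangeVanish r S z) :
    NedelecVanish r S (grad z) := by
  obtain ⟨h1, h2, h3⟩ := h
  refine ⟨fun a b hab ha hb q hq => ?_, fun a b c hab hac hbc ha hb hc q hq => ?_⟩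
  · have h := edgeInt_dirDeriv a b (z * q)
    rw [dirDeriv_mul, map_add, ev_mul, ev_mul, h1 a ha, h1 b hb] at h
    have h' : edgeInt a b (z * dirDeriv (tangent a b) q) = 0 := by
      rcases totalDegree_dirDeriv_lt (tangent a b) q with h0 | h0
      · simp [h0]
      · exact h2 a b hab ha hb _ (by omega)
    rw [along_grad]
    linarith
  · have h := faceInt_dirDeriv_outer b hac (z * q)
    rw [dirDeriv_mul, map_add, h2 c b hbc.symm hc hb q hq, h2 a c hac ha hc q hq] at h
    have h' : faceInt a b c (z * dirDeriv (tangent a b) q) = 0 := by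
      rcases totalDegree_dirDeriv_lt (tangent a b) q with h0 | h0
      · simp [h0]
      · exact h3 a b c hab hac hbc ha hb hc _ (by omega)
    rw [along_grad]
    linarith

/-- The same integration by parts read backwards: every test polynomial is a tangential derivative
of one of degree one higher. Vertex values are the only data that the gradient does not see. -/
theorem LagrangeVanish.of_grad {r : ℕ} {S : Finset E3} {z : Poly}
    (h : NedelecVanish r S (QuadDiv.grad z)) (h1 : ∀ a ∈ S, ev a z = 0) :
    LagrangeVanish r S z := by
  have h2 : ∀ a b : E3, a ≠ b → a ∈ S → b ∈ S → ∀ q : Poly, q.totalDegree + 2 ≤ r →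
      edgeInt a b (z * q) = 0 := fun a b hab ha hb q hq => by
    obtain ⟨Q, hQ, rfl⟩ := exists_dirDeriv_eq (tangent_ne_zero hab) q
    have h' := edgeInt_dirDeriv a b (z * Q)
    have h'' := h.1 a b hab ha hb Q (by omega)
    rw [along_grad] at h''
    rw [dirDeriv_mul, map_add, ev_mul, ev_mul, h1 a ha, h1 b hb] at h'
    linarith
  refine ⟨h1, h2, fun a b c hab hac hbc ha hb hc q hq => ?_⟩
  obtain ⟨Q, hQ, rfl⟩ := exists_dirDeriv_eq (tangent_ne_zero hab) q
  have h' := faceInt_dirDeriv_outer b hac (z * Q)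
  have h'' := h.2 a b c hab hac hbc ha hb hc Q (by omega)
  rw [along_grad] at h''
  rw [dirDeriv_mul, map_add, h2 c b hbc.symm hc hb Q (by omega),
    h2 a c hac ha hc Q (by omega)] at h'
  linarith

/-- All terms of Stokes' formula for a test polynomial in `P_{r-1}` are Nédélec moments: edge terms
against `P_{r-1}` and face terms against its derivatives in `P_{r-2}`. -/
theorem NedelecVanish.curl {r : ℕ} {S : Finset E3} {z : VPoly} (h : NedelecVanish r S z) :
    NormalVanish r S (curl z) := by
  obtain ⟨h1, h2⟩ := h
  intro a b c hab hac hbc ha hb hc q hq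
  have hd : ∀ a b c : E3, a ≠ b → a ≠ c → b ≠ c → a ∈ S → b ∈ S → c ∈ S → ∀ d,
      faceInt a b c (along (tangent a b) z * dirDeriv d q) = 0 := by
    intro a b c hab hac hbc ha hb hc d
    rcases totalDegree_dirDeriv_lt d q with h0 | h0
    · simp [h0]
    · exact h2 a b c hab hac hbc ha hb hc _ (by omega)
  rw [faceInt_curl_mul hac, h1 a b hab ha hb q hq, h1 b c hbc hb hc q hq, h1 a c hac ha hc q hq,
    hd a b c hab hac hbc ha hb hc, ← faceInt_swap_right hab hac,
    hd a c b hac hab hbc.symm ha hc hb]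
  simp

section Glue

variable {Ω : Set E3} {T : TetMesh Ω}

theorem pair_subset {a b : E3} {S : Finset E3} : {a, b} ⊆ S ↔ a ∈ S ∧ b ∈ S := by
  simp [Finset.insert_subset_iff]

theorem triple_subset {a b c : E3} {S : Finset E3} :
    {a, b, c} ⊆ S ↔ a ∈ S ∧ b ∈ S ∧ c ∈ S := by
  simp [Finset.insert_subset_iff]

open Classical in
theorem mem_lagrangeGlue {m : ℕ} {u : T.Cell → Poly} :
    u ∈ lagrangeGlue T m ↔ ∀ K K' : T.Cell, LagrangeVanish m (K.verts ∩ K'.verts) (u K - u K') := by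
  refine forall_congr' fun K => forall_congr' fun K' => ?_
  simp only [LagrangeVanish, sub_mul, map_sub, sub_eq_zero, Finset.mem_inter, pair_subset,
    triple_subset]
  constructor
  · rintro ⟨h1, h2, h3⟩
    exact ⟨fun a ha => h1 a ha.1 ha.2, fun a b hab ha hb => h2 a b hab ⟨ha.1, hb.1⟩ ⟨ha.2, hb.2⟩,
      fun a b c hab hac hbc ha hb hc => h3 a b c hab hac hbc ⟨ha.1, hb.1, hc.1⟩ ⟨ha.2, hb.2, hc.2⟩⟩
  · rintro ⟨h1, h2, h3⟩
    exact ⟨fun a ha ha' => h1 a ⟨ha, ha'⟩, fun a b hab h h' => h2 a b hab ⟨h.1, h'.1⟩ ⟨h.2, h'.2⟩,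
      fun a b c hab hac hbc h h' => h3 a b c hab hac hbc ⟨h.1, h'.1⟩ ⟨h.2.1, h'.2.1⟩
        ⟨h.2.2, h'.2.2⟩⟩

open Classical in
theorem mem_nedelecGlue {r : ℕ} {u : T.Cell → VPoly} :
    u ∈ nedelecGlue T r ↔ ∀ K K' : T.Cell, NedelecVanish r (K.verts ∩ K'.verts) (u K - u K') := by
  refine forall_congr' fun K => forall_congr' fun K' => ?_
  simp only [NedelecVanish, sub_mul, map_sub, sub_eq_zero, Finset.mem_inter, pair_subset,
    triple_subset]
  constructor
  · rintro ⟨h2, h3⟩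
    exact ⟨fun a b hab ha hb => h2 a b hab ⟨ha.1, hb.1⟩ ⟨ha.2, hb.2⟩,
      fun a b c hab hac hbc ha hb hc => h3 a b c hab hac hbc ⟨ha.1, hb.1, hc.1⟩ ⟨ha.2, hb.2, hc.2⟩⟩
  · rintro ⟨h2, h3⟩
    exact ⟨fun a b hab h h' => h2 a b hab ⟨h.1, h'.1⟩ ⟨h.2, h'.2⟩,
      fun a b c hab hac hbc h h' => h3 a b c hab hac hbc ⟨h.1, h'.1⟩ ⟨h.2.1, h'.2.1⟩
        ⟨h.2.2, h'.2.2⟩⟩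

open Classical in
theorem mem_normalGlue {r : ℕ} {u : T.Cell → VPoly} :
    u ∈ normalGlue T r ↔ ∀ K K' : T.Cell, NormalVanish r (K.verts ∩ K'.verts) (u K - u K') := by
  refine forall_congr' fun K => forall_congr' fun K' => ?_
  simp only [NormalVanish, sub_mul, map_sub, sub_eq_zero, Finset.mem_inter, triple_subset]
  exact ⟨fun h3 a b c hab hac hbc ha hb hc => h3 a b c hab hac hbc ⟨ha.1, hb.1, hc.1⟩
    ⟨ha.2, hb.2, hc.2⟩, fun h3 a b c hab hac hbc h h' => h3 a b c hab hac hbc ⟨h.1, h'.1⟩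
      ⟨h.2.1, h'.2.1⟩ ⟨h.2.2, h'.2.2⟩⟩

end Glue

end Spaces

/-! ### The vertex map of a mesh -/

/-! ### Topology: cohomology of a mesh of a contractible Lipschitz domain -/

section Mesh

variable {Ω : Set E3} (T : TetMesh Ω)

theorem TetMesh.exists_cell {s : Finset E3} (hs : s ∈ T.faces) : ∃ K : T.Cell, s ⊆ K.verts := by
  obtain ⟨K, hK, hsK, hc⟩ := T.pure s hs
  exact ⟨⟨K, hK, hc⟩, hsK⟩

theorem TetMesh.isCompact_closure {Ω : Set E3} (T : TetMesh Ω) : IsCompact (closure Ω) := by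
  rw [← T.space_eq]
  exact T.finite_faces.isCompact_biUnion fun s _ => s.finite_toSet.isCompact_convexHull ℝ

theorem TetMesh.convexHull_subset {s : Finset E3} (hs : s ∈ T.faces) :
    convexHull ℝ (s : Set E3) ⊆ closure Ω := by
  rw [← T.space_eq]; exact T.convexHull_subset_space hs

/-- A face of least cardinality through `x` is the carrier: its intersection with any other face
through `x` is again a face through `x`. -/
theorem TetMesh.exists_minimal_face {x : E3} (hx : x ∈ closure Ω) :
    ∃ s ∈ T.faces, s.Nonempty ∧
      ∀ t ∈ T.faces, x ∈ convexHull ℝ (t : Set E3) → s ⊆ t := by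
  classical
  obtain ⟨s₀, hs₀⟩ : ∃ s ∈ T.faces, x ∈ convexHull ℝ (s : Set E3) := by
    rw [← T.space_eq] at hx
    exact T.mem_space_iff.1 hx
  obtain ⟨s, ⟨hs, hxs⟩, hmin⟩ := Set.exists_min_image
    {s : Finset E3 | s ∈ T.faces ∧ x ∈ convexHull ℝ (s : Set E3)} Finset.card
    (T.finite_faces.subset fun s h => h.1) ⟨s₀, hs₀⟩
  refine ⟨s, hs, T.nonempty_of_mem_faces hs, fun t ht hxt => ?_⟩
  have h1 := T.inter_subset_convexHull hs ht ⟨hxs, hxt⟩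
  rw [← Finset.coe_inter] at h1
  have hne : (s ∩ t).Nonempty := by
    exact Finset.coe_nonempty.1 (convexHull_nonempty_iff.1 ⟨x, h1⟩)
  have h2 := hmin (s ∩ t) ⟨T.down_closed hs Finset.inter_subset_left hne, h1⟩
  rw [← Finset.eq_of_subset_of_card_le Finset.inter_subset_left h2]
  exact Finset.inter_subset_right

/-- A labelling of the points of the mesh by vertices of their carriers such that points that are
close to a common point are labelled by vertices of a common cell. -/
theorem TetMesh.exists_vertex_map : ∃ v : E3 → E3, ∃ δ > 0,
    (∀ y ∈ closure Ω, ∃ K : T.Cell, ∀ x ∈ closure Ω, dist x y < δ → v x ∈ K.verts) ∧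
    ∀ s ∈ T.faces, ∀ x ∈ convexHull ℝ (s : Set E3), v x ∈ s := by
  classical
  -- `U a` is open, being the complement of the finitely many closed simplices without the vertex
  -- `a`; on the mesh it is the open star of `a`. The stars cover the mesh because every point lies
  -- in the star of each vertex of its carrier.
  let U : E3 → Set E3 := fun a => (⋃ t ∈ {t ∈ T.faces | a ∉ t}, convexHull ℝ (t : Set E3))ᶜ
  have hU : ∀ a y, y ∈ U a ↔ ∀ t ∈ T.faces, y ∈ convexHull ℝ (t : Set E3) → a ∈ t := by
    intro a y
    simp only [U, Set.mem_compl_iff, Set.mem_iUnion, Set.mem_ofPred_eq, not_exists]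
    exact ⟨fun h t ht hy => by_contra fun ha => h t ⟨ht, ha⟩ hy,
      fun h t ht hy => ht.2 (h t ht.1 hy)⟩
  obtain ⟨δ, hδ, hball⟩ := lebesgue_number_lemma_of_metric (c := U) T.isCompact_closure
    (fun a => (((T.finite_faces.subset fun t h => h.1).isCompact_biUnion
      fun s _ => s.finite_toSet.isCompact_convexHull ℝ).isClosed).isOpen_compl)
    (fun x hx => by
      obtain ⟨s, hs, ⟨a, ha⟩, hmin⟩ := T.exists_minimal_face hx
      exact Set.mem_iUnion.2 ⟨a, (hU a x).2 fun t ht hxt => hmin t ht hxt ha⟩)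
  -- By the Lebesgue number, the `δ`-ball around `x` lies in the star of `v x`; hence `v x` is a
  -- vertex of every simplex that meets this ball.
  choose! v hv using hball
  refine ⟨v, δ, hδ, fun y hy => ?_, fun s hs x hx => ?_⟩
  · obtain ⟨s, hs, hys⟩ := T.mem_space_iff.1 (T.space_eq ▸ hy)
    obtain ⟨K, hK⟩ := T.exists_cell hs
    refine ⟨K, fun x hx hxy => hK ?_⟩
    have : y ∈ Metric.ball x δ := by rwa [Metric.mem_ball, dist_comm]
    exact (hU _ _).1 (hv x hx this) s hs hys
  · exact (hU _ _).1 (hv x (T.convexHull_subset hs hx) (Metric.mem_ball_self hδ)) s hs hx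

end Mesh

/-! ### Pushing the closure of a Lipschitz domain into its interior -/

/-- In the local coordinates the closure lies weakly above the graph, so a small upward shift lands
strictly above it. -/
theorem IsLipschitzDomain.exists_direction {Ω : Set E3} (hΩ : IsLipschitzDomain Ω) {p : E3}
    (hp : p ∈ frontier Ω) : ∃ (e : E3) (ρ : ℝ), 0 < ρ ∧ ‖e‖ = 1 ∧
      ∀ x ∈ closure Ω, dist x p < ρ → ∀ s : ℝ, 0 < s → s < ρ → x + s • e ∈ Ω := by
  obtain ⟨A, g, L, hg, U, hU, h⟩ := hΩ.lipschitz_boundary p hp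
  obtain ⟨ρ, hρ, hball⟩ := Metric.mem_nhds_iff.1 hU
  set e₃ : E3 := EuclideanSpace.single 2 1 with he₃
  set e : E3 := A.linearIsometryEquiv.symm e₃ with he
  have hne : ‖e‖ = 1 := by simp [he, he₃]
  have hA : ∀ x (s : ℝ), A (x + s • e) = A x + s • e₃ := fun x s => by
    have := A.map_vadd x (s • e)
    rw [vadd_eq_add, vadd_eq_add] at this
    rw [add_comm, this, map_smul, he, LinearIsometryEquiv.apply_symm_apply, add_comm]
  have hgc : Continuous fun x : E3 => g (!₂[A x 0, A x 1]) := by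
    refine hg.continuous.comp ?_
    have h0 : Continuous fun x : E3 => A x 0 := by
      have := A.continuous; fun_prop
    have h1 : Continuous fun x : E3 => A x 1 := by
      have := A.continuous; fun_prop
    refine (PiLp.continuous_toLp 2 _).comp (continuous_pi fun i => ?_)
    fin_cases i
    · exact h0
    · exact h1
  have hA2 : Continuous fun x : E3 => A x 2 := by
    have := A.continuous; fun_prop
  -- Half the radius keeps the shifted point in the ball on which the graph description is valid.
  refine ⟨e, ρ / 2, by positivity, hne, fun x hx hxp s hs hsρ => ?_⟩
  have hxU : dist x p < ρ := by linarith
  have hsU : x + s • e ∈ U := hball <| by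
    rw [Metric.mem_ball]
    have : dist (x + s • e) x = s := by
      rw [dist_eq_norm, add_sub_cancel_left, norm_smul, hne, mul_one, Real.norm_eq_abs,
        abs_of_pos hs]
    have := dist_triangle (x + s • e) x p
    linarith
  have hle : g (!₂[A x 0, A x 1]) ≤ A x 2 := by
    have hx' : x ∈ closure (Ω ∩ Metric.ball p ρ) :=
      Metric.isOpen_ball.closure_inter ⟨hx, hxU⟩
    refine closure_minimal (t := {x : E3 | g (!₂[A x 0, A x 1]) ≤ A x 2}) ?_
      (isClosed_le hgc hA2) hx'
    rintro y ⟨hy, hyp⟩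
    exact ((h y (hball hyp)).1 hy).le
  have e0 : (A x + s • e₃) 0 = A x 0 := by simp [he₃]
  have e1 : (A x + s • e₃) 1 = A x 1 := by simp [he₃]
  have e2 : (A x + s • e₃) 2 = A x 2 + s := by simp [he₃]
  rw [h _ hsU, hA, e0, e1, e2]
  linarith

/-- The closure of a Lipschitz domain can be mapped into the domain by a map close to the
identity. -/
theorem IsLipschitzDomain.exists_push {Ω : Set E3} (hΩ : IsLipschitzDomain Ω) {η : ℝ} (hη : 0 < η) :
    ∃ G : E3 → E3, Continuous G ∧ (∀ x, dist (G x) x ≤ η) ∧ ∀ x ∈ closure Ω, G x ∈ Ω := by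
  classical
  have hdir : ∀ p : frontier Ω, ∃ (e : E3) (ρ : ℝ), 0 < ρ ∧ ‖e‖ = 1 ∧
      ∀ x ∈ closure Ω, dist x p < ρ → ∀ s : ℝ, 0 < s → s < ρ → x + s • e ∈ Ω :=
    fun p => hΩ.exists_direction p.2
  choose e ρ hρ hne h using hdir
  -- Induction on the boundary patches. The alternative `G x = x ∨ G x ∈ Ω` is the invariant: a
  -- point not yet in the domain has not moved, so the next local push still applies to it, and no
  -- push leaves the domain.
  have key : ∀ t : Finset (frontier Ω), ∀ η > 0, ∃ G : E3 → E3, Continuous G ∧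
      (∀ x, dist (G x) x ≤ η) ∧ ∀ x ∈ closure Ω, (G x = x ∨ G x ∈ Ω) ∧
        ((∃ p ∈ t, dist x p < ρ p) → G x ∈ Ω) := by
    intro t
    induction t using Finset.induction_on with
    | empty => exact fun η hη => ⟨id, continuous_id, by simp [hη.le], by simp⟩
    | insert p t _ ih =>
      intro η hη
      obtain ⟨G, hGc, hGd, hG⟩ := ih (η / 2) (by positivity)
      let τ : ℝ := min (η / 2) (ρ p / 2)
      have hτ : 0 < τ := lt_min (by positivity) (by have := hρ p; positivity)
      let b : E3 → ℝ := fun x => max 0 (1 - dist x p / ρ p)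
      have hb0 : ∀ x, 0 ≤ b x := fun x => le_max_left _ _
      have hb1 : ∀ x, b x ≤ 1 := fun x => max_le zero_le_one
        (by have := div_nonneg (dist_nonneg (x := x) (y := p)) (hρ p).le; linarith)
      have hb : ∀ x : E3, dist x p < ρ p → 0 < b x := fun x hx => lt_max_of_lt_right <| by
        have := (div_lt_one (hρ p)).2 hx
        linarith
      have hb' : ∀ x : E3, ¬ dist x p < ρ p → b x = 0 := fun x hx => max_eq_left <| by
        have := (one_le_div (hρ p)).2 (not_lt.1 hx)
        linarith
      -- A push in the patch direction, cut off by the tent function `b`, which is positive exactly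
      -- on the patch.
      let P : E3 → E3 := fun x => x + (τ * b x) • e p
      have hPd : ∀ x, dist (P x) x ≤ η / 2 := fun x => by
        have : dist (P x) x = τ * b x := by
          rw [dist_eq_norm, add_sub_cancel_left, norm_smul, hne, mul_one, Real.norm_eq_abs,
            abs_of_nonneg (mul_nonneg hτ.le (hb0 x))]
        rw [this]
        calc τ * b x ≤ τ * 1 := by gcongr; exact hb1 x
          _ ≤ η / 2 := by rw [mul_one]; exact min_le_left _ _
      have hPΩ : ∀ x ∈ closure Ω, dist x p < ρ p → P x ∈ Ω := fun x hx hxp => by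
        refine h p x hx hxp _ (mul_pos hτ (hb x hxp)) ?_
        calc τ * b x ≤ τ * 1 := by gcongr; exact hb1 x
          _ ≤ ρ p / 2 := by rw [mul_one]; exact min_le_right _ _
          _ < ρ p := by have := hρ p; linarith
      have hP : ∀ x ∈ closure Ω, P x = x ∨ P x ∈ Ω := fun x hx => by
        by_cases hxp : dist x p < ρ p
        · exact Or.inr (hPΩ x hx hxp)
        · left; simp [P, hb' x hxp]
      have hPc : Continuous P := by
        have : Continuous b := continuous_const.max (by fun_prop)
        fun_prop
      refine ⟨P ∘ G, hPc.comp hGc, fun x => ?_, fun x hx => ?_⟩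
      · have h1 := dist_triangle (P (G x)) (G x) x
        have h2 := hPd (G x)
        have h3 := hGd x
        simp only [Function.comp]
        linarith
      · have hin : G x ∈ Ω → P (G x) ∈ Ω := fun hg => by
          rcases hP (G x) (subset_closure hg) with h0 | h0
          · rwa [h0]
          · exact h0
        obtain ⟨h1, h2⟩ := hG x hx
        refine ⟨?_, ?_⟩
        · rcases h1 with h1 | h1
          · simp only [Function.comp, h1]; exact hP x hx
          · exact Or.inr (hin h1)
        · rintro ⟨q, hq, hxq⟩
          rcases Finset.mem_insert.1 hq with rfl | hq
          · rcases h1 with h1 | h1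
            · simp only [Function.comp, h1]; exact hPΩ x hx hxq
            · exact hin h1
          · exact hin (h2 ⟨q, hq, hxq⟩)
  have hcomp : IsCompact (frontier Ω) :=
    (hΩ.isBounded.isCompact_closure).of_isClosed_subset isClosed_frontier frontier_subset_closure
  obtain ⟨t, ht⟩ := hcomp.elim_finite_subcover (fun p : frontier Ω => Metric.ball (p : E3) (ρ p))
    (fun _ => Metric.isOpen_ball)
    (fun x hx => Set.mem_iUnion.2 ⟨⟨x, hx⟩, Metric.mem_ball_self (hρ _)⟩)
  obtain ⟨G, hGc, hGd, hG⟩ := key t η hη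
  refine ⟨G, hGc, hGd, fun x hx => ?_⟩
  by_cases hxΩ : x ∈ Ω
  · rcases (hG x hx).1 with h1 | h1
    · rwa [h1]
    · exact h1
  · have hxf : x ∈ frontier Ω := by
      rw [frontier, hΩ.isOpen.interior_eq]; exact ⟨hx, hxΩ⟩
    obtain ⟨p, hp, hxp⟩ := by simpa using ht hxf
    exact (hG x hx).2 ⟨⟨p, hp⟩, hxp.1, by simpa using hxp.2⟩

/-- A contraction of the closure of a contractible Lipschitz domain in small steps. -/
theorem IsLipschitzDomain.exists_discrete_contraction {Ω : Set E3} (hΩ : IsLipschitzDomain Ω)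
    [ContractibleSpace Ω] {δ : ℝ} (hδ : 0 < δ) :
    ∃ ε > 0, ∃ (N : ℕ) (p : E3) (h : ℕ → E3 → E3), (∀ x, h 0 x = x) ∧
      (∀ x ∈ closure Ω, h N x = p) ∧ (∀ j, ∀ x ∈ closure Ω, h j x ∈ closure Ω) ∧
      ∀ j, ∀ x ∈ closure Ω, ∀ y ∈ closure Ω, dist x y < ε →
        dist (h j y) (h j x) < δ ∧ dist (h (j + 1) y) (h j x) < δ := by
  classical
  obtain ⟨G, hGc, hGd, hGΩ⟩ := hΩ.exists_push (show 0 < δ / 2 by positivity)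
  obtain ⟨p, ⟨H⟩⟩ := id_nullhomotopic Ω
  let g : closure Ω → Ω := fun x => ⟨G x, hGΩ x x.2⟩
  have hg : Continuous g := (hGc.comp continuous_subtype_val).subtype_mk _
  -- The contraction exists only on the open domain; precomposition with `G` makes it uniformly
  -- continuous on the compact closure.
  let F : unitInterval × closure Ω → E3 := fun z => (H (z.1, g z.2) : E3)
  have hF : Continuous F := by
    refine continuous_subtype_val.comp (H.continuous.comp ?_)
    exact continuous_fst.prodMk (hg.comp continuous_snd)
  have : CompactSpace (closure Ω) := isCompact_iff_compactSpace.1 hΩ.isBounded.isCompact_closure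
  have hFu := CompactSpace.uniformContinuous_of_continuous hF
  obtain ⟨ε, hε, hFε⟩ := Metric.uniformContinuous_iff.1 hFu δ hδ
  obtain ⟨N, hN⟩ := exists_nat_one_div_lt hε
  have hN0 : (0 : ℝ) < (N : ℝ) + 1 := by positivity
  let τ : ℕ → unitInterval := fun j => ⟨min ((j : ℝ) / (N + 1)) 1,
    le_min (by positivity) zero_le_one, min_le_right _ _⟩
  have hτ0 : τ 0 = 0 := by ext; simp [τ]
  have hτN : τ (N + 1) = 1 := by ext; simp [τ, hN0.ne']
  have hτ : ∀ j, dist (τ (j + 1)) (τ j) < ε := fun j => by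
    refine lt_of_le_of_lt ?_ hN
    rw [Subtype.dist_eq, Real.dist_eq]
    refine (abs_min_sub_min_le_max _ _ _ _).trans ?_
    rw [sub_self, abs_zero, max_eq_left (abs_nonneg _), ← sub_div]
    push_cast
    rw [add_sub_cancel_left, abs_of_pos (by positivity)]
  -- Stage `0` is the identity, stage `1` is `G`, and the later stages follow the homotopy. Values
  -- off the closure are irrelevant.
  let h : ℕ → E3 → E3 := fun j x => match j with
    | 0 => x
    | j + 1 => if hx : x ∈ closure Ω then F (τ j, ⟨x, hx⟩) else x
  have hs : ∀ j x (hx : x ∈ closure Ω), h (j + 1) x = F (τ j, ⟨x, hx⟩) := fun j x hx => by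
    simp only [h, dif_pos hx]
  have hd : ∀ j x (hx : x ∈ closure Ω) y (hy : y ∈ closure Ω) i, dist x y < ε →
      dist (τ i) (τ j) < ε → dist (h (i + 1) y) (h (j + 1) x) < δ := by
    intro j x hx y hy i hxy hij
    rw [hs j x hx, hs i y hy]
    refine hFε ?_
    rw [Prod.dist_eq]
    refine max_lt hij ?_
    rw [Subtype.dist_eq, dist_comm]
    exact hxy
  -- `δ / 2` serves the jump from the identity to `G`, which itself moves points by at most `δ / 2`;
  -- `ε` serves the other stages. Since stage `j + 1` uses time `τ j` and `τ (N + 1) = 1`, the last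
  -- stage is `N + 2`.
  refine ⟨min ε (δ / 2), lt_min hε (by positivity), N + 2, p, h, fun x => rfl, fun x hx => ?_, ?_,
    ?_⟩
  · rw [hs _ x hx, hτN]
    simp only [F, H.apply_one]
    rfl
  · intro j x hx
    cases j with
    | zero => exact hx
    | succ j => rw [hs j x hx]; exact subset_closure (H _).2
  · intro j x hx y hy hxy
    have hxy1 := hxy.trans_le (min_le_left _ _)
    have hxy2 := hxy.trans_le (min_le_right _ _)
    cases j with
    | zero =>
      have e1 : h (0 + 1) y = G y := by
        rw [hs 0 y hy, hτ0]; simp only [F, H.apply_zero]; rfl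
      rw [e1]
      refine ⟨by rw [dist_comm]; change dist x y < δ; linarith, ?_⟩
      change dist (G y) x < δ
      have h1 := dist_triangle (G y) y x
      have h2 := hGd y
      rw [dist_comm y x] at h1
      linarith
    | succ j =>
      exact ⟨hd j x hx y hy j hxy1 (by simpa using hε), hd j x hx y hy (j + 1) hxy1 (hτ j)⟩

/-! ### Subdivision of cochains -/

/-- The value of a `1`-cochain on the edge `[x, y]` subdivided into `2 ^ n` equal pieces. -/
def edgeSub (b : E3 → E3 → ℝ) : ℕ → E3 → E3 → ℝ
  | 0, x, y => b x y
  | n + 1, x, y => edgeSub b n x (midpoint ℝ x y) + edgeSub b n (midpoint ℝ x y) y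

/-- The value of a `2`-cochain on the triangle `[x, y, z]` subdivided into `4 ^ n` congruent
pieces. -/
def faceSub (c : E3 → E3 → E3 → ℝ) : ℕ → E3 → E3 → E3 → ℝ
  | 0, x, y, z => c x y z
  | n + 1, x, y, z =>
    faceSub c n x (midpoint ℝ x y) (midpoint ℝ x z) +
      faceSub c n (midpoint ℝ x y) y (midpoint ℝ y z) +
      faceSub c n (midpoint ℝ x z) (midpoint ℝ y z) z +
      faceSub c n (midpoint ℝ x y) (midpoint ℝ y z) (midpoint ℝ x z)

theorem midpoint_mem {S : Set E3} (hS : Convex ℝ S) {x y : E3} (hx : x ∈ S) (hy : y ∈ S) :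
    midpoint ℝ x y ∈ S :=
  hS.segment_subset hx hy (midpoint_mem_segment x y)

theorem dist_midpoint_lt {x y : E3} {δ : ℝ} {n : ℕ} (h : dist x y < 2 ^ (n + 1) * δ) :
    dist x (midpoint ℝ x y) < 2 ^ n * δ ∧ dist (midpoint ℝ x y) y < 2 ^ n * δ := by
  rw [dist_left_midpoint, dist_midpoint_right, Real.norm_ofNat]
  rw [pow_succ] at h
  constructor <;> linarith

theorem dist_midpoint_midpoint_lt {x y z : E3} {δ : ℝ} {n : ℕ} (h : dist y z < 2 ^ (n + 1) * δ) :
    dist (midpoint ℝ x y) (midpoint ℝ x z) < 2 ^ n * δ := by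
  have := dist_midpoint_midpoint_le x y x z
  rw [dist_self, zero_add] at this
  rw [pow_succ] at h
  linarith

theorem edgeSub_swap {S : Set E3} (hS : Convex ℝ S) {b : E3 → E3 → ℝ} {δ : ℝ}
    (hb : ∀ x ∈ S, ∀ y ∈ S, dist x y < δ → b x y = -b y x) (n : ℕ) : ∀ x ∈ S, ∀ y ∈ S,
    dist x y < 2 ^ n * δ → edgeSub b n x y = -edgeSub b n y x := by
  induction n with
  | zero => simpa [edgeSub] using hb
  | succ n ih =>
    intro x hx y hy hxy
    have hm := midpoint_mem hS hx hy
    obtain ⟨h1, h2⟩ := dist_midpoint_lt hxy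
    simp only [edgeSub, midpoint_comm y x]
    rw [ih x hx _ hm h1, ih _ hm y hy h2]
    ring

/-- Each bisection doubles the scale on which the cochain is known to be a coboundary, since the
values at midpoints cancel. -/
theorem edgeSub_eq_sub {S : Set E3} (hS : Convex ℝ S) {b : E3 → E3 → ℝ} {g : E3 → ℝ} {δ : ℝ}
    (hb : ∀ x ∈ S, ∀ y ∈ S, dist x y < δ → b x y = g y - g x) (n : ℕ) : ∀ x ∈ S, ∀ y ∈ S,
    dist x y < 2 ^ n * δ → edgeSub b n x y = g y - g x := by
  induction n with
  | zero => simpa [edgeSub] using hb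
  | succ n ih =>
    intro x hx y hy hxy
    have hm := midpoint_mem hS hx hy
    obtain ⟨h1, h2⟩ := dist_midpoint_lt hxy
    rw [edgeSub, ih x hx _ hm h1, ih _ hm y hy h2]
    ring

theorem edgeSub_eq_sub' {S : Set E3} (hS : Convex ℝ S) {b : E3 → E3 → ℝ} {g : E3 → ℝ}
    (hb : ∀ x ∈ S, ∀ y ∈ S, b x y = g y - g x) (n : ℕ) {x y : E3} (hx : x ∈ S) (hy : y ∈ S) :
    edgeSub b n x y = g y - g x := by
  refine edgeSub_eq_sub hS (δ := dist x y + 1) (fun x hx y hy _ => hb x hx y hy) n x hx y hy ?_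
  have h1 : (1 : ℝ) ≤ 2 ^ n := one_le_pow₀ one_le_two
  nlinarith [dist_nonneg (x := x) (y := y)]

/-- The edges of the middle triangle occur once in each direction and cancel by antisymmetry, so
only the halves of the outer edges remain. -/
theorem faceSub_eq {S : Set E3} (hS : Convex ℝ S) {b : E3 → E3 → ℝ} {c : E3 → E3 → E3 → ℝ} {δ : ℝ}
    (hb : ∀ x ∈ S, ∀ y ∈ S, dist x y < δ → b x y = -b y x)
    (hc : ∀ x ∈ S, ∀ y ∈ S, ∀ z ∈ S, dist x y < δ → dist y z < δ → dist x z < δ →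
      c x y z = b x y + b y z + b z x) (n : ℕ) : ∀ x ∈ S, ∀ y ∈ S, ∀ z ∈ S,
    dist x y < 2 ^ n * δ → dist y z < 2 ^ n * δ → dist x z < 2 ^ n * δ →
    faceSub c n x y z = edgeSub b n x y + edgeSub b n y z + edgeSub b n z x := by
  induction n with
  | zero => simpa [edgeSub, faceSub] using hc
  | succ n ih =>
    intro x hx y hy z hz hxy hyz hxz
    have mxy := midpoint_mem hS hx hy
    have myz := midpoint_mem hS hy hz
    have mxz := midpoint_mem hS hx hz
    obtain ⟨xy1, xy2⟩ := dist_midpoint_lt hxy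
    obtain ⟨yz1, yz2⟩ := dist_midpoint_lt hyz
    obtain ⟨xz1, xz2⟩ := dist_midpoint_lt hxz
    have d1 : dist (midpoint ℝ x y) (midpoint ℝ x z) < 2 ^ n * δ := dist_midpoint_midpoint_lt hyz
    have d2 : dist (midpoint ℝ x y) (midpoint ℝ y z) < 2 ^ n * δ := by
      rw [midpoint_comm x y]; exact dist_midpoint_midpoint_lt hxz
    have d3 : dist (midpoint ℝ x z) (midpoint ℝ y z) < 2 ^ n * δ := by
      rw [midpoint_comm x z, midpoint_comm y z]; exact dist_midpoint_midpoint_lt hxy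
    have sw := edgeSub_swap hS hb n
    rw [faceSub, ih x hx _ mxy _ mxz xy1 d1 xz1, ih _ mxy y hy _ myz xy2 yz1 d2,
      ih _ mxz _ myz z hz d3 yz2 xz2, ih _ mxy _ myz _ mxz d2 (by rwa [dist_comm]) d1,
      sw _ mxy _ mxz d1, sw _ mxz _ myz d3, sw _ mxy _ myz d2]
    simp only [edgeSub, midpoint_comm z x]
    ring

theorem faceSub_eq' {S : Set E3} (hS : Convex ℝ S) {b : E3 → E3 → ℝ} {c : E3 → E3 → E3 → ℝ}
    (hb : ∀ x ∈ S, ∀ y ∈ S, b x y = -b y x)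
    (hc : ∀ x ∈ S, ∀ y ∈ S, ∀ z ∈ S, c x y z = b x y + b y z + b z x) (n : ℕ) {x y z : E3}
    (hx : x ∈ S) (hy : y ∈ S) (hz : z ∈ S) :
    faceSub c n x y z = edgeSub b n x y + edgeSub b n y z + edgeSub b n z x := by
  have h1 : (1 : ℝ) ≤ 2 ^ n := one_le_pow₀ one_le_two
  have h2 := dist_nonneg (x := x) (y := y)
  have h3 := dist_nonneg (x := y) (y := z)
  have h4 := dist_nonneg (x := x) (y := z)
  have h5 : dist x y + dist y z + dist x z + 1 ≤ 2 ^ n * (dist x y + dist y z + dist x z + 1) :=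
    le_mul_of_one_le_left (by positivity) h1
  exact faceSub_eq hS (δ := dist x y + dist y z + dist x z + 1)
    (fun x hx y hy _ => hb x hx y hy) (fun x hx y hy z hz _ _ _ => hc x hx y hy z hz) n
    x hx y hy z hz (by linarith) (by linarith) (by linarith)

/-! ### Simplicial cohomology of a mesh of a contractible domain -/

section Cohomology

variable {Ω : Set E3} (T : TetMesh Ω)

/-- A cellwise constant function that agrees on cells with a common vertex is constant. -/
theorem TetMesh.eq_of_agree (hΩ : IsLipschitzDomain Ω) {c : T.Cell → ℝ}
    (hc : ∀ K K' : T.Cell, ∀ a ∈ K.verts, a ∈ K'.verts → c K = c K') (K K' : T.Cell) :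
    c K = c K' := by
  obtain ⟨v, δ, hδ, hv, hvs⟩ := T.exists_vertex_map
  have hpre : IsPreconnected (closure Ω) := hΩ.isConnected.isPreconnected.closure
  have key : ∀ x ∈ closure Ω, ∀ y ∈ closure Ω, ∀ K K' : T.Cell, v x ∈ K.verts →
      v y ∈ K'.verts → c K = c K' := by
    intro x hx y hy
    -- On a preconnected set a transitive relation that holds between nearby points holds between
    -- all; nearby points have labels in a common cell.
    refine hpre.induction₂' (fun x y => ∀ K K' : T.Cell, v x ∈ K.verts →
      v y ∈ K'.verts → c K = c K') (fun x hx => ?_) (fun x y z hx hy hz hxy hyz K K' hK hK' => ?_)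
      hx hy
    · obtain ⟨K₀, hK₀⟩ := hv x hx
      have hx0 := hK₀ x hx (by simpa using hδ)
      filter_upwards [inter_mem_nhdsWithin _ (Metric.ball_mem_nhds x hδ)] with y hy
      have hy0 := hK₀ y hy.1 hy.2
      exact ⟨fun K K' hK hK' => (hc K K₀ _ hK hx0).trans (hc K₀ K' _ hy0 hK'),
        fun K K' hK hK' => (hc K K₀ _ hK hy0).trans (hc K₀ K' _ hx0 hK')⟩
    · obtain ⟨K₀, hK₀⟩ := hv y hy
      have hy0 := hK₀ y hy (by simpa using hδ)
      exact (hxy K K₀ hK hy0).trans (hyz K₀ K' hy0 hK')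
  have hmem : ∀ K : T.Cell, ∃ x ∈ closure Ω, v x ∈ K.verts := fun K => by
    obtain ⟨a, ha⟩ := T.nonempty_of_mem_faces K.2.1
    have := subset_convexHull ℝ (K.1 : Set E3) ha
    exact ⟨a, T.convexHull_subset K.2.1 this, hvs K.1 K.2.1 a this⟩
  obtain ⟨x, hx, hxK⟩ := hmem K
  obtain ⟨y, hy, hyK⟩ := hmem K'
  exact key x hx y hy K K' hxK hyK

theorem TetMesh.vertex_map_self {v : E3 → E3}
    (hvs : ∀ s ∈ T.faces, ∀ x ∈ convexHull ℝ (s : Set E3), v x ∈ s) {K : T.Cell} {a : E3}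
    (ha : a ∈ K.verts) : v a = a := by
  have h1 : ({a} : Finset E3) ∈ T.faces :=
    T.down_closed K.2.1 (Finset.singleton_subset_iff.2 ha) (Finset.singleton_nonempty a)
  simpa using hvs {a} h1 a (subset_convexHull ℝ _ (by simp))

/-- The first cohomology of a mesh of a contractible domain vanishes. -/
theorem TetMesh.exists_potential (hΩ : IsLipschitzDomain Ω) [ContractibleSpace Ω]
    {γ : T.Cell → E3 → ℝ} (hγ : ∀ K K' : T.Cell, ∀ a b, a ∈ K.verts → a ∈ K'.verts →
      b ∈ K.verts → b ∈ K'.verts → γ K b - γ K a = γ K' b - γ K' a) :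
    ∃ g : E3 → ℝ, ∀ K : T.Cell, ∀ a ∈ K.verts, ∀ b ∈ K.verts, g b - g a = γ K b - γ K a := by
  classical
  obtain ⟨v, δ, hδ, hv, hvs⟩ := T.exists_vertex_map
  obtain ⟨ε, hε, N, p, h, h0, hN, hX, hstep⟩ := hΩ.exists_discrete_contraction hδ
  -- By `hγ` the potential difference is the same in every cell containing both vertices, so any
  -- choice will do.
  let l : E3 → E3 → ℝ := fun x y =>
    if H : ∃ K : T.Cell, x ∈ K.verts ∧ y ∈ K.verts then γ H.choose y - γ H.choose x else 0
  have hl : ∀ K : T.Cell, ∀ x ∈ K.verts, ∀ y ∈ K.verts, l x y = γ K y - γ K x := by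
    intro K x hx y hy
    have H : ∃ K : T.Cell, x ∈ K.verts ∧ y ∈ K.verts := ⟨K, hx, hy⟩
    simp only [l, dif_pos H]
    exact hγ _ _ _ _ H.choose_spec.1 hx H.choose_spec.2 hy
  -- Minus the sum of `l` along the labelled track of `x` under the contraction.
  let g : E3 → ℝ := fun x => -∑ j ∈ Finset.range N, l (v (h j x)) (v (h (j + 1) x))
  have hg : ∀ x ∈ closure Ω, ∀ y ∈ closure Ω, dist x y < ε → l (v x) (v y) = g y - g x := by
    intro x hx y hy hxy
    -- The four labels around one rung between two neighbouring tracks lie in one cell, where `l` is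
    -- exact. Summed over `j`, the cross differences telescope.
    have hj : ∀ j, l (v (h j x)) (v (h (j + 1) x)) - l (v (h j y)) (v (h (j + 1) y)) =
        l (v (h j x)) (v (h j y)) - l (v (h (j + 1) x)) (v (h (j + 1) y)) := fun j => by
      obtain ⟨K, hK⟩ := hv (h j x) (hX j x hx)
      have s1 := hstep j x hx x hx (by simpa using hε)
      have s2 := hstep j x hx y hy hxy
      have m1 := hK _ (hX j x hx) s1.1
      have m2 := hK _ (hX (j + 1) x hx) s1.2
      have m3 := hK _ (hX j y hy) s2.1
      have m4 := hK _ (hX (j + 1) y hy) s2.2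
      rw [hl K _ m1 _ m2, hl K _ m3 _ m4, hl K _ m1 _ m3, hl K _ m2 _ m4]
      ring
    have hsum : g y - g x = ∑ j ∈ Finset.range N,
        (l (v (h j x)) (v (h j y)) - l (v (h (j + 1) x)) (v (h (j + 1) y))) := by
      rw [← Finset.sum_congr rfl fun j _ => hj j, Finset.sum_sub_distrib]
      simp only [g]
      ring
    have hp : l (v (h N x)) (v (h N y)) = 0 := by
      obtain ⟨K, hK⟩ := hv (h N x) (hX N x hx)
      have m1 := hK _ (hX N x hx) (by simpa using hδ)
      rw [hN y hy, ← hN x hx, hl K _ m1 _ m1, sub_self]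
    rw [hsum, Finset.sum_range_sub' (fun j => l (v (h j x)) (v (h j y))), hp, sub_zero, h0, h0]
  refine ⟨g, fun K a ha b hb => ?_⟩
  have hS : Convex ℝ (convexHull ℝ (K.1 : Set E3)) := convex_convexHull ℝ _
  have hSX := T.convexHull_subset K.2.1
  have haS : a ∈ convexHull ℝ (K.1 : Set E3) := subset_convexHull ℝ _ ha
  have hbS : b ∈ convexHull ℝ (K.1 : Set E3) := subset_convexHull ℝ _ hb
  obtain ⟨n, hn⟩ := pow_unbounded_of_one_lt (dist a b / ε) (one_lt_two (α := ℝ))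
  rw [div_lt_iff₀ hε] at hn
  -- The subdivided edge is summed twice: with the primitive `g` on short pieces, and with the
  -- potential of `K`, which is valid at every scale inside `K`. Vertices are their own labels.
  have e1 := edgeSub_eq_sub hS (b := fun x y => l (v x) (v y))
    (fun x hx y hy hxy => hg x (hSX hx) y (hSX hy) hxy) n a haS b hbS hn
  have e2 := edgeSub_eq_sub' hS (b := fun x y => l (v x) (v y)) (g := fun x => γ K (v x))
    (fun x hx y hy => hl K _ (hvs K.1 K.2.1 x hx) _ (hvs K.1 K.2.1 y hy)) n haS hbS
  rw [e2] at e1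
  simp only [T.vertex_map_self hvs ha, T.vertex_map_self hvs hb] at e1
  exact e1.symm

/-- The second cohomology of a mesh of a contractible domain vanishes. -/
theorem TetMesh.exists_circulation (hΩ : IsLipschitzDomain Ω) [ContractibleSpace Ω]
    {β : T.Cell → E3 → E3 → ℝ}
    (hanti : ∀ K : T.Cell, ∀ a ∈ K.verts, ∀ b ∈ K.verts, β K a b = -β K b a)
    (hβ : ∀ K K' : T.Cell, ∀ a b c, a ∈ K.verts → a ∈ K'.verts →
      b ∈ K.verts → b ∈ K'.verts → c ∈ K.verts → c ∈ K'.verts →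
      β K a b + β K b c + β K c a = β K' a b + β K' b c + β K' c a) :
    ∃ B : E3 → E3 → ℝ, (∀ K : T.Cell, ∀ a ∈ K.verts, ∀ b ∈ K.verts, B a b = -B b a) ∧
      ∀ K : T.Cell, ∀ a ∈ K.verts, ∀ b ∈ K.verts, ∀ c ∈ K.verts,
        B a b + B b c + B c a = β K a b + β K b c + β K c a := by
  classical
  obtain ⟨v, δ, hδ, hv, hvs⟩ := T.exists_vertex_map
  obtain ⟨ε, hε, N, p, h, h0, hN, hX, hstep⟩ := hΩ.exists_discrete_contraction hδ
  let f : E3 → E3 → E3 → ℝ := fun x y z =>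
    if H : ∃ K : T.Cell, x ∈ K.verts ∧ y ∈ K.verts ∧ z ∈ K.verts then
      β H.choose x y + β H.choose y z + β H.choose z x else 0
  have hf : ∀ K : T.Cell, ∀ x ∈ K.verts, ∀ y ∈ K.verts, ∀ z ∈ K.verts,
      f x y z = β K x y + β K y z + β K z x := by
    intro K x hx y hy z hz
    have H : ∃ K : T.Cell, x ∈ K.verts ∧ y ∈ K.verts ∧ z ∈ K.verts := ⟨K, hx, hy, hz⟩
    simp only [f, dif_pos H]
    exact hβ _ _ _ _ _ H.choose_spec.1 hx H.choose_spec.2.1 hy H.choose_spec.2.2 hz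
  -- The prism operator: the quadrilateral between two tracks is cut into two triangles along a
  -- diagonal.
  let P : ℕ → E3 → E3 → ℝ := fun j x y =>
    f (v (h j x)) (v (h (j + 1) x)) (v (h (j + 1) y)) - f (v (h j x)) (v (h j y)) (v (h (j + 1) y))
  let b : E3 → E3 → ℝ := fun x y => -∑ j ∈ Finset.range N, P j x y
  have hP : ∀ j, ∀ x ∈ closure Ω, ∀ y ∈ closure Ω, ∀ K : T.Cell, v (h j x) ∈ K.verts →
      v (h (j + 1) x) ∈ K.verts → v (h j y) ∈ K.verts → v (h (j + 1) y) ∈ K.verts →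
      P j x y = β K (v (h j x)) (v (h (j + 1) x)) + β K (v (h (j + 1) x)) (v (h (j + 1) y)) -
        β K (v (h j y)) (v (h (j + 1) y)) - β K (v (h j x)) (v (h j y)) := by
    intro j x hx y hy K m1 m2 m3 m4
    simp only [P]
    rw [hf K _ m1 _ m2 _ m4, hf K _ m1 _ m3 _ m4]
    ring
  have hb : ∀ x ∈ closure Ω, ∀ y ∈ closure Ω, dist x y < ε → b x y = -b y x := by
    intro x hx y hy hxy
    have hj : ∀ j, P j x y = -P j y x := fun j => by
      obtain ⟨K, hK⟩ := hv (h j x) (hX j x hx)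
      have s1 := hstep j x hx x hx (by simpa using hε)
      have s2 := hstep j x hx y hy hxy
      have m1 := hK _ (hX j x hx) s1.1
      have m2 := hK _ (hX (j + 1) x hx) s1.2
      have m3 := hK _ (hX j y hy) s2.1
      have m4 := hK _ (hX (j + 1) y hy) s2.2
      rw [hP j x hx y hy K m1 m2 m3 m4, hP j y hy x hx K m3 m4 m1 m2,
        hanti K _ m2 _ m4, hanti K _ m1 _ m3]
      ring
    simp only [b, hj, Finset.sum_neg_distrib]
  have hfb : ∀ x ∈ closure Ω, ∀ y ∈ closure Ω, ∀ z ∈ closure Ω, dist x y < ε → dist y z < ε →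
      dist x z < ε → f (v x) (v y) (v z) = b x y + b y z + b z x := by
    intro x hx y hy z hz hxy hyz hxz
    have hj : ∀ j, P j x y + P j y z + P j z x =
        f (v (h (j + 1) x)) (v (h (j + 1) y)) (v (h (j + 1) z)) -
          f (v (h j x)) (v (h j y)) (v (h j z)) := fun j => by
      obtain ⟨K, hK⟩ := hv (h j x) (hX j x hx)
      have s1 := hstep j x hx x hx (by simpa using hε)
      have s2 := hstep j x hx y hy hxy
      have s3 := hstep j x hx z hz hxz
      have m1 := hK _ (hX j x hx) s1.1
      have m2 := hK _ (hX (j + 1) x hx) s1.2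
      have m3 := hK _ (hX j y hy) s2.1
      have m4 := hK _ (hX (j + 1) y hy) s2.2
      have m5 := hK _ (hX j z hz) s3.1
      have m6 := hK _ (hX (j + 1) z hz) s3.2
      rw [hP j x hx y hy K m1 m2 m3 m4, hP j y hy z hz K m3 m4 m5 m6,
        hP j z hz x hx K m5 m6 m1 m2, hf K _ m1 _ m3 _ m5, hf K _ m2 _ m4 _ m6]
      ring
    have hsum : b x y + b y z + b z x = -∑ j ∈ Finset.range N,
        (f (v (h (j + 1) x)) (v (h (j + 1) y)) (v (h (j + 1) z)) -
          f (v (h j x)) (v (h j y)) (v (h j z))) := by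
      rw [← Finset.sum_congr rfl fun j _ => hj j, Finset.sum_add_distrib, Finset.sum_add_distrib]
      simp only [b]
      ring
    have hp : f (v (h N x)) (v (h N y)) (v (h N z)) = 0 := by
      obtain ⟨K, hK⟩ := hv (h N x) (hX N x hx)
      have m1 := hK _ (hX N x hx) (by simpa using hδ)
      rw [hN y hy, hN z hz, ← hN x hx, hf K _ m1 _ m1 _ m1]
      linarith [hanti K _ m1 _ m1]
    rw [hsum, Finset.sum_range_sub (fun j => f (v (h j x)) (v (h j y)) (v (h j z))), hp, h0, h0, h0]
    ring
  -- One subdivision depth must serve all cells, so that `edgeSub b n` is a single cochain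
  -- independent of the cell.
  obtain ⟨n, hn⟩ := pow_unbounded_of_one_lt (Metric.diam (closure Ω) / ε) (one_lt_two (α := ℝ))
  rw [div_lt_iff₀ hε] at hn
  have hdist : ∀ x ∈ closure Ω, ∀ y ∈ closure Ω, dist x y < 2 ^ n * ε := fun x hx y hy =>
    (Metric.dist_le_diam_of_mem hΩ.isBounded.closure hx hy).trans_lt hn
  have hmem : ∀ K : T.Cell, ∀ a ∈ K.verts, a ∈ convexHull ℝ (K.1 : Set E3) := fun K a ha =>
    subset_convexHull ℝ _ ha
  refine ⟨edgeSub b n, fun K a ha a' ha' => ?_, fun K a₁ h₁ a₂ h₂ a₃ h₃ => ?_⟩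
  · have hSX := T.convexHull_subset K.2.1
    exact edgeSub_swap (convex_convexHull ℝ (K.1 : Set E3))
      (fun x hx y hy hxy => hb x (hSX hx) y (hSX hy) hxy) n a (hmem K a ha) a' (hmem K a' ha')
      (hdist _ (hSX (hmem K a ha)) _ (hSX (hmem K a' ha')))
  · have hSX := T.convexHull_subset K.2.1
    have hS := convex_convexHull ℝ (K.1 : Set E3)
    have hvK := hvs K.1 K.2.1
    have m₁ := hmem K _ h₁
    have m₂ := hmem K _ h₂
    have m₃ := hmem K _ h₃
    have e1 := faceSub_eq hS (c := fun x y z => f (v x) (v y) (v z))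
      (fun x hx y hy hxy => hb x (hSX hx) y (hSX hy) hxy)
      (fun x hx y hy z hz => hfb x (hSX hx) y (hSX hy) z (hSX hz)) n a₁ m₁ a₂ m₂ a₃ m₃
      (hdist _ (hSX m₁) _ (hSX m₂)) (hdist _ (hSX m₂) _ (hSX m₃)) (hdist _ (hSX m₁) _ (hSX m₃))
    have e2 := faceSub_eq' hS (c := fun x y z => f (v x) (v y) (v z))
      (b := fun x y => β K (v x) (v y))
      (fun x hx y hy => hanti K _ (hvK x hx) _ (hvK y hy))
      (fun x hx y hy z hz => hf K _ (hvK x hx) _ (hvK y hy) _ (hvK z hz)) n m₁ m₂ m₃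
    -- Points of the edge `[a, a']` are labelled only by `a` or `a'`. On two labels an antisymmetric
    -- cochain is a coboundary, so its subdivided sum telescopes to its value on the edge.
    have e3 : ∀ a ∈ K.verts, ∀ a' ∈ K.verts,
        edgeSub (fun x y => β K (v x) (v y)) n a a' = β K a a' := by
      intro a ha a' ha'
      have hface : ({a, a'} : Finset E3) ∈ T.faces :=
        T.down_closed K.2.1 (pair_subset.2 ⟨ha, ha'⟩) ⟨a, by simp⟩
      have h0 := hanti K a ha a ha
      have h0' := hanti K a' ha' a' ha'
      have h1 := hanti K a ha a' ha'
      have e := edgeSub_eq_sub' (convex_convexHull ℝ (({a, a'} : Finset E3) : Set E3))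
        (b := fun x y => β K (v x) (v y)) (g := fun x => if v x = a then 0 else β K a a')
        (fun x hx y hy => by
          have hx' := hvs _ hface x hx
          have hy' := hvs _ hface y hy
          simp only [Finset.mem_insert, Finset.mem_singleton] at hx' hy'
          by_cases haa : a' = a
          · subst haa
            simp only [or_self] at hx' hy'
            simp only [hx', hy', if_true]
            linarith
          · rcases hx' with hx' | hx' <;> rcases hy' with hy' | hy' <;>
              simp only [hx', hy', if_true, if_neg haa] <;> linarith) n
        (x := a) (y := a') (subset_convexHull ℝ _ (by simp)) (subset_convexHull ℝ _ (by simp))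
      rw [e, T.vertex_map_self hvs ha, T.vertex_map_self hvs ha', if_pos rfl]
      split_ifs with haa
      · subst haa; linarith
      · ring
    rw [e3 _ h₁ _ h₂, e3 _ h₂ _ h₃, e3 _ h₃ _ h₁] at e2
    rw [← e1, e2]

end Cohomology

/-! ### Affine polynomials, barycentric coordinates and tangential traces -/

section LinearPolynomials

open MvPolynomial

/-! ### Polynomials of degree one -/

theorem dirDeriv_tangent_eq_C {l : Poly} (hl : l.totalDegree ≤ 1) (a b : E3) :
    dirDeriv (tangent a b) l = C (ev b l - ev a l) := by
  have h0 : (dirDeriv (tangent a b) l).totalDegree = 0 := by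
    have := totalDegree_dirDeriv_le (tangent a b) l
    omega
  have h1 := totalDegree_eq_zero_iff_eq_C.1 h0
  have h2 := edgeInt_dirDeriv a b l
  rw [h1] at h2
  have h3 : edgeInt a b (C (coeff 0 (dirDeriv (tangent a b) l))) =
      coeff 0 (dirDeriv (tangent a b) l) := by
    change (∫ t in (0 : ℝ)..1, ev (a + t • (b - a)) _) = _
    simp
  rw [h1, ← h2, h3]

theorem ev_line {l : Poly} (hl : l.totalDegree ≤ 1) (x a b : E3) (t : ℝ) :
    ev (x + t • (b - a)) l = ev x l + t * (ev b l - ev a l) := by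
  have h1 := dirDeriv_tangent_eq_C hl x (x + t • (b - a))
  have h2 := dirDeriv_tangent_eq_C hl a b
  have h3 : tangent x (x + t • (b - a)) = t • tangent a b := by ext i; simp [tangent]
  have h4 : dirDeriv (t • tangent a b) l = t • dirDeriv (tangent a b) l := by
    simp only [dirDeriv_apply, Pi.smul_apply, smul_eq_mul]; module
  rw [h3, h4, h2, smul_eq_C_mul, ← C_mul] at h1
  have := C_injective _ _ h1
  linarith

theorem ev_edge {l : Poly} (hl : l.totalDegree ≤ 1) (a b : E3) (t : ℝ) :
    ev (a + t • (b - a)) l = (1 - t) * ev a l + t * ev b l := by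
  rw [ev_line hl]; ring

theorem ev_face {l : Poly} (hl : l.totalDegree ≤ 1) (a b c : E3) (s t : ℝ) :
    ev (a + s • (b - a) + t • (c - a)) l = (1 - s - t) * ev a l + s * ev b l + t * ev c l := by
  rw [ev_line hl, ev_line hl]; ring

theorem ev_eq_zero_of_mem_convexHull {l : Poly} (hl : l.totalDegree ≤ 1) {S : Finset E3}
    (h : ∀ a ∈ S, ev a l = 0) {x : E3} (hx : x ∈ convexHull ℝ (S : Set E3)) : ev x l = 0 := by
  refine convexHull_min (t := {x | ev x l = 0}) (fun a ha => h a ha) ?_ hx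
  rw [convex_iff_segment_subset]
  rintro y hy z hz _ ⟨s, t, hs, ht, hst, rfl⟩
  have hy' : ev y l = 0 := hy
  have hz' : ev z l = 0 := hz
  have e : s • y + t • z = y + t • (z - y) := by
    rw [show s = 1 - t by linarith]; module
  change ev _ l = 0
  rw [e, ev_edge hl, hy', hz']; ring

/-! ### Barycentric coordinates -/

/-- The determinant of `b - a`, `c - a`, `d - a`. -/
def vol (a b c d : E3) : ℝ := normal a b c ⬝ᵥ tangent a d

theorem vol_eq (a b c d : E3) : vol a b c d =
    ((b 1 - a 1) * (c 2 - a 2) - (b 2 - a 2) * (c 1 - a 1)) * (d 0 - a 0) +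
    ((b 2 - a 2) * (c 0 - a 0) - (b 0 - a 0) * (c 2 - a 2)) * (d 1 - a 1) +
    ((b 0 - a 0) * (c 1 - a 1) - (b 1 - a 1) * (c 0 - a 0)) * (d 2 - a 2) := by
  simp [vol, normal, crossProduct, tangent, dotProduct, Fin.sum_univ_three]

/-- The linear polynomial whose value at `x` is `vol a b c x`. -/
def volPoly (a b c : E3) : Poly := ∑ i, C (normal a b c i) * (X i - C (a i))

theorem ev_volPoly (a b c x : E3) : ev x (volPoly a b c) = vol a b c x := by
  simp [volPoly, vol, dotProduct, ev_mul, tangent]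

theorem totalDegree_volPoly (a b c : E3) : (volPoly a b c).totalDegree ≤ 1 := by
  refine totalDegree_finsetSum_le fun i _ => (totalDegree_mul _ _).trans ?_
  rw [totalDegree_C, zero_add]
  exact (totalDegree_sub _ _).trans (max_le (totalDegree_X i).le (by simp))

/-- A linear relation between the three edge vectors at `a` gives weights of sum zero that
contradict affine independence. -/
theorem vol_ne_zero {K : Finset E3} (hK : AffineIndependent ℝ ((↑) : K → E3)) {a b c d : E3}
    (ha : a ∈ K) (hb : b ∈ K) (hc : c ∈ K) (hd : d ∈ K) (hab : a ≠ b) (hac : a ≠ c) (had : a ≠ d)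
    (hbc : b ≠ c) (hbd : b ≠ d) (hcd : c ≠ d) : vol a b c d ≠ 0 := by
  intro h0
  let M : Matrix (Fin 3) (Fin 3) ℝ := ![tangent a b, tangent a c, tangent a d]
  have hM : M.det = 0 := by
    rw [← h0, vol_eq, Matrix.det_fin_three]
    simp [M, tangent]
    ring
  obtain ⟨w, hw, hwM⟩ := Matrix.exists_vecMul_eq_zero_iff.2 hM
  let f : Fin 4 ↪ K := ⟨![⟨a, ha⟩, ⟨b, hb⟩, ⟨c, hc⟩, ⟨d, hd⟩], by
    intro i j hij
    fin_cases i <;> fin_cases j <;> simp_all [Subtype.ext_iff]⟩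
  have hf := (affineIndependent_iff.1 (hK.comp_embedding f)) Finset.univ
    ![-(w 0 + w 1 + w 2), w 0, w 1, w 2] (by simp [Fin.sum_univ_four]; ring) (by
      ext i
      have h := congrFun hwM i
      simp [Matrix.vecMul, dotProduct, Fin.sum_univ_three, M, tangent] at h
      simp only [Fin.sum_univ_four, Matrix.cons_val, PiLp.add_apply, PiLp.smul_apply, smul_eq_mul]
      change -(w 0 + w 1 + w 2) * a i + w 0 * b i + w 1 * c i + w 2 * d i = 0
      linarith)
  apply hw
  ext i
  fin_cases i
  · simpa using hf 1 (Finset.mem_univ _)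
  · simpa using hf 2 (Finset.mem_univ _)
  · simpa using hf 3 (Finset.mem_univ _)

/-- `lam` is a family of barycentric coordinates for the simplex with vertex set `K`. -/
def IsBarycentric (K : Finset E3) (lam : E3 → Poly) : Prop :=
  ∀ v ∈ K, (lam v).totalDegree ≤ 1 ∧ ev v (lam v) = 1 ∧ ∀ w ∈ K, w ≠ v → ev w (lam v) = 0

theorem TetMesh.Cell.exists_barycentric {Ω : Set E3} {T : TetMesh Ω} (K : T.Cell) :
    ∃ lam, IsBarycentric K.verts lam := by
  classical
  have h : ∀ v ∈ K.verts, ∃ l : Poly, l.totalDegree ≤ 1 ∧ ev v l = 1 ∧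
      ∀ w ∈ K.verts, w ≠ v → ev w l = 0 := by
    intro v hv
    have hc : (K.verts.erase v).card = 3 := by
      rw [Finset.card_erase_of_mem hv, show K.verts.card = 4 from K.2.2]
    obtain ⟨a, b, c, hab, hac, hbc, habc⟩ := Finset.card_eq_three.1 hc
    have hmem : ∀ x, x ∈ K.verts.erase v ↔ x = a ∨ x = b ∨ x = c := by simp [habc]
    have ha := Finset.mem_erase.1 ((hmem a).2 (by simp))
    have hb := Finset.mem_erase.1 ((hmem b).2 (by simp))
    have hc := Finset.mem_erase.1 ((hmem c).2 (by simp))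
    have hv0 := vol_ne_zero (T.indep K.2.1) ha.2 hb.2 hc.2 hv hab hac ha.1 hbc hb.1 hc.1
    refine ⟨(vol a b c v)⁻¹ • volPoly a b c, (totalDegree_smul_le _ _).trans
      (totalDegree_volPoly a b c), ?_, fun w hw hwv => ?_⟩
    · rw [map_smul, ev_volPoly, smul_eq_mul, inv_mul_cancel₀ hv0]
    · rw [map_smul, ev_volPoly, smul_eq_mul]
      have : vol a b c w = 0 := by
        rcases (hmem w).1 (Finset.mem_erase.2 ⟨hwv, hw⟩) with rfl | rfl | rfl <;>
          rw [vol_eq] <;> ring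
      rw [this, mul_zero]
  choose! lam hlam using h
  exact ⟨lam, hlam⟩

/-! ### Fields with vanishing tangential trace -/

/-- The components of `v` tangential to the simplex with vertex set `S` vanish on it. -/
def TraceZero (S : Finset E3) (v : VPoly) : Prop :=
  ∀ a ∈ S, ∀ b ∈ S, ∀ x ∈ convexHull ℝ (S : Set E3), ev x (along (tangent a b) v) = 0

theorem TraceZero.add {S : Finset E3} {u v : VPoly} (hu : TraceZero S u) (hv : TraceZero S v) :
    TraceZero S (u + v) := fun a ha b hb x hx => by
  rw [map_add, map_add, hu a ha b hb x hx, hv a ha b hb x hx, add_zero]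

theorem along_smul (d : Fin 3 → ℝ) (p : Poly) (v : VPoly) : along d (p • v) = p * along d v := by
  simp only [along_apply, Pi.smul_apply, smul_eq_mul, mul_add, mul_smul_comm]

theorem TraceZero.smul {S : Finset E3} {v : VPoly} (hv : TraceZero S v) (p : Poly) :
    TraceZero S (p • v) := fun a ha b hb x hx => by
  rw [along_smul, ev_mul, hv a ha b hb x hx, mul_zero]

theorem TraceZero.neg {S : Finset E3} {v : VPoly} (hv : TraceZero S v) :
    TraceZero S (-v) := fun a ha b hb x hx => by
  rw [map_neg, map_neg, hv a ha b hb x hx, neg_zero]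

theorem TraceZero.sub {S : Finset E3} {u v : VPoly} (hu : TraceZero S u) (hv : TraceZero S v) :
    TraceZero S (u - v) := sub_eq_add_neg u v ▸ hu.add hv.neg

theorem traceZero_grad {S : Finset E3} {l : Poly} (hl : l.totalDegree ≤ 1)
    (h : ∀ a ∈ S, ev a l = 0) : TraceZero S (grad l) := fun a ha b hb x _ => by
  rw [along_grad, dirDeriv_tangent_eq_C hl, h a ha, h b hb]; simp

theorem traceZero_smul {S : Finset E3} {l : Poly} (hl : l.totalDegree ≤ 1)
    (h : ∀ a ∈ S, ev a l = 0) (v : VPoly) : TraceZero S (l • v) := fun a ha b hb x hx => by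
  rw [along_smul, ev_mul, ev_eq_zero_of_mem_convexHull hl h hx, zero_mul]

theorem grad_mul (p q : Poly) : grad (p * q) = q • grad p + p • grad q := by
  ext1 i
  simp only [grad_apply, Pi.add_apply, Pi.smul_apply, smul_eq_mul, pderiv_mul]
  ring

/-- This localises the corrections built from bubbles: a multiple of a barycentric coordinate has no
tangential gradient on a simplex where that coordinate vanishes. -/
theorem traceZero_grad_mul {S : Finset E3} {l : Poly} (hl : l.totalDegree ≤ 1)
    (h : ∀ a ∈ S, ev a l = 0) (p : Poly) : TraceZero S (grad (l * p)) := by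
  rw [grad_mul]
  exact ((traceZero_grad hl h).smul p).add (traceZero_smul hl h _)

end LinearPolynomials

/-! ### Vanishing and positivity of moments -/

section Integrals

theorem edgeInt_eq_zero {a b : E3} {p : Poly}
    (h : ∀ t : ℝ, 0 ≤ t → t ≤ 1 → ev (a + t • (b - a)) p = 0) : edgeInt a b p = 0 := by
  change (∫ t in (0 : ℝ)..1, ev (a + t • (b - a)) p) = 0
  refine intervalIntegral.integral_zero_ae (Filter.Eventually.of_forall fun t ht => ?_)
  rw [Set.uIoc_of_le zero_le_one] at ht
  exact h t ht.1.le ht.2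

theorem faceInt_eq_zero {a b c : E3} {p : Poly}
    (h : ∀ s t : ℝ, 0 ≤ s → 0 < t → s + t ≤ 1 → ev (a + s • (b - a) + t • (c - a)) p = 0) :
    faceInt a b c p = 0 := by
  change (∫ s in (0 : ℝ)..1, ∫ t in (0 : ℝ)..(1 - s), _) = 0
  refine intervalIntegral.integral_zero_ae (Filter.Eventually.of_forall fun s hs => ?_)
  rw [Set.uIoc_of_le zero_le_one] at hs
  refine intervalIntegral.integral_zero_ae (Filter.Eventually.of_forall fun t ht => ?_)
  rw [Set.uIoc_of_le (by linarith [hs.2])] at ht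
  exact h s t hs.1.le ht.1 (by linarith [ht.2])

theorem eq_zero_of_integral_eq_zero {f : ℝ → ℝ} (hf : Continuous f) {r : ℝ}
    (h0 : ∀ t, 0 ≤ t → t ≤ r → 0 ≤ f t) (h : ∫ t in (0 : ℝ)..r, f t = 0) {t : ℝ}
    (ht0 : 0 ≤ t) (htr : t ≤ r) (hr : 0 < r) : f t = 0 := by
  by_contra hne
  have hpos : 0 < f t := lt_of_le_of_ne (h0 t ht0 htr) (Ne.symm hne)
  have := intervalIntegral.integral_pos hr hf.continuousOn
    (fun x hx => h0 x hx.1.le hx.2) ⟨t, ⟨ht0, htr⟩, hpos⟩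
  linarith

theorem ev_eq_zero_of_edgeInt_eq_zero {a b : E3} {p : Poly}
    (h0 : ∀ t : ℝ, 0 ≤ t → t ≤ 1 → 0 ≤ ev (a + t • (b - a)) p) (h : edgeInt a b p = 0) {t : ℝ}
    (ht0 : 0 ≤ t) (ht1 : t ≤ 1) : ev (a + t • (b - a)) p = 0 :=
  eq_zero_of_integral_eq_zero (continuous_ev_line a (b - a) p) h0 h ht0 ht1 one_pos

theorem ev_eq_zero_of_faceInt_eq_zero {a b c : E3} {p : Poly}
    (h0 : ∀ s t : ℝ, 0 ≤ s → 0 ≤ t → s + t ≤ 1 → 0 ≤ ev (a + s • (b - a) + t • (c - a)) p)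
    (h : faceInt a b c p = 0) {s t : ℝ} (hs : 0 ≤ s) (ht : 0 < t) (hst : s + t ≤ 1) :
    ev (a + s • (b - a) + t • (c - a)) p = 0 := by
  have h1 := eq_zero_of_integral_eq_zero (continuous_faceInt_aux a b c p)
    (fun s hs hs1 => intervalIntegral.integral_nonneg (by linarith)
      fun t ht => h0 s t hs ht.1 (by linarith [ht.2])) h hs (by linarith) one_pos
  exact eq_zero_of_integral_eq_zero (continuous_ev_line (a + s • (b - a)) (c - a) p)
    (fun t ht ht1 => h0 s t hs ht (by linarith)) h1 ht.le (by linarith) (by linarith)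

theorem faceInt_nonneg {a b c : E3} {p : Poly}
    (h0 : ∀ s t : ℝ, 0 ≤ s → 0 ≤ t → s + t ≤ 1 → 0 ≤ ev (a + s • (b - a) + t • (c - a)) p) :
    0 ≤ faceInt a b c p :=
  intervalIntegral.integral_nonneg zero_le_one fun s hs =>
    intervalIntegral.integral_nonneg (by linarith [hs.2]) fun t ht =>
      h0 s t hs.1 ht.1 (by linarith [ht.2])

/-- A polynomial whose derivative vanishes on a segment is constant on it. -/
theorem ev_eq_of_dirDeriv_eq_zero {x e : E3} {p : Poly} {r : ℝ} (hr : 0 ≤ r)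
    (h : ∀ t, 0 < t → t < r → ev (x + t • e) (dirDeriv (fun i => e i) p) = 0) :
    ev (x + r • e) p = ev x p := by
  rcases hr.eq_or_lt with rfl | hr
  · simp
  obtain ⟨t, ht, h1⟩ := exists_hasDerivAt_eq_slope (fun t : ℝ => ev (x + t • e) p) _ hr
    (continuous_ev_line x e p).continuousOn (fun t _ => hasDerivAt_ev_line x e p t)
  rw [h t ht.1 ht.2, eq_comm, div_eq_zero_iff] at h1
  rcases h1 with h1 | h1
  · simpa [sub_eq_zero] using h1
  · linarith

theorem TraceZero.nedelecVanish {S : Finset E3} {v : VPoly} (hv : TraceZero S v) (r : ℕ) :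
    NedelecVanish r S v := by
  have hmem : ∀ a ∈ S, a ∈ convexHull ℝ (S : Set E3) := fun a ha => subset_convexHull ℝ _ ha
  have hconv := convex_convexHull ℝ (S : Set E3)
  refine ⟨fun a b _ ha hb q _ => edgeInt_eq_zero fun t ht0 ht1 => ?_,
    fun a b c _ _ _ ha hb hc q _ => faceInt_eq_zero fun s t hs ht hst => ?_⟩
  · rw [ev_mul, hv a ha b hb, zero_mul]
    have := hconv (hmem a ha) (hmem b hb) (show 0 ≤ 1 - t by linarith) ht0 (by ring)
    convert this using 1
    module
  · rw [ev_mul, hv a ha b hb, zero_mul]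
    have := hconv.sum_mem (t := Finset.univ) (w := ![1 - s - t, s, t]) (z := ![a, b, c])
      (fun i _ => by
        fin_cases i
        · simp; linarith
        · simpa using hs
        · simpa using ht.le) (by simp [Fin.sum_univ_three]; ring)
      (fun i _ => by
        fin_cases i
        · exact hmem a ha
        · exact hmem b hb
        · exact hmem c hc)
    convert this using 1
    simp only [Fin.sum_univ_three, Matrix.cons_val]
    module

end Integrals

/-! ### Moment problems on one edge or face, solved by bubbles and Whitney-type fields -/

section LocalSolvability

open MvPolynomial

/-! ### Solvability of moment problems on edges and faces -/

/-- A functional that vanishes on the right kernel of a bilinear form is represented by it. -/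
theorem exists_bilin_eq {V W : Type*} [AddCommGroup V] [Module ℝ V] [AddCommGroup W] [Module ℝ W]
    [FiniteDimensional ℝ W] (B : V →ₗ[ℝ] W →ₗ[ℝ] ℝ) (φ : W →ₗ[ℝ] ℝ)
    (h : ∀ w, (∀ v, B v w = 0) → φ w = 0) : ∃ v, ∀ w, B v w = φ w := by
  have h1 : φ ∈ (LinearMap.range B).dualCoannihilator.dualAnnihilator := by
    rw [Submodule.mem_dualAnnihilator]
    intro w hw
    rw [Submodule.mem_dualCoannihilator] at hw
    exact h w fun v => hw _ ⟨v, rfl⟩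
  rw [Subspace.dualCoannihilator_dualAnnihilator_eq] at h1
  obtain ⟨v, hv⟩ := h1
  exact ⟨v, fun w => LinearMap.congr_fun hv w⟩

theorem exists_poly_bilin_eq (B : Poly →ₗ[ℝ] Poly →ₗ[ℝ] ℝ) (φ : Poly →ₗ[ℝ] ℝ) (m : ℕ)
    (h : ∀ g, g.totalDegree ≤ m → (∀ p, p.totalDegree ≤ m → B p g = 0) → φ g = 0) :
    ∃ p, p.totalDegree ≤ m ∧ ∀ g, g.totalDegree ≤ m → B p g = φ g := by
  have : FiniteDimensional ℝ (lagrangeShape m) :=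
    inferInstanceAs (Module.Finite ℝ (restrictTotalDegree (Fin 3) ℝ m))
  obtain ⟨p, hp⟩ := exists_bilin_eq (B.domRestrict₁₂ (lagrangeShape m) (lagrangeShape m))
    (φ.domRestrict (lagrangeShape m)) (fun g hg => h g (mem_lagrangeShape.1 g.2) fun p hp =>
      hg ⟨p, mem_lagrangeShape.2 hp⟩)
  exact ⟨p, mem_lagrangeShape.1 p.2, fun g hg => hp ⟨g, mem_lagrangeShape.2 hg⟩⟩

/-- Unique solvability by positivity. Testing a kernel element `g` with `p = D (l g)` and
integrating by parts, the bubble `la * lb` kills the boundary terms and leaves `∫ la lb (D (l g))² =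
0`. Hence `l g` is constant on the edge, and it vanishes at `a`. -/
theorem exists_edge_bubble {a b : E3} {la lb l : Poly} (hla : la.totalDegree ≤ 1)
    (hlb : lb.totalDegree ≤ 1) (hl : l.totalDegree ≤ 1) (haa : ev a la = 1) (hba : ev b la = 0)
    (hab : ev a lb = 0) (hbb : ev b lb = 1) (hal : ev a l = 0) (φ : Poly →ₗ[ℝ] ℝ)
    (hφ : ∀ g, (∀ t : ℝ, 0 ≤ t → t ≤ 1 → ev (a + t • (b - a)) (l * g) = 0) → φ g = 0) (m : ℕ) :
    ∃ p : Poly, p.totalDegree ≤ m ∧ ∀ g : Poly, g.totalDegree ≤ m →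
      edgeInt a b (dirDeriv (tangent a b) (la * (lb * p)) * (l * g)) = φ g := by
  let D : Poly →ₗ[ℝ] Poly := (dirDeriv (tangent a b)).toLinearMap
  refine exists_poly_bilin_eq (((LinearMap.mul ℝ Poly).compr₂ (edgeInt a b)).compl₁₂
    (D ∘ₗ LinearMap.mulLeft ℝ la ∘ₗ LinearMap.mulLeft ℝ lb) (LinearMap.mulLeft ℝ l)) φ m
    fun g hg hB => hφ g fun r hr0 hr1 => ?_
  set h := dirDeriv (tangent a b) (l * g) with hh
  have hhd : h.totalDegree ≤ m := by
    refine (totalDegree_dirDeriv_le _ _).trans ?_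
    have := totalDegree_mul l g
    omega
  have h1 : edgeInt a b (dirDeriv (tangent a b) (la * (lb * h)) * (l * g)) = 0 := hB h hhd
  have h2 := edgeInt_dirDeriv a b (la * (lb * h) * (l * g))
  rw [dirDeriv_mul, map_add, h1] at h2
  simp only [ev_mul, hba, hab] at h2
  have hpt : ∀ t : ℝ, ev (a + t • (b - a)) (la * (lb * h) * h) =
      (1 - t) * t * ev (a + t • (b - a)) h ^ 2 := fun t => by
    simp only [ev_mul, ev_edge hla, ev_edge hlb, haa, hba, hab, hbb]; ring
  have h3 : ∀ t : ℝ, 0 < t → t < 1 → ev (a + t • (b - a)) h = 0 := fun t ht0 ht1 => by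
    have := ev_eq_zero_of_edgeInt_eq_zero (a := a) (b := b) (p := la * (lb * h) * h)
      (fun t ht0 ht1 => by
        rw [hpt]; exact mul_nonneg (mul_nonneg (by linarith) ht0) (sq_nonneg _))
      (by rw [hh] at h2 ⊢; linarith) ht0.le ht1.le
    rw [hpt] at this
    have h4 : (1 - t) * t ≠ 0 := (mul_pos (by linarith) ht0).ne'
    simpa using (mul_eq_zero.1 this).resolve_left h4
  rw [ev_eq_of_dirDeriv_eq_zero hr0 fun t ht0 ht1 => h3 t ht0 (by linarith), ev_mul, hal, zero_mul]

/-- As on an edge, with the derivative along `[a, b]` only. The factor `l` vanishes on `[a, c]`,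
from which every point of the face is reached in that direction. -/
theorem exists_face_bubble {a b c : E3} (hac : a ≠ c) {la lb lc l : Poly}
    (hla : la.totalDegree ≤ 1) (hlb : lb.totalDegree ≤ 1) (hlc : lc.totalDegree ≤ 1)
    (hl : l.totalDegree ≤ 1) (haa : ev a la = 1) (hba : ev b la = 0) (hca : ev c la = 0)
    (hab : ev a lb = 0) (hbb : ev b lb = 1) (hcb : ev c lb = 0)
    (hac' : ev a lc = 0) (hbc : ev b lc = 0) (hcc : ev c lc = 1)
    (hal : ev a l = 0) (hcl : ev c l = 0) (φ : Poly →ₗ[ℝ] ℝ)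
    (hφ : ∀ g, (∀ s t : ℝ, 0 ≤ s → 0 < t → s + t ≤ 1 →
      ev (a + s • (b - a) + t • (c - a)) (l * g) = 0) → φ g = 0) (m : ℕ) :
    ∃ p : Poly, p.totalDegree ≤ m ∧ ∀ g : Poly, g.totalDegree ≤ m →
      faceInt a b c (dirDeriv (tangent a b) (la * (lb * (lc * p))) * (l * g)) = φ g := by
  let D : Poly →ₗ[ℝ] Poly := (dirDeriv (tangent a b)).toLinearMap
  refine exists_poly_bilin_eq (((LinearMap.mul ℝ Poly).compr₂ (faceInt a b c)).compl₁₂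
    (D ∘ₗ LinearMap.mulLeft ℝ la ∘ₗ LinearMap.mulLeft ℝ lb ∘ₗ LinearMap.mulLeft ℝ lc)
    (LinearMap.mulLeft ℝ l)) φ m fun g hg hB => hφ g fun r t hr0 ht0 hrt => ?_
  set h := dirDeriv (tangent a b) (l * g) with hh
  have hhd : h.totalDegree ≤ m := by
    refine (totalDegree_dirDeriv_le _ _).trans ?_
    have := totalDegree_mul l g
    omega
  have h1 : faceInt a b c (dirDeriv (tangent a b) (la * (lb * (lc * h))) * (l * g)) = 0 := hB h hhd
  have h2 := faceInt_dirDeriv_outer b hac (la * (lb * (lc * h)) * (l * g))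
  have e1 : edgeInt c b (la * (lb * (lc * h)) * (l * g)) = 0 := edgeInt_eq_zero fun t _ _ => by
    simp only [ev_mul, ev_edge hla, hba, hca]; ring
  have e2 : edgeInt a c (la * (lb * (lc * h)) * (l * g)) = 0 := edgeInt_eq_zero fun t _ _ => by
    simp only [ev_mul, ev_edge hlb, hab, hcb]; ring
  rw [dirDeriv_mul, map_add, h1, e1, e2] at h2
  have hpt : ∀ s t : ℝ, ev (a + s • (b - a) + t • (c - a)) (la * (lb * (lc * h)) * h) =
      (1 - s - t) * s * t * ev (a + s • (b - a) + t • (c - a)) h ^ 2 := fun s t => by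
    simp only [ev_mul, ev_face hla, ev_face hlb, ev_face hlc, haa, hba, hca, hab, hbb, hcb, hac',
      hbc, hcc]
    ring
  have h3 : ∀ s t : ℝ, 0 < s → 0 < t → s + t < 1 →
      ev (a + s • (b - a) + t • (c - a)) h = 0 := fun s t hs ht hst => by
    have := ev_eq_zero_of_faceInt_eq_zero (a := a) (b := b) (c := c)
      (p := la * (lb * (lc * h)) * h)
      (fun s t hs ht hst => by
        rw [hpt]
        exact mul_nonneg (mul_nonneg (mul_nonneg (by linarith) hs) ht) (sq_nonneg _))
      (by rw [hh] at h2 ⊢; linarith) hs.le ht hst.le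
    rw [hpt] at this
    have h4 : (1 - s - t) * s * t ≠ 0 := (mul_pos (mul_pos (by linarith) hs) ht).ne'
    simpa using (mul_eq_zero.1 this).resolve_left h4
  have hcomm : ∀ s : ℝ, a + s • (b - a) + t • (c - a) = a + t • (c - a) + s • (b - a) :=
    fun s => by module
  rw [hcomm, ev_eq_of_dirDeriv_eq_zero hr0 fun s hs0 hs1 => ?_, ev_mul, ev_edge hl, hal, hcl]
  · ring
  · rw [← hcomm]
    exact h3 s t hs0 ht0 (by linarith)

/-! ### Fields with prescribed normal moments on a single face -/

/-- A Nédélec field whose tangential trace is supported on the face with barycentric coordinates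
`la`, `lb`, `lc`. -/
def fluxField (a b c : E3) (la lb lc q : Poly) : VPoly :=
  (dirDeriv (tangent a b) q * la) • (lb • grad lc - lc • grad lb) -
    (dirDeriv (tangent b c) q * lc) • (la • grad lb - lb • grad la)

theorem posDot_grad_of_totalDegree_le_one {l : Poly} (hl : l.totalDegree ≤ 1) :
    posDot (grad l) = l - C (coeff 0 l) := by
  ext s
  simp only [posDot, grad_apply, coeff_add, coeff_X_mul_pderiv, coeff_sub, coeff_C]
  have hs : (s 0 : ℝ) * coeff s l + s 1 * coeff s l + s 2 * coeff s l = s.degree * coeff s l := by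
    rw [Finsupp.degree_eq_sum, Fin.sum_univ_three]; push_cast; ring
  rw [hs]
  by_cases h : coeff s l = 0
  · rw [h]
    split_ifs with h0
    · rw [h0, h]; simp
    · simp
  · have h1 : s.degree ≤ 1 := (le_totalDegree (mem_support_iff.2 h)).trans hl
    split_ifs with h0
    · subst h0; simp
    · have h2 : s.degree = 1 := by
        have : s.degree ≠ 0 := fun h => h0 ((Finsupp.degree_eq_zero_iff s).1 h).symm
        omega
      rw [h2]; simp

/-- The position vector times the Whitney field `lb ∇lc - lc ∇lb` is `lb(0) lc - lc(0) lb`: its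
quadratic terms cancel, as the degree criterion for Nédélec shape functions requires. -/
theorem whitney_mem_nedelecShape {r : ℕ} {g lb lc : Poly} (hg : g.totalDegree + 1 ≤ r)
    (hlb : lb.totalDegree ≤ 1) (hlc : lc.totalDegree ≤ 1) :
    g • (lb • grad lc - lc • grad lb) ∈ nedelecShape r := by
  rw [mem_nedelecShape (by omega)]
  constructor
  · intro i
    have h1 : ∀ l l' : Poly, l.totalDegree ≤ 1 → l'.totalDegree ≤ 1 →
        (l * pderiv i l').totalDegree ≤ 1 := fun l l' h h' => by
      have := totalDegree_mul l (pderiv i l')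
      have := totalDegree_pderiv_le i l'
      omega
    refine (totalDegree_mul g (lb * pderiv i lc - lc * pderiv i lb)).trans ?_
    have := (totalDegree_sub (lb * pderiv i lc) (lc * pderiv i lb)).trans
      (max_le (h1 lb lc hlb hlc) (h1 lc lb hlc hlb))
    omega
  · have e : posDot (g • (lb • grad lc - lc • grad lb)) =
        g * (coeff 0 lb • lc - coeff 0 lc • lb) := by
      have e1 : posDot (g • (lb • grad lc - lc • grad lb)) =
          g * (lb * posDot (grad lc) - lc * posDot (grad lb)) := by
        simp only [posDot, Pi.smul_apply, Pi.sub_apply, smul_eq_mul]; ring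
      rw [e1, posDot_grad_of_totalDegree_le_one hlb, posDot_grad_of_totalDegree_le_one hlc,
        smul_eq_C_mul, smul_eq_C_mul]
      ring
    rw [e]
    refine (totalDegree_mul _ _).trans ?_
    have := (totalDegree_sub (coeff 0 lb • lc) (coeff 0 lc • lb)).trans
      (max_le ((totalDegree_smul_le _ _).trans hlc) ((totalDegree_smul_le _ _).trans hlb))
    omega

theorem fluxField_mem_nedelecShape {r : ℕ} {a b c : E3} {la lb lc q : Poly}
    (hla : la.totalDegree ≤ 1) (hlb : lb.totalDegree ≤ 1) (hlc : lc.totalDegree ≤ 1)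
    (hq : q.totalDegree + 1 ≤ r) : fluxField a b c la lb lc q ∈ nedelecShape r := by
  have h : ∀ (d : Fin 3 → ℝ) (l : Poly), l.totalDegree ≤ 1 →
      (dirDeriv d q * l).totalDegree + 1 ≤ r := fun d l hl => by
    rcases totalDegree_dirDeriv_lt d q with h0 | h0
    · rw [h0, zero_mul, totalDegree_zero]; omega
    · have := totalDegree_mul (dirDeriv d q) l
      omega
  exact Submodule.sub_mem _ (whitney_mem_nedelecShape (h _ _ hla) hlb hlc)
    (whitney_mem_nedelecShape (h _ _ hlc) hla hlb)

/-- By Stokes, the flux moments of `fluxField` are minus the symmetric form `∫ (la lb D_ab q D_ab q'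
+ lb lc D_bc q D_bc q' + la lc D_ac q D_ac q')`. It is positive semidefinite, and its kernel
consists of the polynomials constant on the face. So every functional that kills those is attained.
-/
theorem exists_fluxField {a b c : E3} (hac : a ≠ c) {la lb lc : Poly}
    (hla : la.totalDegree ≤ 1) (hlb : lb.totalDegree ≤ 1) (hlc : lc.totalDegree ≤ 1)
    (haa : ev a la = 1) (hba : ev b la = 0) (hca : ev c la = 0)
    (hab : ev a lb = 0) (hbb : ev b lb = 1) (hcb : ev c lb = 0)
    (hac' : ev a lc = 0) (hbc : ev b lc = 0) (hcc : ev c lc = 1) (N : Poly →ₗ[ℝ] ℝ)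
    (hN : ∀ q k, (∀ s t : ℝ, 0 ≤ s → 0 < t → s + t ≤ 1 →
      ev (a + s • (b - a) + t • (c - a)) q = k) → N q = 0) (m : ℕ) :
    ∃ q : Poly, q.totalDegree ≤ m ∧ ∀ q' : Poly, q'.totalDegree ≤ m →
      faceInt a b c (along (normal a b c) (curl (fluxField a b c la lb lc q)) * q') = N q' := by
  let D : (Fin 3 → ℝ) → Poly →ₗ[ℝ] Poly := fun d => (dirDeriv d).toLinearMap
  let B₀ : Poly → (Fin 3 → ℝ) → Poly →ₗ[ℝ] Poly →ₗ[ℝ] ℝ := fun β d =>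
    ((LinearMap.mul ℝ Poly).compr₂ (faceInt a b c)).compl₁₂ (LinearMap.mulLeft ℝ β ∘ₗ D d) (D d)
  have hB₀ : ∀ β d q q', B₀ β d q q' = faceInt a b c (β * dirDeriv d q * dirDeriv d q') :=
    fun β d q q' => rfl
  let B : Poly →ₗ[ℝ] Poly →ₗ[ℝ] ℝ := B₀ (la * lb) (tangent a b) +
    B₀ (lb * lc) (tangent b c) + B₀ (la * lc) (tangent a c)
  have hB : ∀ q q', B q q' = B₀ (la * lb) (tangent a b) q q' +
    B₀ (lb * lc) (tangent b c) q q' + B₀ (la * lc) (tangent a c) q q' := fun q q' => rfl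
  have hflux : ∀ q q', faceInt a b c
      (along (normal a b c) (curl (fluxField a b c la lb lc q)) * q') = -B q q' := by
    intro q q'
    have hal : ∀ d, along d (fluxField a b c la lb lc q) =
        (dirDeriv (tangent a b) q * la) * (lb * dirDeriv d lc - lc * dirDeriv d lb) -
        (dirDeriv (tangent b c) q * lc) * (la * dirDeriv d lb - lb * dirDeriv d la) := fun d => by
      simp only [fluxField, map_sub, along_smul, along_grad]
    have e1 : edgeInt a b (along (tangent a b) (fluxField a b c la lb lc q) * q') = 0 :=
      edgeInt_eq_zero fun t _ _ => by
        simp only [hal, dirDeriv_tangent_eq_C hlc, dirDeriv_tangent_eq_C hlb, ev_mul, map_sub,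
          ev_edge hlc, ev_C, hac', hbc]
        ring
    have e2 : edgeInt b c (along (tangent b c) (fluxField a b c la lb lc q) * q') = 0 :=
      edgeInt_eq_zero fun t _ _ => by
        simp only [hal, dirDeriv_tangent_eq_C hla, ev_mul, map_sub, ev_edge hla, ev_C, hba, hca]
        ring
    have e3 : edgeInt a c (along (tangent a c) (fluxField a b c la lb lc q) * q') = 0 :=
      edgeInt_eq_zero fun t _ _ => by
        simp only [hal, dirDeriv_tangent_eq_C hlb, ev_mul, map_sub, ev_edge hlb, ev_C, hab, hcb]
        ring
    rw [faceInt_curl_mul hac, e1, e2, e3, hB, hB₀, hB₀, hB₀, ← map_add, ← map_add, ← map_neg,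
      add_zero, sub_zero, zero_sub, ← map_neg, ← map_add]
    congr 1
    have hD : ∀ p, dirDeriv (tangent b c) p =
        dirDeriv (tangent a c) p - dirDeriv (tangent a b) p := fun p => by
      rw [← tangent_sub a b c, dirDeriv_sub_left]
    simp only [hal, hD, dirDeriv_tangent_eq_C hla, dirDeriv_tangent_eq_C hlb,
      dirDeriv_tangent_eq_C hlc, haa, hba, hca, hab, hbb, hcb, hac', hbc, hcc, sub_zero, sub_self,
      zero_sub, map_zero, map_one, map_neg]
    ring
  obtain ⟨q, hq, hqN⟩ := exists_poly_bilin_eq (-B) N m fun q hq hker => by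
    have h0 : -B q q = 0 := hker q hq
    rw [hB, hB₀, hB₀, hB₀] at h0
    have pab : ∀ s t : ℝ, ev (a + s • (b - a) + t • (c - a))
        (la * lb * dirDeriv (tangent a b) q * dirDeriv (tangent a b) q) = (1 - s - t) * s *
        ev (a + s • (b - a) + t • (c - a)) (dirDeriv (tangent a b) q) ^ 2 := fun s t => by
      simp only [ev_mul, ev_face hla, ev_face hlb, haa, hba, hca, hab, hbb, hcb]; ring
    have pbc : ∀ s t : ℝ, ev (a + s • (b - a) + t • (c - a))
        (lb * lc * dirDeriv (tangent b c) q * dirDeriv (tangent b c) q) = s * t *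
        ev (a + s • (b - a) + t • (c - a)) (dirDeriv (tangent b c) q) ^ 2 := fun s t => by
      simp only [ev_mul, ev_face hlb, ev_face hlc, hac', hbc, hcc, hab, hbb, hcb]; ring
    have pac : ∀ s t : ℝ, ev (a + s • (b - a) + t • (c - a))
        (la * lc * dirDeriv (tangent a c) q * dirDeriv (tangent a c) q) = (1 - s - t) * t *
        ev (a + s • (b - a) + t • (c - a)) (dirDeriv (tangent a c) q) ^ 2 := fun s t => by
      simp only [ev_mul, ev_face hla, ev_face hlc, haa, hba, hca, hac', hbc, hcc]; ring
    have nab : ∀ s t : ℝ, 0 ≤ s → 0 ≤ t → s + t ≤ 1 → 0 ≤ ev (a + s • (b - a) + t • (c - a))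
        (la * lb * dirDeriv (tangent a b) q * dirDeriv (tangent a b) q) := fun s t hs ht hst => by
      rw [pab]; exact mul_nonneg (mul_nonneg (by linarith) hs) (sq_nonneg _)
    have nbc : ∀ s t : ℝ, 0 ≤ s → 0 ≤ t → s + t ≤ 1 → 0 ≤ ev (a + s • (b - a) + t • (c - a))
        (lb * lc * dirDeriv (tangent b c) q * dirDeriv (tangent b c) q) := fun s t hs ht hst => by
      rw [pbc]; exact mul_nonneg (mul_nonneg hs ht) (sq_nonneg _)
    have nac : ∀ s t : ℝ, 0 ≤ s → 0 ≤ t → s + t ≤ 1 → 0 ≤ ev (a + s • (b - a) + t • (c - a))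
        (la * lc * dirDeriv (tangent a c) q * dirDeriv (tangent a c) q) := fun s t hs ht hst => by
      rw [pac]; exact mul_nonneg (mul_nonneg (by linarith) ht) (sq_nonneg _)
    have iab := faceInt_nonneg nab
    have ibc := faceInt_nonneg nbc
    have iac := faceInt_nonneg nac
    -- Each of the three nonnegative integrals vanishes. Two directions suffice to join `a` to any
    -- point of the face: along `[a, c]`, then parallel to `[a, b]`.
    refine hN q (ev a q) fun r t hr ht hrt => ?_
    have hcomm : ∀ s : ℝ, a + s • (b - a) + t • (c - a) = a + t • (c - a) + s • (b - a) :=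
      fun s => by module
    rw [hcomm, ev_eq_of_dirDeriv_eq_zero hr fun s hs0 hs1 => ?_,
      ev_eq_of_dirDeriv_eq_zero ht.le fun s hs0 hs1 => ?_]
    · have := ev_eq_zero_of_faceInt_eq_zero nac (by linarith) (le_refl 0) hs0 (by linarith)
      rw [pac] at this
      have h4 : (1 - 0 - s) * s ≠ 0 := (mul_pos (by linarith) hs0).ne'
      have := (mul_eq_zero.1 this).resolve_left h4
      rw [zero_smul, add_zero] at this
      exact pow_eq_zero_iff two_ne_zero |>.1 this
    · have := ev_eq_zero_of_faceInt_eq_zero nab (by linarith) hs0.le ht (by linarith)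
      rw [pab] at this
      have h4 : (1 - s - t) * s ≠ 0 := (mul_pos (by linarith) hs0).ne'
      have := (mul_eq_zero.1 this).resolve_left h4
      rw [← hcomm]
      exact pow_eq_zero_iff two_ne_zero |>.1 this
  exact ⟨q, hq, fun q' hq' => by rw [hflux]; exact hqN q' hq'⟩

theorem fluxField_traceZero {S : Finset E3} {a b c : E3} {la lb lc : Poly}
    (hla : la.totalDegree ≤ 1) (hlb : lb.totalDegree ≤ 1) (hlc : lc.totalDegree ≤ 1)
    (h : (∀ x ∈ S, ev x la = 0) ∨ (∀ x ∈ S, ev x lb = 0) ∨ ∀ x ∈ S, ev x lc = 0) (q : Poly) :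
    TraceZero S (fluxField a b c la lb lc q) := by
  rcases h with h | h | h
  · refine TraceZero.sub ?_ ?_
    · rw [mul_smul, smul_comm]
      exact traceZero_smul hla h _
    · exact ((traceZero_smul hla h _).sub ((traceZero_grad hla h).smul lb)).smul _
  · refine TraceZero.sub ?_ ?_
    · exact ((traceZero_smul hlb h _).sub ((traceZero_grad hlb h).smul lc)).smul _
    · exact (((traceZero_grad hlb h).smul la).sub (traceZero_smul hlb h _)).smul _
  · refine TraceZero.sub ?_ ?_
    · exact (((traceZero_grad hlc h).smul lb).sub (traceZero_smul hlc h _)).smul _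
    · rw [mul_smul, smul_comm]
      exact traceZero_smul hlc h _

end LocalSolvability

/-! ### Normalising the gradient freedom by conditions seen identically from every cell -/

section Gauges

open MvPolynomial

/-! ### Gauge conditions on edges and faces -/

/-- An orientation of an edge, with a linear polynomial that parametrizes it. -/
structure EdgeFrame (s : Finset E3) where
  (a b : E3)
  l : Poly
  eq : s = {a, b}
  hab : a ≠ b
  hl : l.totalDegree ≤ 1
  la : ev a l = 0
  lb : ev b l = 1

/-- An ordering of the vertices of a face, with barycentric coordinates of two of them. -/
structure FaceFrame (s : Finset E3) where
  (a b c : E3)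
  (l l' : Poly)
  eq : s = {a, b, c}
  hab : a ≠ b
  hac : a ≠ c
  hbc : b ≠ c
  hl : l.totalDegree ≤ 1
  la : ev a l = 0
  lb : ev b l = 1
  lc : ev c l = 0
  hl' : l'.totalDegree ≤ 1
  la' : ev a l' = 0
  lb' : ev b l' = 0
  lc' : ev c l' = 1

theorem nonempty_edgeFrame {s : Finset E3} (hs : s.card = 2) : Nonempty (EdgeFrame s) := by
  obtain ⟨a, b, hab, rfl⟩ := Finset.card_eq_two.1 hs
  obtain ⟨l, hl, hd⟩ := exists_linear_dirDeriv_eq_one (tangent_ne_zero hab)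
  rw [dirDeriv_tangent_eq_C hl, ← C_1] at hd
  have h1 := C_injective _ _ hd
  refine ⟨⟨a, b, l - C (ev a l), rfl, hab, (totalDegree_sub_C_le _ _).trans hl, ?_, ?_⟩⟩
  · rw [map_sub, ev_C, sub_self]
  · rw [map_sub, ev_C, h1]

theorem nonempty_faceFrame {Ω : Set E3} {T : TetMesh Ω} {s : Finset E3} (hs : s.card = 3)
    {K : T.Cell} (hK : s ⊆ K.verts) : Nonempty (FaceFrame s) := by
  obtain ⟨a, b, c, hab, hac, hbc, rfl⟩ := Finset.card_eq_three.1 hs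
  obtain ⟨ha, hb, hc⟩ := triple_subset.1 hK
  obtain ⟨lam, hlam⟩ := K.exists_barycentric
  obtain ⟨b1, b2, b3⟩ := hlam b hb
  obtain ⟨c1, c2, c3⟩ := hlam c hc
  exact ⟨⟨a, b, c, lam b, lam c, rfl, hab, hac, hbc, b1, b3 a ha hab, b2, b3 c hc hbc.symm,
    c1, c3 a ha hac, c3 b hb hbc, c2⟩⟩

/-- The gauge condition of a field on an edge. -/
def EdgeFrame.Gauge {s : Finset E3} (e : EdgeFrame s) (r : ℕ) (v : VPoly) : Prop :=
  ∀ g : Poly, g.totalDegree + 2 ≤ r → edgeInt e.a e.b (along (tangent e.a e.b) v * (e.l * g)) = 0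

/-- The gauge condition of a field on a face. -/
def FaceFrame.Gauge {s : Finset E3} (f : FaceFrame s) (r : ℕ) (v : VPoly) : Prop :=
  ∀ g : Poly, g.totalDegree + 3 ≤ r →
    faceInt f.a f.b f.c (along (tangent f.a f.b) v * (f.l * g)) = 0

theorem EdgeFrame.mem_a {s : Finset E3} (e : EdgeFrame s) : e.a ∈ s :=
  (pair_subset.1 e.eq.symm.subset).1

theorem EdgeFrame.mem_b {s : Finset E3} (e : EdgeFrame s) : e.b ∈ s :=
  (pair_subset.1 e.eq.symm.subset).2

theorem FaceFrame.subset {s : Finset E3} (f : FaceFrame s) : f.a ∈ s ∧ f.b ∈ s ∧ f.c ∈ s :=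
  triple_subset.1 f.eq.symm.subset

theorem EdgeFrame.Gauge.add {s : Finset E3} {e : EdgeFrame s} {r : ℕ} {v w : VPoly}
    (hv : e.Gauge r v) (hw : e.Gauge r w) : e.Gauge r (v + w) := fun g hg => by
  rw [map_add, add_mul, map_add, hv g hg, hw g hg, add_zero]

theorem EdgeFrame.Gauge.sub {s : Finset E3} {e : EdgeFrame s} {r : ℕ} {v w : VPoly}
    (hv : e.Gauge r v) (hw : e.Gauge r w) : e.Gauge r (v - w) := fun g hg => by
  rw [map_sub, sub_mul, map_sub, hv g hg, hw g hg, sub_zero]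

theorem FaceFrame.Gauge.add {s : Finset E3} {f : FaceFrame s} {r : ℕ} {v w : VPoly}
    (hv : f.Gauge r v) (hw : f.Gauge r w) : f.Gauge r (v + w) := fun g hg => by
  rw [map_add, add_mul, map_add, hv g hg, hw g hg, add_zero]

theorem FaceFrame.Gauge.sub {s : Finset E3} {f : FaceFrame s} {r : ℕ} {v w : VPoly}
    (hv : f.Gauge r v) (hw : f.Gauge r w) : f.Gauge r (v - w) := fun g hg => by
  rw [map_sub, sub_mul, map_sub, hv g hg, hw g hg, sub_zero]

theorem TraceZero.edgeInt_eq_zero {S : Finset E3} {v : VPoly} (hv : TraceZero S v) {a b : E3}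
    (hab : a ≠ b) (ha : a ∈ S) (hb : b ∈ S) (q : Poly) :
    edgeInt a b (along (tangent a b) v * q) = 0 :=
  (hv.nedelecVanish _).1 a b hab ha hb q le_rfl

theorem TraceZero.edgeGauge {s : Finset E3} {v : VPoly} (hv : TraceZero s v) (e : EdgeFrame s)
    (r : ℕ) : e.Gauge r v := fun _ _ => hv.edgeInt_eq_zero e.hab e.mem_a e.mem_b _

theorem TraceZero.faceGauge {s : Finset E3} {v : VPoly} (hv : TraceZero s v) (f : FaceFrame s)
    (r : ℕ) : f.Gauge r v := fun _ _ =>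
  (hv.nedelecVanish _).2 _ _ _ f.hab f.hac f.hbc f.subset.1 f.subset.2.1 f.subset.2.2 _ le_rfl

theorem traceZero_zero (S : Finset E3) : TraceZero S 0 := fun a _ b _ x _ => by simp

theorem traceZero_sum {ι : Type*} {S : Finset E3} (t : Finset ι) (f : ι → VPoly)
    (h : ∀ i ∈ t, TraceZero S (f i)) : TraceZero S (∑ i ∈ t, f i) :=
  Finset.sum_induction f (TraceZero S) (fun _ _ => TraceZero.add) (traceZero_zero S) h

theorem IsBarycentric.exists_notMem {K S : Finset E3} {lam : E3 → Poly}
    (hlam : IsBarycentric K lam) (hS : S ⊆ K) {x : E3} (hxK : x ∈ K) (hx : x ∉ S) :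
    ∀ a ∈ S, ev a (lam x) = 0 := fun a ha =>
  (hlam x hxK).2.2 a (hS ha) fun h => hx (h ▸ ha)

/-- The correction is an edge bubble. It vanishes at all vertices, so it keeps the edge integrals,
and its gradient has no tangential trace on simplices that do not contain the edge. For `r < 2` the
gauge is vacuous. -/
theorem IsBarycentric.exists_edgeGauge {K s : Finset E3} {lam : E3 → Poly}
    (hlam : IsBarycentric K lam) (hs : s ⊆ K) (e : EdgeFrame s) (r : ℕ) (v : VPoly) :
    ∃ p : Poly, p.totalDegree ≤ r ∧ e.Gauge r (v + grad p) ∧ (∀ x ∈ K, ev x p = 0) ∧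
      ∀ S ⊆ K, ¬ s ⊆ S → TraceZero S (grad p) := by
  obtain ⟨a1, a2, a3⟩ := hlam e.a (hs e.mem_a)
  obtain ⟨b1, b2, b3⟩ := hlam e.b (hs e.mem_b)
  by_cases hr : r < 2
  · exact ⟨0, by simp, fun g hg => by omega, by simp, fun S _ _ => by
      rw [map_zero]; exact traceZero_zero S⟩
  obtain ⟨m, rfl⟩ := Nat.exists_eq_add_of_le' (not_lt.1 hr)
  obtain ⟨p, hp, h⟩ := exists_edge_bubble a1 b1 e.hl a2 (a3 e.b (hs e.mem_b) e.hab.symm)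
    (b3 e.a (hs e.mem_a) e.hab) b2 e.la
    (-(edgeInt e.a e.b ∘ₗ LinearMap.mulLeft ℝ (along (tangent e.a e.b) v) ∘ₗ
      LinearMap.mulLeft ℝ e.l)) (fun g hg => by
        change -edgeInt e.a e.b (along (tangent e.a e.b) v * (e.l * g)) = 0
        rw [edgeInt_eq_zero fun t h0 h1 => by rw [ev_mul, hg t h0 h1, mul_zero], neg_zero]) m
  refine ⟨lam e.a * (lam e.b * p), ?_, fun g hg => ?_, fun x hx => ?_, fun S hS hsS => ?_⟩
  · have := totalDegree_mul (lam e.a) (lam e.b * p)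
    have := totalDegree_mul (lam e.b) p
    omega
  · rw [map_add, add_mul, map_add, along_grad, h g (by omega)]
    change _ + -edgeInt e.a e.b (along (tangent e.a e.b) v * (e.l * g)) = 0
    ring
  · rw [ev_mul, ev_mul]
    by_cases hxa : x = e.a
    · rw [b3 x hx (by rw [hxa]; exact e.hab)]; ring
    · rw [a3 x hx hxa]; ring
  · by_cases ha : e.a ∈ S
    · have hb : e.b ∉ S := fun hb => hsS (by rw [e.eq]; exact pair_subset.2 ⟨ha, hb⟩)
      rw [mul_left_comm]
      exact traceZero_grad_mul b1 (hlam.exists_notMem hS (hs e.mem_b) hb) _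
    · exact traceZero_grad_mul a1 (hlam.exists_notMem hS (hs e.mem_a) ha) _

/-- The face analogue, with a cubic bubble; for `r < 3` the gauge is vacuous. -/
theorem IsBarycentric.exists_faceGauge {K s : Finset E3} {lam : E3 → Poly}
    (hlam : IsBarycentric K lam) (hs : s ⊆ K) (f : FaceFrame s) (r : ℕ) (v : VPoly) :
    ∃ p : Poly, p.totalDegree ≤ r ∧ f.Gauge r (v + grad p) ∧
      ∀ S ⊆ K, ¬ s ⊆ S → TraceZero S (grad p) := by
  obtain ⟨ma, mb, mc⟩ := f.subset
  obtain ⟨a1, a2, a3⟩ := hlam f.a (hs ma)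
  obtain ⟨b1, b2, b3⟩ := hlam f.b (hs mb)
  obtain ⟨c1, c2, c3⟩ := hlam f.c (hs mc)
  by_cases hr : r < 3
  · exact ⟨0, by simp, fun g hg => by omega, fun S _ _ => by
      rw [map_zero]; exact traceZero_zero S⟩
  obtain ⟨m, rfl⟩ := Nat.exists_eq_add_of_le' (not_lt.1 hr)
  obtain ⟨p, hp, h⟩ := exists_face_bubble f.hac a1 b1 c1 f.hl a2 (a3 _ (hs mb) f.hab.symm)
    (a3 _ (hs mc) f.hac.symm) (b3 _ (hs ma) f.hab) b2 (b3 _ (hs mc) f.hbc.symm)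
    (c3 _ (hs ma) f.hac) (c3 _ (hs mb) f.hbc) c2 f.la f.lc
    (-(faceInt f.a f.b f.c ∘ₗ LinearMap.mulLeft ℝ (along (tangent f.a f.b) v) ∘ₗ
      LinearMap.mulLeft ℝ f.l)) (fun g hg => by
        change -faceInt f.a f.b f.c (along (tangent f.a f.b) v * (f.l * g)) = 0
        rw [faceInt_eq_zero fun s t h0 h1 h2 => by rw [ev_mul, hg s t h0 h1 h2, mul_zero],
          neg_zero]) m
  refine ⟨lam f.a * (lam f.b * (lam f.c * p)), ?_, fun g hg => ?_, fun S hS hsS => ?_⟩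
  · have := totalDegree_mul (lam f.a) (lam f.b * (lam f.c * p))
    have := totalDegree_mul (lam f.b) (lam f.c * p)
    have := totalDegree_mul (lam f.c) p
    omega
  · rw [map_add, add_mul, map_add, along_grad, h g (by omega)]
    change _ + -faceInt f.a f.b f.c (along (tangent f.a f.b) v * (f.l * g)) = 0
    ring
  · by_cases ha : f.a ∈ S
    · by_cases hb : f.b ∈ S
      · have hc : f.c ∉ S := fun hc => hsS (by rw [f.eq]; exact triple_subset.2 ⟨ha, hb, hc⟩)
        rw [show lam f.a * (lam f.b * (lam f.c * p)) = lam f.c * (lam f.a * (lam f.b * p)) by ring]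
        exact traceZero_grad_mul c1 (hlam.exists_notMem hS (hs mc) hc) _
      · rw [mul_left_comm]
        exact traceZero_grad_mul b1 (hlam.exists_notMem hS (hs mb) hb) _
    · exact traceZero_grad_mul a1 (hlam.exists_notMem hS (hs ma) ha) _

theorem not_subset_of_card_eq {s t : Finset E3} (h : s.card = t.card) (hne : s ≠ t) : ¬ s ⊆ t :=
  fun hst => hne (Finset.eq_of_subset_of_card_le hst h.ge)

/-- The gradient part of a field can be chosen such that all gauge conditions hold and the edge
integrals have prescribed values. -/
theorem IsBarycentric.exists_gauge {K : Finset E3} {lam : E3 → Poly}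
    (hlam : IsBarycentric K lam) (hK : K.Nonempty)
    (fe : ∀ s : Finset E3, s.card = 2 → s ⊆ K → EdgeFrame s)
    (ff : ∀ s : Finset E3, s.card = 3 → s ⊆ K → FaceFrame s) {r : ℕ} (hr : 1 ≤ r) (v : VPoly)
    (B : E3 → E3 → ℝ) (hB : ∀ a ∈ K, ∀ b ∈ K, B a b = -B b a)
    (hBv : ∀ a ∈ K, ∀ b ∈ K, ∀ c ∈ K, B a b + B b c + B c a =
      edgeInt a b (along (tangent a b) v) + edgeInt b c (along (tangent b c) v) +
        edgeInt c a (along (tangent c a) v)) :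
    ∃ p : Poly, p.totalDegree ≤ r ∧
      (∀ a ∈ K, ∀ b ∈ K, edgeInt a b (along (tangent a b) (v + grad p)) = B a b) ∧
      (∀ s hs hsK, (fe s hs hsK).Gauge r (v + grad p)) ∧
      ∀ s hs hsK, (ff s hs hsK).Gauge r (v + grad p) := by
  classical
  obtain ⟨o, ho⟩ := hK
  -- The defect of the edge integrals. Its sum around each triangle vanishes, so on the simplex it
  -- is the coboundary of `θ o`, which the linear `p₀` removes.
  let θ : E3 → E3 → ℝ := fun a b => edgeInt a b (along (tangent a b) v) - B a b
  have hθ : ∀ a ∈ K, ∀ b ∈ K, θ a b = θ o b - θ o a := by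
    intro a ha b hb
    have h1 := hBv o ho a ha b hb
    have h2 : edgeInt b o (along (tangent b o) v) = -edgeInt o b (along (tangent o b) v) := by
      rw [edgeInt_swap, tangent_swap, along_neg_left, map_neg]
    have h3 := hB b hb o ho
    simp only [θ]
    linarith
  let p₀ : Poly := ∑ x ∈ K, -θ o x • lam x
  have hp₀ : p₀.totalDegree ≤ r := totalDegree_finsetSum_le fun x hx =>
    (totalDegree_smul_le _ _).trans ((hlam x hx).1.trans hr)
  have hp₀v : ∀ x ∈ K, ev x p₀ = -θ o x := fun x hx => by
    rw [map_sum, Finset.sum_eq_single x]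
    · rw [map_smul, (hlam x hx).2.1, smul_eq_mul, mul_one]
    · intro y hy hyx
      rw [map_smul, (hlam y hy).2.2 x hx hyx.symm, smul_zero]
    · exact fun h => absurd hx h
  have he : ∀ s : Finset E3, ∃ p : Poly, ∀ (hs : s.card = 2) (hsK : s ⊆ K), p.totalDegree ≤ r ∧
      (fe s hs hsK).Gauge r (v + grad p₀ + grad p) ∧ (∀ x ∈ K, ev x p = 0) ∧
      ∀ S ⊆ K, ¬ s ⊆ S → TraceZero S (grad p) := fun s => by
    by_cases h : s.card = 2 ∧ s ⊆ K
    · obtain ⟨p, hp⟩ := hlam.exists_edgeGauge h.2 (fe s h.1 h.2) r (v + grad p₀)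
      exact ⟨p, fun _ _ => hp⟩
    · exact ⟨0, fun h1 h2 => absurd ⟨h1, h2⟩ h⟩
  choose pe hpe using he
  let p₁ : Poly := ∑ s ∈ K.powersetCard 2, pe s
  have m2 : ∀ s, s ∈ K.powersetCard 2 ↔ s ⊆ K ∧ s.card = 2 := fun s => Finset.mem_powersetCard
  have hf : ∀ s : Finset E3, ∃ p : Poly, ∀ (hs : s.card = 3) (hsK : s ⊆ K), p.totalDegree ≤ r ∧
      (ff s hs hsK).Gauge r (v + grad p₀ + grad p₁ + grad p) ∧
      ∀ S ⊆ K, ¬ s ⊆ S → TraceZero S (grad p) := fun s => by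
    by_cases h : s.card = 3 ∧ s ⊆ K
    · obtain ⟨p, hp⟩ := hlam.exists_faceGauge h.2 (ff s h.1 h.2) r (v + grad p₀ + grad p₁)
      exact ⟨p, fun _ _ => hp⟩
    · exact ⟨0, fun h1 h2 => absurd ⟨h1, h2⟩ h⟩
  choose pf hpf using hf
  let p₂ : Poly := ∑ s ∈ K.powersetCard 3, pf s
  have m3 : ∀ s, s ∈ K.powersetCard 3 ↔ s ⊆ K ∧ s.card = 3 := fun s => Finset.mem_powersetCard
  -- The corrections are triangular: vertex values first, then edge bubbles, then face bubbles, and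
  -- none disturbs what has been achieved before it.
  have tz : ∀ S ⊆ K, S.card ≤ 2 → TraceZero S (grad p₂) := fun S hS hSc => by
    rw [map_sum]
    refine traceZero_sum _ _ fun s hs => ?_
    obtain ⟨h1, h2⟩ := (m3 s).1 hs
    exact (hpf s h2 h1).2.2 S hS fun h => by have := Finset.card_le_card h; omega
  have hev : v + grad (p₀ + p₁ + p₂) = v + grad p₀ + grad p₁ + grad p₂ := by
    rw [map_add, map_add]; abel
  refine ⟨p₀ + p₁ + p₂, ?_, fun a ha b hb => ?_, fun s hs hsK => ?_, fun s hs hsK => ?_⟩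
  · refine (totalDegree_add _ _).trans (max_le ((totalDegree_add _ _).trans (max_le hp₀ ?_)) ?_)
    · exact totalDegree_finsetSum_le fun s hs => (hpe s ((m2 s).1 hs).2 ((m2 s).1 hs).1).1
    · exact totalDegree_finsetSum_le fun s hs => (hpf s ((m3 s).1 hs).2 ((m3 s).1 hs).1).1
  · by_cases hab : a = b
    · subst hab
      have h1 := hB a ha a ha
      rw [tangent_self]
      have : along 0 (v + grad (p₀ + p₁ + p₂)) = 0 := by simp [along_apply]
      rw [this, map_zero]
      linarith
    have h1 : ∀ x ∈ K, ev x p₁ = 0 := fun x hx => by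
      rw [map_sum]
      exact Finset.sum_eq_zero fun s hs => (hpe s ((m2 s).1 hs).2 ((m2 s).1 hs).1).2.2.1 x hx
    have h2 : edgeInt a b (along (tangent a b) (grad p₂)) = 0 := by
      have := (tz {a, b} (pair_subset.2 ⟨ha, hb⟩) Finset.card_le_two).edgeInt_eq_zero hab
        (by simp) (by simp) 1
      rwa [mul_one] at this
    rw [hev, map_add, map_add, h2]
    simp only [map_add, along_grad, edgeInt_dirDeriv, h1 a ha, h1 b hb, hp₀v a ha, hp₀v b hb]
    have := hθ a ha b hb
    simp only [θ] at this ⊢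
    linarith
  · rw [hev]
    refine EdgeFrame.Gauge.add ?_ ((tz s hsK hs.le).edgeGauge _ r)
    have e1 : grad p₁ = grad (pe s) + ∑ s' ∈ (K.powersetCard 2).erase s, grad (pe s') := by
      rw [map_sum, Finset.add_sum_erase _ (fun s => grad (pe s)) ((m2 s).2 ⟨hsK, hs⟩)]
    rw [e1, ← add_assoc]
    refine (hpe s hs hsK).2.1.add (TraceZero.edgeGauge (traceZero_sum _ _ fun s' hs' => ?_) _ r)
    obtain ⟨hne, hs'⟩ := Finset.mem_erase.1 hs'
    obtain ⟨k1, k2⟩ := (m2 s').1 hs'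
    exact (hpe s' k2 k1).2.2.2 s hsK (not_subset_of_card_eq (k2.trans hs.symm) hne)
  · rw [hev]
    have e1 : grad p₂ = grad (pf s) + ∑ s' ∈ (K.powersetCard 3).erase s, grad (pf s') := by
      rw [map_sum, Finset.add_sum_erase _ (fun s => grad (pf s)) ((m3 s).2 ⟨hsK, hs⟩)]
    rw [e1, ← add_assoc]
    refine (hpf s hs hsK).2.1.add (TraceZero.faceGauge (traceZero_sum _ _ fun s' hs' => ?_) _ r)
    obtain ⟨hne, hs'⟩ := Finset.mem_erase.1 hs'
    obtain ⟨k1, k2⟩ := (m3 s').1 hs'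
    exact (hpf s' k2 k1).2.2 s hsK (not_subset_of_card_eq (k2.trans hs.symm) hne)

/-! ### Fields that satisfy the gauge conditions are determined by their curl -/

theorem edgeInt_mul_of_dirDeriv_eq_zero {a b : E3} {R : Poly} (hR : dirDeriv (tangent a b) R = 0)
    (F : Poly) : edgeInt a b (F * R) = ev a R * edgeInt a b F := by
  have h : edgeInt a b (F * R - ev a R • F) = 0 := edgeInt_eq_zero fun t h0 _ => by
    have : ev (a + t • (b - a)) R = ev a R := ev_eq_of_dirDeriv_eq_zero h0 fun s _ _ => by
      rw [← tangent_eq, hR, map_zero]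
    rw [map_sub, ev_mul, map_smul, this, smul_eq_mul]; ring
  rwa [map_sub, map_smul, smul_eq_mul, sub_eq_zero] at h

theorem EdgeFrame.dirDeriv_l {s : Finset E3} (e : EdgeFrame s) :
    dirDeriv (tangent e.a e.b) e.l = 1 := by
  rw [dirDeriv_tangent_eq_C e.hl, e.la, e.lb, sub_zero, C_1]

/-- On the edge a test polynomial is a constant plus a multiple of `l`; the edge integral handles
the first part and the gauge the second. -/
theorem EdgeFrame.Gauge.edgeInt_eq_zero {s : Finset E3} {e : EdgeFrame s} {r : ℕ} {z : VPoly}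
    (hz : e.Gauge r z) (h0 : edgeInt e.a e.b (along (tangent e.a e.b) z) = 0) {q : Poly}
    (hq : q.totalDegree + 1 ≤ r) : edgeInt e.a e.b (along (tangent e.a e.b) z * q) = 0 := by
  obtain ⟨R, g, rfl, hR, -, hg⟩ := exists_eq_add_mul e.hl e.dirDeriv_l q
  rw [mul_add, map_add, edgeInt_mul_of_dirDeriv_eq_zero hR, h0, mul_zero, zero_add]
  rcases hg with rfl | hg
  · simp
  · exact hz g (by omega)

/-- With vanishing edge and curl moments, Stokes leaves the symmetry `∫ z·(c-a) D_ab Q = ∫ z·(b-a)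
D_ac Q`, which relates the two tangential components. The gauge accounts for the multiples of `l`,
where the symmetry gives no information. -/
theorem FaceFrame.Gauge.faceInt_eq_zero {s : Finset E3} {f : FaceFrame s} {r : ℕ} {z : VPoly}
    (hz : f.Gauge r z)
    (hedge : ∀ a b : E3, a ≠ b → a ∈ s → b ∈ s → ∀ q : Poly, q.totalDegree + 1 ≤ r →
      edgeInt a b (along (tangent a b) z * q) = 0)
    (hcurl : ∀ q : Poly, q.totalDegree + 1 ≤ r →
      faceInt f.a f.b f.c (along (normal f.a f.b f.c) (curl z) * q) = 0) {q : Poly}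
    (hq : q.totalDegree + 2 ≤ r) :
    faceInt f.a f.b f.c (along (tangent f.a f.b) z * q) = 0 ∧
      faceInt f.a f.b f.c (along (tangent f.a f.c) z * q) = 0 := by
  obtain ⟨ma, mb, mc⟩ := f.subset
  have hdl : dirDeriv (tangent f.a f.b) f.l = 1 := by
    rw [dirDeriv_tangent_eq_C f.hl, f.la, f.lb, sub_zero, C_1]
  have hdl' : dirDeriv (tangent f.a f.c) f.l' = 1 := by
    rw [dirDeriv_tangent_eq_C f.hl', f.la', f.lc', sub_zero, C_1]
  have hel' : dirDeriv (tangent f.a f.b) f.l' = 0 := by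
    rw [dirDeriv_tangent_eq_C f.hl', f.la', f.lb', sub_zero, C_0]
  have stokes : ∀ Q : Poly, Q.totalDegree + 1 ≤ r →
      faceInt f.a f.b f.c (along (tangent f.a f.c) z * dirDeriv (tangent f.a f.b) Q) =
        faceInt f.a f.b f.c (along (tangent f.a f.b) z * dirDeriv (tangent f.a f.c) Q) := by
    intro Q hQ
    have h := faceInt_curl_mul f.hac (b := f.b) z Q
    rw [hcurl Q hQ, hedge _ _ f.hab ma mb Q hQ, hedge _ _ f.hbc mb mc Q hQ,
      hedge _ _ f.hac ma mc Q hQ] at h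
    linarith
  have key : ∀ q : Poly, q.totalDegree + 2 ≤ r →
      faceInt f.a f.b f.c (along (tangent f.a f.b) z * q) = 0 := by
    intro q hq
    -- `R` is constant along `[a, b]`, so it is `D_ac Q` for some `Q` with `D_ab Q = 0`; the
    -- symmetry then kills its moment.
    obtain ⟨R, g, rfl, hR, hRd, hg⟩ := exists_eq_add_mul f.hl hdl q
    obtain ⟨Q, hQd, hQ, hQ0⟩ := exists_dirDeriv_eq_of_dirDeriv_eq_zero f.hl' hdl' hel' hR
    have h := stokes Q (by omega)
    rw [hQ, hQ0, mul_zero, map_zero] at h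
    rw [mul_add, map_add, ← h, zero_add]
    rcases hg with rfl | hg
    · simp
    · exact hz g (by omega)
  refine ⟨key q hq, ?_⟩
  obtain ⟨Q, hQd, rfl⟩ := exists_dirDeriv_eq (tangent_ne_zero f.hab) q
  rw [stokes Q (by omega)]
  rcases totalDegree_dirDeriv_lt (tangent f.a f.c) Q with h0 | h0
  · rw [h0, mul_zero, map_zero]
  · exact key _ (by omega)

theorem card_triple {a b c : E3} (hab : a ≠ b) (hac : a ≠ c) (hbc : b ≠ c) :
    ({a, b, c} : Finset E3).card = 3 :=
  Finset.card_eq_three.2 ⟨a, b, c, hab, hac, hbc, rfl⟩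

/-- Applied to the difference of the fields of two cells. The frames may order the vertices
differently from the moment considered, which only changes signs or combines tangents. -/
theorem nedelecVanish_of_gauge {S : Finset E3} {r : ℕ} {z : VPoly}
    (hint : ∀ a ∈ S, ∀ b ∈ S, edgeInt a b (along (tangent a b) z) = 0)
    (hcurl : NormalVanish r S (curl z))
    (he : ∀ s ⊆ S, s.card = 2 → ∃ e : EdgeFrame s, e.Gauge r z)
    (hf : ∀ s ⊆ S, s.card = 3 → ∃ f : FaceFrame s, f.Gauge r z) : NedelecVanish r S z := by
  have hedge : ∀ a b : E3, a ≠ b → a ∈ S → b ∈ S → ∀ q : Poly, q.totalDegree + 1 ≤ r →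
      edgeInt a b (along (tangent a b) z * q) = 0 := by
    intro a b hab ha hb q hq
    obtain ⟨e, hz⟩ := he {a, b} (pair_subset.2 ⟨ha, hb⟩) (Finset.card_pair hab)
    have hS := fun x (hx : x ∈ ({a, b} : Finset E3)) => pair_subset.2 ⟨ha, hb⟩ hx
    have h := hz.edgeInt_eq_zero (hint _ (hS _ e.mem_a) _ (hS _ e.mem_b)) hq
    have m1 := e.mem_a
    have m2 := e.mem_b
    have hne := e.hab
    simp only [Finset.mem_insert, Finset.mem_singleton] at m1 m2
    rcases m1 with m1 | m1 <;> rcases m2 with m2 | m2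
    · exact absurd (m1.trans m2.symm) hne
    · rwa [m1, m2] at h
    · rw [m1, m2, edgeInt_swap, tangent_swap, along_neg_left, neg_mul, map_neg, neg_eq_zero] at h
      exact h
    · exact absurd (m1.trans m2.symm) hne
  refine ⟨hedge, fun a b c hab hac hbc ha hb hc q hq => ?_⟩
  have hsub : ({a, b, c} : Finset E3) ⊆ S := triple_subset.2 ⟨ha, hb, hc⟩
  obtain ⟨f, hz⟩ := hf {a, b, c} hsub (card_triple hab hac hbc)
  obtain ⟨ma, mb, mc⟩ := f.subset
  obtain ⟨h1, h2⟩ := hz.faceInt_eq_zero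
    (fun x y hxy hx hy => hedge x y hxy (hsub hx) (hsub hy))
    (hcurl _ _ _ f.hab f.hac f.hbc (hsub ma) (hsub mb) (hsub mc)) hq
  have key : ∀ x ∈ ({a, b, c} : Finset E3),
      faceInt f.a f.b f.c (along (tangent f.a x) z * q) = 0 := by
    intro x hx
    rw [f.eq, Finset.mem_insert, Finset.mem_insert, Finset.mem_singleton] at hx
    rcases hx with rfl | rfl | rfl
    · rw [tangent_self]
      have : along 0 z = 0 := by simp [along_apply]
      rw [this, zero_mul, map_zero]
    · exact h1
    · exact h2
  rw [faceInt_perm f.hab f.hac f.hbc f.eq, ← tangent_sub f.a a b, along_sub_left, sub_mul, map_sub,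
    key a (by simp), key b (by simp), sub_zero]

end Gauges

/-! ### Exactness at the grad-div space -/

section CurlExact

variable {Ω : Set E3} {T : TetMesh Ω}

theorem exists_curl_eq_of_div_eq_zero {r k : ℕ} {K : Finset E3} {w : VPoly}
    (hw : w ∈ gradDivShape r k K) (hd : div w = 0) : ∃ v ∈ nedelecShape r, curl v = w := by
  obtain ⟨_, ⟨v, hv, rfl⟩, _, ⟨p, -, rfl⟩, rfl⟩ := Submodule.mem_sup.1 hw
  rw [map_add, div_curl, div_poincare, zero_add] at hd
  exact ⟨v, hv, by rw [hd, map_zero, add_zero]⟩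

/-- Local curl preimages are corrected by gradients: first to common edge integrals, by the second
cohomology, then to common gauges. -/
theorem exists_curlH_eq (hΩ : IsLipschitzDomain Ω) [ContractibleSpace Ω] {r k : ℕ} (hr : 1 ≤ r)
    {w : T.Cell → VPoly} (hw : w ∈ gradDivSpace T r k) (hd : divH T w = 0) :
    ∃ v ∈ nedelecSpace T r, curlH T v = w := by
  classical
  obtain ⟨⟨hshape, -⟩, hnormal⟩ := hw
  have h1 : ∀ K : T.Cell, ∃ v ∈ nedelecShape r, curl v = w K := fun K =>
    exists_curl_eq_of_div_eq_zero (hshape K (Set.mem_univ K)) (congrFun hd K)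
  choose v hv hcv using h1
  have hz : ∀ K K' : T.Cell, NormalVanish r (K.verts ∩ K'.verts) (curl (v K - v K')) := by
    intro K K'
    rw [map_sub, hcv, hcv]
    exact mem_normalGlue.1 hnormal K K'
  let β : T.Cell → E3 → E3 → ℝ := fun K a b => edgeInt a b (along (tangent a b) (v K))
  have hanti : ∀ K a b, β K a b = -β K b a := fun K a b => by
    simp only [β]
    rw [edgeInt_swap, tangent_swap, along_neg_left, map_neg]
  have hβ0 : ∀ K a, β K a a = 0 := fun K a => by linarith [hanti K a a]
  have hβ : ∀ K K' : T.Cell, ∀ a b c, a ∈ K.verts → a ∈ K'.verts →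
      b ∈ K.verts → b ∈ K'.verts → c ∈ K.verts → c ∈ K'.verts →
      β K a b + β K b c + β K c a = β K' a b + β K' b c + β K' c a := by
    intro K K' a b c ha ha' hb hb' hc hc'
    by_cases hab : a = b
    · subst hab; rw [hβ0, hβ0, hanti K a c, hanti K' a c]; ring
    by_cases hac : a = c
    · subst hac; rw [hβ0, hβ0, hanti K a b, hanti K' a b]; ring
    by_cases hbc : b = c
    · subst hbc; rw [hβ0, hβ0, hanti K a b, hanti K' a b]; ring
    have h2 := hz K K' a b c hab hac hbc (Finset.mem_inter.2 ⟨ha, ha'⟩)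
      (Finset.mem_inter.2 ⟨hb, hb'⟩) (Finset.mem_inter.2 ⟨hc, hc'⟩) 1 (by simpa using hr)
    rw [faceInt_curl_mul hac] at h2
    have hd1 : ∀ d, dirDeriv d (1 : Poly) = 0 := fun d => (dirDeriv d).map_one_eq_zero
    simp only [hd1, mul_zero, mul_one, map_zero, sub_zero, add_zero, map_sub] at h2
    rw [hanti K c a, hanti K' c a]
    simp only [β]
    linarith
  obtain ⟨B, hB, hBβ⟩ := T.exists_circulation hΩ (fun K a _ b _ => hanti K a b) hβ
  -- The frames are chosen once per edge and face, independently of the cell, so that gauge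
  -- conditions of neighbours can be subtracted.
  let fe : ∀ s : Finset E3, s.card = 2 → EdgeFrame s := fun s hs =>
    Classical.choice (nonempty_edgeFrame hs)
  let ff : ∀ s : Finset E3, s.card = 3 → (∃ K : T.Cell, s ⊆ K.verts) → FaceFrame s :=
    fun s hs hK => Classical.choice (nonempty_faceFrame hs hK.choose_spec)
  have hgauge : ∀ K : T.Cell, ∃ p : Poly, p.totalDegree ≤ r ∧
      (∀ a ∈ K.verts, ∀ b ∈ K.verts,
        edgeInt a b (along (tangent a b) (v K + grad p)) = B a b) ∧
      (∀ s hs, s ⊆ K.verts → (fe s hs).Gauge r (v K + grad p)) ∧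
      ∀ s hs (hsK : s ⊆ K.verts), (ff s hs ⟨K, hsK⟩).Gauge r (v K + grad p) := fun K => by
    obtain ⟨lam, hlam⟩ := K.exists_barycentric
    exact hlam.exists_gauge (T.nonempty_of_mem_faces K.2.1) (fun s hs _ => fe s hs)
      (fun s hs hsK => ff s hs ⟨K, hsK⟩) hr (v K) B (hB K) (hBβ K)
  choose p hp hpB hpe hpf using hgauge
  refine ⟨fun K => v K + grad (p K), ⟨fun K _ => ?_, mem_nedelecGlue.2 fun K K' => ?_⟩,
    funext fun K => ?_⟩
  · exact Submodule.add_mem _ (hv K) (grad_mem_nedelecShape (hp K))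
  · have mK : ∀ x ∈ K.verts ∩ K'.verts, x ∈ K.verts := fun x hx => (Finset.mem_inter.1 hx).1
    have mK' : ∀ x ∈ K.verts ∩ K'.verts, x ∈ K'.verts := fun x hx => (Finset.mem_inter.1 hx).2
    refine nedelecVanish_of_gauge (fun a ha b hb => ?_) ?_
      (fun s hs hc => ⟨fe s hc, (hpe K s hc fun x hx => mK x (hs hx)).sub
        (hpe K' s hc fun x hx => mK' x (hs hx))⟩)
      (fun s hs hc => ⟨ff s hc ⟨K, fun x hx => mK x (hs hx)⟩,
        (hpf K s hc fun x hx => mK x (hs hx)).sub (hpf K' s hc fun x hx => mK' x (hs hx))⟩)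
    · rw [map_sub, map_sub, hpB K a (mK a ha) b (mK b hb), hpB K' a (mK' a ha) b (mK' b hb),
        sub_self]
    · have := hz K K'
      rw [map_sub] at this ⊢
      rwa [map_add, map_add, curl_grad, curl_grad, add_zero, add_zero]
  · change curl (v K + grad (p K)) = w K
    rw [map_add, curl_grad, add_zero, hcv]

end CurlExact

/-! ### Prescribing the normal moments of a curl on the faces of one tetrahedron -/

section Fluxes

open MvPolynomial

/-! ### Alternating functions of three points -/

/-- The alternating real functions of three points. -/
def altFun : Submodule ℝ (E3 → E3 → E3 → ℝ) where
  carrier := {H | (∀ x y z, H y x z = -H x y z) ∧ ∀ x y z, H x z y = -H x y z}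
  add_mem' := by
    rintro F G ⟨h1, h2⟩ ⟨g1, g2⟩
    exact ⟨fun x y z => by simp only [Pi.add_apply, h1 x y z, g1 x y z]; ring,
      fun x y z => by simp only [Pi.add_apply, h2 x y z, g2 x y z]; ring⟩
  zero_mem' := by simp
  smul_mem' := by
    rintro c F ⟨h1, h2⟩
    exact ⟨fun x y z => by simp only [Pi.smul_apply, smul_eq_mul, h1 x y z]; ring,
      fun x y z => by simp only [Pi.smul_apply, smul_eq_mul, h2 x y z]; ring⟩

theorem altFun_self {H : E3 → E3 → E3 → ℝ} (hH : H ∈ altFun) (x y : E3) :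
    H x x y = 0 ∧ H x y x = 0 ∧ H x y y = 0 := by
  have h1 := hH.1 x x y
  have h2 := hH.2 x y y
  have h3 := hH.1 y x x
  have h4 := hH.2 y x x
  exact ⟨by linarith, by linarith, by linarith⟩

theorem altFun_eq_zero {H : E3 → E3 → E3 → ℝ} (hH : H ∈ altFun) {a b c : E3} (h0 : H a b c = 0)
    {x y z : E3} (hx : x ∈ ({a, b, c} : Finset E3)) (hy : y ∈ ({a, b, c} : Finset E3))
    (hz : z ∈ ({a, b, c} : Finset E3)) : H x y z = 0 := by
  have h1 : H b a c = 0 := by rw [hH.1 a b c, h0, neg_zero]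
  have h2 : H a c b = 0 := by rw [hH.2 a b c, h0, neg_zero]
  have h3 : H b c a = 0 := by rw [hH.2 b a c, h1, neg_zero]
  have h4 : H c a b = 0 := by rw [hH.1 a c b, h2, neg_zero]
  have h5 : H c b a = 0 := by rw [hH.1 b c a, h3, neg_zero]
  have hs := altFun_self hH
  simp only [Finset.mem_insert, Finset.mem_singleton] at hx hy hz
  rcases hx with rfl | rfl | rfl <;> rcases hy with rfl | rfl | rfl <;>
    rcases hz with rfl | rfl | rfl <;>
    first | assumption | exact (hs _ _).1 | exact (hs _ _).2.1 | exact (hs _ _).2.2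

theorem altFun_eq {F G : E3 → E3 → E3 → ℝ} (hF : F ∈ altFun) (hG : G ∈ altFun) {a b c : E3}
    (h0 : F a b c = G a b c) {x y z : E3} (hx : x ∈ ({a, b, c} : Finset E3))
    (hy : y ∈ ({a, b, c} : Finset E3)) (hz : z ∈ ({a, b, c} : Finset E3)) : F x y z = G x y z :=
  sub_eq_zero.1 (altFun_eq_zero (Submodule.sub_mem _ hF hG) (sub_eq_zero.2 h0) hx hy hz)

/-- The alternating sum over the faces of a tetrahedron. -/
def bdry (H : E3 → E3 → E3 → ℝ) (a b c d : E3) : ℝ := H b c d - H a c d + H a b d - H a b c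

/-- For an alternating function of four points the order of the points is irrelevant up to sign. -/
theorem alternating_eq_zero {H : E3 → E3 → E3 → E3 → ℝ} (h1 : ∀ x y z w, H y x z w = -H x y z w)
    (h2 : ∀ x, H x ∈ altFun) {a b c d : E3} (h0 : H a b c d = 0) {x y z w : E3}
    (hx : x ∈ ({a, b, c, d} : Finset E3)) (hy : y ∈ ({a, b, c, d} : Finset E3))
    (hz : z ∈ ({a, b, c, d} : Finset E3)) (hw : w ∈ ({a, b, c, d} : Finset E3)) :
    H x y z w = 0 := by
  have e1 : ∀ x z w, H x x z w = 0 := fun x z w => by linarith [h1 x x z w]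
  by_cases hxy : y = x
  · rw [hxy, e1]
  by_cases hxz : z = x
  · rw [hxz, (h2 x).1 x y w, e1, neg_zero]
  by_cases hxw : w = x
  · rw [hxw, (h2 x).2 y x z, (h2 x).1 x y z, e1, neg_zero, neg_zero]
  have b0 : H b a c d = 0 := by rw [h1, h0, neg_zero]
  have c0 : H c a b d = 0 := by rw [h1, (h2 a).1, h0, neg_zero, neg_zero]
  have d0 : H d a b c = 0 := by rw [h1, (h2 a).1, (h2 a).2, h0, neg_zero, neg_zero, neg_zero]
  simp only [Finset.mem_insert, Finset.mem_singleton] at hx hy hz hw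
  rcases hx with rfl | rfl | rfl | rfl
  · exact altFun_eq_zero (h2 _) h0 (by simp; tauto) (by simp; tauto) (by simp; tauto)
  · exact altFun_eq_zero (h2 _) b0 (by simp; tauto) (by simp; tauto) (by simp; tauto)
  · exact altFun_eq_zero (h2 _) c0 (by simp; tauto) (by simp; tauto) (by simp; tauto)
  · exact altFun_eq_zero (h2 _) d0 (by simp; tauto) (by simp; tauto) (by simp; tauto)

theorem bdry_swap {H : E3 → E3 → E3 → ℝ} (hH : H ∈ altFun) (x y z w : E3) :
    bdry H y x z w = -bdry H x y z w := by
  simp only [bdry]; rw [hH.1 x y w, hH.1 x y z]; ring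

theorem bdry_mem_altFun {H : E3 → E3 → E3 → ℝ} (hH : H ∈ altFun) (x : E3) :
    bdry H x ∈ altFun := by
  refine ⟨fun y z w => ?_, fun y z w => ?_⟩
  · simp only [bdry]; rw [hH.1 y z w, hH.2 x y z]; ring
  · simp only [bdry]; rw [hH.2 y z w, hH.2 x z w]; ring

theorem normal_mem_altFun (i : Fin 3) : (fun a b c => normal a b c i) ∈ altFun := by
  refine ⟨fun x y z => ?_, fun x y z => ?_⟩ <;> fin_cases i <;>
    simp [normal, crossProduct, tangent] <;> ring

theorem vol_swap (x y z w : E3) : vol y x z w = -vol x y z w := by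
  simp only [vol_eq]; ring

theorem vol_mem_altFun (x : E3) : vol x ∈ altFun := by
  refine ⟨fun y z w => ?_, fun y z w => ?_⟩ <;> simp only [vol_eq] <;> ring

/-- The face integral is symmetric only for distinct points; on degenerate triples the alternating
factor vanishes. -/
theorem mul_faceInt_mem_altFun {H : E3 → E3 → E3 → ℝ} (hH : H ∈ altFun) (p : Poly) :
    (fun a b c => H a b c * faceInt a b c p) ∈ altFun := by
  have hs := altFun_self hH
  refine ⟨fun x y z => ?_, fun x y z => ?_⟩
  · change H y x z * _ = -(H x y z * _)
    by_cases hxy : x = y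
    · rw [hxy, (hs _ _).1]; ring
    by_cases hxz : x = z
    · rw [hxz, (hs _ _).2.2, (hs _ _).2.1]; ring
    by_cases hyz : y = z
    · rw [hyz, (hs _ _).2.2, (hs _ _).2.1]; ring
    rw [hH.1 x y z, faceInt_swap_left hxy hxz hyz]; ring
  · change H x z y * _ = -(H x y z * _)
    by_cases hxy : x = y
    · rw [hxy, (hs _ _).1, (hs _ _).2.1]; ring
    by_cases hxz : x = z
    · rw [hxz, (hs _ _).1, (hs _ _).2.1]; ring
    rw [hH.2 x y z, faceInt_swap_right hxy hxz]; ring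

/-! ### Face fluxes -/

/-- The weighted flux of a field through a face. -/
def faceFlux (v : VPoly) (a b c : E3) : Poly →ₗ[ℝ] ℝ :=
  faceInt a b c ∘ₗ LinearMap.mulLeft ℝ (along (normal a b c) v)

theorem faceFlux_apply (v : VPoly) (a b c : E3) (q : Poly) :
    faceFlux v a b c q = faceInt a b c (along (normal a b c) v * q) := rfl

theorem faceFlux_add (v w : VPoly) (a b c : E3) (q : Poly) :
    faceFlux (v + w) a b c q = faceFlux v a b c q + faceFlux w a b c q := by
  simp only [faceFlux_apply, map_add, add_mul]

theorem faceFlux_mem_altFun (v : VPoly) (q : Poly) : (fun a b c => faceFlux v a b c q) ∈ altFun := by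
  have h : (fun a b c => faceFlux v a b c q) =
      ∑ i : Fin 3, fun a b c => normal a b c i * faceInt a b c (v i * q) := by
    ext a b c
    simp only [faceFlux_apply, along_apply, add_mul, smul_mul_assoc, map_add, map_smul,
      smul_eq_mul, Fin.sum_univ_three, Pi.add_apply]
  rw [h]
  exact Submodule.sum_mem _ fun i _ => mul_faceInt_mem_altFun (normal_mem_altFun i) _

theorem faceInt_C (a b c : E3) (k : ℝ) : faceInt a b c (C k) = k / 2 := by
  change (∫ s in (0 : ℝ)..1, ∫ t in (0 : ℝ)..(1 - s), ev _ (C k)) = _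
  simp only [ev_C, intervalIntegral.integral_const, sub_zero, smul_eq_mul]
  rw [intervalIntegral.integral_mul_const, intervalIntegral.integral_sub (by simp) (by simp)]
  simp
  ring

theorem faceFlux_eq_zero {v : VPoly} {a b c : E3} {q : Poly}
    (h : ∀ s t : ℝ, 0 ≤ s → 0 < t → s + t ≤ 1 → ev (a + s • (b - a) + t • (c - a)) q = 0) :
    faceFlux v a b c q = 0 :=
  faceInt_eq_zero fun s t h0 h1 h2 => by
    rw [LinearMap.mulLeft_apply, ev_mul, h s t h0 h1 h2, mul_zero]

/-- The field `C × x / 2`, whose curl is the constant field `c`. -/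
def rotField (c : Fin 3 → ℝ) : VPoly :=
  ![C (c 1 / 2) * X 2 - C (c 2 / 2) * X 1, C (c 2 / 2) * X 0 - C (c 0 / 2) * X 2,
    C (c 0 / 2) * X 1 - C (c 1 / 2) * X 0]

theorem curl_rotField (c : Fin 3 → ℝ) : curl (rotField c) = fun i => C (c i) := by
  have h : ∀ x : ℝ, (C (x / 2) + C (x / 2) : Poly) = C x := fun x => by rw [← C_add, add_halves]
  have h0 : rotField c 0 = C (c 1 / 2) * X 2 - C (c 2 / 2) * X 1 := rfl
  have h1 : rotField c 1 = C (c 2 / 2) * X 0 - C (c 0 / 2) * X 2 := rfl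
  have h2 : rotField c 2 = C (c 0 / 2) * X 1 - C (c 1 / 2) * X 0 := rfl
  ext1 i
  fin_cases i
  · change pderiv 1 (rotField c 2) - pderiv 2 (rotField c 1) = C (c 0)
    rw [h1, h2, ← h (c 0)]
    simp
  · change pderiv 2 (rotField c 0) - pderiv 0 (rotField c 2) = C (c 1)
    rw [h0, h2, ← h (c 1)]
    simp
  · change pderiv 0 (rotField c 1) - pderiv 1 (rotField c 0) = C (c 2)
    rw [h0, h1, ← h (c 2)]
    simp

theorem rotField_mem_nedelecShape {r : ℕ} (hr : 1 ≤ r) (c : Fin 3 → ℝ) :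
    rotField c ∈ nedelecShape r := by
  have h : ∀ (x y : ℝ) (i j : Fin 3), (C x * X i - C y * X j : Poly).totalDegree ≤ r :=
    fun x y i j => by
      have h1 : ∀ (x : ℝ) (i : Fin 3), (C x * X i : Poly).totalDegree ≤ 1 := fun x i => by
        refine (totalDegree_mul _ _).trans ?_
        rw [totalDegree_C, zero_add, totalDegree_X]
      exact ((totalDegree_sub _ _).trans (max_le (h1 x i) (h1 y j))).trans hr
  refine (mem_nedelecShape hr).2 ⟨fun i => ?_, ?_⟩
  · fin_cases i <;> exact h _ _ _ _
  · have : posDot (rotField c) = 0 := by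
      simp [posDot, rotField]
      ring
    rw [this, totalDegree_zero]
    exact Nat.zero_le r

theorem faceFlux_curl_rotField (c : Fin 3 → ℝ) (x y z : E3) :
    faceFlux (curl (rotField c)) x y z 1 = (normal x y z ⬝ᵥ c) / 2 := by
  rw [faceFlux_apply, curl_rotField, mul_one, ← faceInt_C x y z]
  congr 1
  simp [along_apply, dotProduct, Fin.sum_univ_three, smul_eq_C_mul]

/-- A constant field with prescribed fluxes through the faces of a tetrahedron. -/
theorem exists_rotField {H : E3 → E3 → E3 → ℝ} {a b c d : E3} (hv : vol a b c d ≠ 0)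
    (hH : bdry H a b c d = 0) : ∃ e : Fin 3 → ℝ,
      faceFlux (curl (rotField e)) a b c 1 = H a b c ∧
      faceFlux (curl (rotField e)) a b d 1 = H a b d ∧
      faceFlux (curl (rotField e)) a c d 1 = H a c d ∧
      faceFlux (curl (rotField e)) b c d 1 = H b c d := by
  -- Cramer's rule for the three faces through `a`: `d - a` is orthogonal to the normals of the two
  -- faces that contain the edge `[a, d]`, and likewise for `b` and `c`. The fourth flux follows
  -- from the vanishing total.
  let e : Fin 3 → ℝ := fun i => 2 / vol a b c d *
    (H a b c * (d i - a i) - H a b d * (c i - a i) + H a c d * (b i - a i))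
  have hn : ∀ x y z, normal x y z ⬝ᵥ e =
      ((y 1 - x 1) * (z 2 - x 2) - (y 2 - x 2) * (z 1 - x 1)) * e 0 +
      ((y 2 - x 2) * (z 0 - x 0) - (y 0 - x 0) * (z 2 - x 2)) * e 1 +
      ((y 0 - x 0) * (z 1 - x 1) - (y 1 - x 1) * (z 0 - x 0)) * e 2 := fun x y z => by
    simp [normal, crossProduct, tangent, dotProduct, Fin.sum_univ_three]
  have h1 : normal a b c ⬝ᵥ e = 2 * H a b c := by
    rw [hn]; simp only [e]; field_simp; rw [vol_eq]; ring
  have h2 : normal a b d ⬝ᵥ e = 2 * H a b d := by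
    rw [hn]; simp only [e]; field_simp; rw [vol_eq]; ring
  have h3 : normal a c d ⬝ᵥ e = 2 * H a c d := by
    rw [hn]; simp only [e]; field_simp; rw [vol_eq]; ring
  have h4 : normal b c d ⬝ᵥ e =
      normal a c d ⬝ᵥ e - normal a b d ⬝ᵥ e + normal a b c ⬝ᵥ e := by
    simp only [hn]; ring
  refine ⟨e, ?_, ?_, ?_, ?_⟩ <;> rw [faceFlux_curl_rotField]
  · rw [h1]; ring
  · rw [h2]; ring
  · rw [h3]; ring
  · rw [h4, h1, h2, h3]
    simp only [bdry] at hH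
    linarith

/-- A field whose curl has prescribed normal moments on one face of a tetrahedron and vanishing
normal moments on the others. -/
theorem IsBarycentric.exists_faceFlux {K s : Finset E3} {lam : E3 → Poly}
    (hlam : IsBarycentric K lam) (hsK : s ⊆ K) (hs : s.card = 3) {N : E3 → E3 → E3 → Poly →ₗ[ℝ] ℝ}
    (halt : ∀ q, (fun x y z => N x y z q) ∈ altFun)
    (hN : ∀ x y z q, (∀ s t : ℝ, 0 ≤ s → 0 < t → s + t ≤ 1 →
      ev (x + s • (y - x) + t • (z - x)) q = 0) → N x y z q = 0)
    (hN1 : ∀ x ∈ s, ∀ y ∈ s, ∀ z ∈ s, N x y z 1 = 0) {r : ℕ} (hr : 1 ≤ r) :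
    ∃ w ∈ nedelecShape r,
      (∀ x ∈ s, ∀ y ∈ s, ∀ z ∈ s, ∀ q : Poly, q.totalDegree + 1 ≤ r →
        faceFlux (curl w) x y z q = N x y z q) ∧
      ∀ S ⊆ K, ¬ s ⊆ S → TraceZero S w := by
  obtain ⟨a, b, c, hab, hac, hbc, rfl⟩ := Finset.card_eq_three.1 hs
  obtain ⟨ha, hb, hc⟩ := triple_subset.1 hsK
  obtain ⟨a1, a2, a3⟩ := hlam a ha
  obtain ⟨b1, b2, b3⟩ := hlam b hb
  obtain ⟨c1, c2, c3⟩ := hlam c hc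
  obtain ⟨q₀, hq₀, hflux⟩ := exists_fluxField hac a1 b1 c1 a2 (a3 b hb hab.symm) (a3 c hc hac.symm)
    (b3 a ha hab) b2 (b3 c hc hbc.symm) (c3 a ha hac) (c3 b hb hbc) c2 (N a b c) (fun q k hq => by
      have h1 : N a b c (q - C k) = 0 := hN a b c _ fun s t h0 h1 h2 => by
        rw [map_sub, hq s t h0 h1 h2, ev_C, sub_self]
      have h2 : N a b c (C k) = 0 := by
        rw [← mul_one (C k), ← smul_eq_C_mul, map_smul,
          hN1 a (by simp) b (by simp) c (by simp), smul_zero]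
      rwa [map_sub, h2, sub_zero] at h1) (r - 1)
  refine ⟨_, fluxField_mem_nedelecShape a1 b1 c1 (q := q₀) (a := a) (b := b) (c := c) (by omega),
    fun x hx y hy z hz q hq => ?_, fun S hS hsS => fluxField_traceZero a1 b1 c1 ?_ _⟩
  · have e := (faceFlux_apply (curl (fluxField a b c (lam a) (lam b) (lam c) q₀)) a b c q).trans
      (hflux q (by omega))
    exact altFun_eq (faceFlux_mem_altFun _ q) (halt q) e hx hy hz
  · by_cases ha' : a ∈ S
    · by_cases hb' : b ∈ S
      · exact Or.inr (Or.inr (hlam.exists_notMem hS hc fun hc' =>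
          hsS (triple_subset.2 ⟨ha', hb', hc'⟩)))
      · exact Or.inr (Or.inl (hlam.exists_notMem hS hb hb'))
    · exact Or.inl (hlam.exists_notMem hS ha ha')

/-- A field whose curl has prescribed normal moments on the faces of a tetrahedron. -/
theorem IsBarycentric.exists_flux {K : Finset E3} {lam : E3 → Poly} (hlam : IsBarycentric K lam)
    {a b c d : E3} (hK : K = {a, b, c, d}) (hKc : K.card = 4) (hv : vol a b c d ≠ 0)
    {N : E3 → E3 → E3 → Poly →ₗ[ℝ] ℝ} (halt : ∀ q, (fun x y z => N x y z q) ∈ altFun)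
    (hN : ∀ x y z q, (∀ s t : ℝ, 0 ≤ s → 0 < t → s + t ≤ 1 →
      ev (x + s • (y - x) + t • (z - x)) q = 0) → N x y z q = 0)
    (hN1 : bdry (fun x y z => N x y z 1) a b c d = 0) {r : ℕ} (hr : 1 ≤ r) :
    ∃ v ∈ nedelecShape r, ∀ x y z : E3, x ≠ y → x ≠ z → y ≠ z → {x, y, z} ⊆ K → ∀ q : Poly,
      q.totalDegree + 1 ≤ r → faceFlux (curl v) x y z q = N x y z q := by
  classical
  obtain ⟨e, e1, e2, e3, e4⟩ := exists_rotField hv hN1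
  -- Once the field with constant curl is subtracted, every face has mean flux zero, so the faces
  -- can be treated one at a time by fields with no trace on the others.
  let N' : E3 → E3 → E3 → Poly →ₗ[ℝ] ℝ := fun x y z => N x y z - faceFlux (curl (rotField e)) x y z
  have halt' : ∀ q, (fun x y z => N' x y z q) ∈ altFun := fun q =>
    Submodule.sub_mem _ (halt q) (faceFlux_mem_altFun _ q)
  have h0 : ∀ {x y z}, faceFlux (curl (rotField e)) x y z 1 = N x y z 1 → N' x y z 1 = 0 :=
    fun h => sub_eq_zero.2 h.symm
  have hN1' : ∀ s ⊆ K, s.card = 3 → ∀ x ∈ s, ∀ y ∈ s, ∀ z ∈ s, N' x y z 1 = 0 := by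
    intro s hsK hs x hx y hy z hz
    obtain ⟨o, ho, hos⟩ : ∃ o ∈ K, o ∉ s := by
      by_contra! h
      have := Finset.card_le_card h
      omega
    have hm : ∀ x ∈ s, x ≠ o ∧ (x = a ∨ x = b ∨ x = c ∨ x = d) := fun x hx =>
      ⟨fun h => hos (h ▸ hx), by simpa [hK] using hsK hx⟩
    have hsub : ∀ {a' b' c'}, (∀ x, x ≠ o ∧ (x = a ∨ x = b ∨ x = c ∨ x = d) →
        x = a' ∨ x = b' ∨ x = c') → N' a' b' c' 1 = 0 → N' x y z 1 = 0 := fun h h0 => by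
      have h' : ∀ x ∈ s, x ∈ ({_, _, _} : Finset E3) := fun x hx => by simpa using h x (hm x hx)
      exact altFun_eq_zero (halt' 1) h0 (h' x hx) (h' y hy) (h' z hz)
    rw [hK] at ho
    simp only [Finset.mem_insert, Finset.mem_singleton] at ho
    clear hm hK
    rcases ho with rfl | rfl | rfl | rfl
    · exact hsub (by tauto) (h0 e4)
    · exact hsub (by tauto) (h0 e3)
    · exact hsub (by tauto) (h0 e2)
    · exact hsub (by tauto) (h0 e1)
  have hw : ∀ s : Finset E3, ∃ w : VPoly, s ⊆ K → s.card = 3 → w ∈ nedelecShape r ∧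
      (∀ x ∈ s, ∀ y ∈ s, ∀ z ∈ s, ∀ q : Poly, q.totalDegree + 1 ≤ r →
        faceFlux (curl w) x y z q = N' x y z q) ∧
      ∀ S ⊆ K, ¬ s ⊆ S → TraceZero S w := fun s => by
    by_cases h : s ⊆ K ∧ s.card = 3
    · obtain ⟨w, hw⟩ := hlam.exists_faceFlux h.1 h.2 halt' (fun x y z q hq => by
        change N x y z q - faceFlux _ x y z q = 0
        rw [hN x y z q hq, faceFlux_eq_zero hq, sub_zero]) (hN1' s h.1 h.2) hr
      exact ⟨w, fun _ _ => hw⟩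
    · exact ⟨0, fun h1 h2 => absurd ⟨h1, h2⟩ h⟩
  choose w hw using hw
  refine ⟨rotField e + ∑ s ∈ K.powersetCard 3, w s, Submodule.add_mem _
    (rotField_mem_nedelecShape hr e) (Submodule.sum_mem _ fun s hs => ?_),
    fun x y z hxy hxz hyz hK' q hq => ?_⟩
  · obtain ⟨h1, h2⟩ := Finset.mem_powersetCard.1 hs
    exact (hw s h1 h2).1
  · have hc := card_triple hxy hxz hyz
    have hm : ({x, y, z} : Finset E3) ∈ K.powersetCard 3 := Finset.mem_powersetCard.2 ⟨hK', hc⟩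
    rw [← Finset.add_sum_erase _ w hm, map_add, map_add, faceFlux_add, faceFlux_add,
      (hw _ hK' hc).2.1 x (by simp) y (by simp) z (by simp) q hq]
    have hz : TraceZero {x, y, z} (∑ s ∈ (K.powersetCard 3).erase {x, y, z}, w s) :=
      traceZero_sum _ _ fun s hs => by
        obtain ⟨hne, hs⟩ := Finset.mem_erase.1 hs
        obtain ⟨h1, h2⟩ := Finset.mem_powersetCard.1 hs
        exact (hw s h1 h2).2.2 _ hK' (not_subset_of_card_eq (h2.trans hc.symm) hne)
    have h3 := (hz.nedelecVanish r).curl x y z hxy hxz hyz (by simp) (by simp) (by simp) q hq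
    rw [faceFlux_apply (curl (∑ s ∈ _, w s)), h3]
    change _ + (N x y z q - _ + 0) = _
    ring

end Fluxes

/-! ### Matching total fluxes across the mesh and surjectivity of the divergence -/

section DivSurjective

open MvPolynomial

variable {Ω : Set E3} {T : TetMesh Ω}

/-! ### Two cells with a common face lie on different sides of it -/

/-- If `d'` is on the same side of the plane `abc` as `d`, then moving slightly from the centroid of
the triangle towards `d'` stays in the tetrahedron. `α`, `β`, `γ` are the coordinates of `d' - a` by
Cramer's rule; `ε₀` keeps all weights nonnegative. -/
theorem exists_mem_convexHull_vol {a b c d : E3} (hv : vol a b c d ≠ 0) {d' : E3}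
    (h : 0 < vol a b c d * vol a b c d') : ∃ ε₀ > 0, ∀ ε : ℝ, 0 < ε → ε ≤ ε₀ →
      a + ((1 - ε) / 3) • (b - a) + ((1 - ε) / 3) • (c - a) + ε • (d' - a) ∈
        convexHull ℝ {a, b, c, d} := by
  set D := vol a b c d with hD
  let α : ℝ := vol a d' c d / D
  let β : ℝ := vol a b d' d / D
  let γ : ℝ := vol a b c d' / D
  have hγ : 0 < γ := by
    have : γ = D * vol a b c d' / D ^ 2 := by simp only [γ]; field_simp
    rw [this]
    positivity
  have hd' : ∀ i, d' i - a i = α * (b i - a i) + β * (c i - a i) + γ * (d i - a i) := fun i => by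
    have : D * (d' i - a i) = vol a d' c d * (b i - a i) + vol a b d' d * (c i - a i) +
        vol a b c d' * (d i - a i) := by
      simp only [hD, vol_eq]
      fin_cases i <;> simp only [Fin.zero_eta, Fin.mk_one, Fin.reduceFinMk] <;> ring
    simp only [α, β, γ]
    field_simp
    linarith
  have hd : d' - a = α • (b - a) + β • (c - a) + γ • (d - a) := by
    ext i
    simpa using hd' i
  have hM : 0 < 1 + 3 * (|α| + |β| + |γ|) := by positivity
  refine ⟨(1 + 3 * (|α| + |β| + |γ|))⁻¹, inv_pos.2 hM, fun ε h0 h1 => ?_⟩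
  have h2 : ε * (1 + 3 * (|α| + |β| + |γ|)) ≤ 1 := by
    rwa [← le_div_iff₀ hM, one_div]
  have n1 := mul_nonneg h0.le (abs_nonneg α)
  have n2 := mul_nonneg h0.le (abs_nonneg β)
  have n3 := mul_nonneg h0.le (abs_nonneg γ)
  have a1 := mul_le_mul_of_nonneg_left (neg_abs_le α) h0.le
  have a2 := mul_le_mul_of_nonneg_left (neg_abs_le β) h0.le
  have a3 := mul_le_mul_of_nonneg_left (le_abs_self α) h0.le
  have a4 := mul_le_mul_of_nonneg_left (le_abs_self β) h0.le
  have a5 := mul_le_mul_of_nonneg_left (le_abs_self γ) h0.le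
  have a6 := mul_pos h0 hγ
  have e : a + ((1 - ε) / 3) • (b - a) + ((1 - ε) / 3) • (c - a) + ε • (d' - a) =
      ∑ i : Fin 4, (![1 - 2 * ((1 - ε) / 3) - ε * (α + β + γ), (1 - ε) / 3 + ε * α,
        (1 - ε) / 3 + ε * β, ε * γ] : Fin 4 → ℝ) i • (![a, b, c, d] : Fin 4 → E3) i := by
    rw [hd]
    simp only [Fin.sum_univ_four, Matrix.cons_val]
    module
  rw [e]
  refine (convex_convexHull ℝ _).sum_mem (fun i _ => ?_) ?_ fun i _ => subset_convexHull ℝ _ ?_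
  · fin_cases i <;> simp only [Fin.zero_eta, Fin.mk_one, Fin.reduceFinMk, Matrix.cons_val] <;>
      nlinarith
  · simp only [Fin.sum_univ_four, Matrix.cons_val]
    ring
  · fin_cases i <;> simp

theorem TetMesh.Cell.verts_eq {K : T.Cell} {a b c d : E3} (hab : a ≠ b) (hac : a ≠ c) (hbc : b ≠ c)
    (hK : {a, b, c} ⊆ K.verts) (hd : d ∈ K.verts) (hd' : d ∉ ({a, b, c} : Finset E3)) :
    K.verts = {a, b, c, d} := by
  symm
  refine Finset.eq_of_subset_of_card_le (fun x hx => ?_) ?_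
  · simp only [Finset.mem_insert, Finset.mem_singleton] at hx
    obtain ⟨ha, hb, hc⟩ := triple_subset.1 hK
    rcases hx with rfl | rfl | rfl | rfl <;> assumption
  · have h1 : K.verts.card = 4 := K.2.2
    have h2 : ({a, b, c, d} : Finset E3) = insert d {a, b, c} := by ext; simp; tauto
    rw [h1, h2, Finset.card_insert_of_notMem hd', card_triple hab hac hbc]

theorem TetMesh.Cell.vol_ne_zero {K : T.Cell} {a b c d : E3} (hab : a ≠ b) (hac : a ≠ c)
    (hbc : b ≠ c) (hK : {a, b, c} ⊆ K.verts) (hd : d ∈ K.verts)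
    (hd' : d ∉ ({a, b, c} : Finset E3)) : vol a b c d ≠ 0 := by
  obtain ⟨ha, hb, hc⟩ := triple_subset.1 hK
  simp only [Finset.mem_insert, Finset.mem_singleton, not_or] at hd'
  exact QuadDiv.vol_ne_zero (T.indep K.2.1) ha hb hc hd hab hac (Ne.symm hd'.1) hbc
    (Ne.symm hd'.2.1) (Ne.symm hd'.2.2)

/-- If both cells lay on the same side, a point just off the centroid of the face would belong to
both. But they intersect only in the face, where `volPoly` vanishes. -/
theorem TetMesh.vol_mul_vol_neg {K K' : T.Cell} (hne : K ≠ K') {a b c d d' : E3} (hab : a ≠ b)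
    (hac : a ≠ c) (hbc : b ≠ c) (hK : {a, b, c} ⊆ K.verts) (hK' : {a, b, c} ⊆ K'.verts)
    (hd : d ∈ K.verts) (hdn : d ∉ ({a, b, c} : Finset E3)) (hd' : d' ∈ K'.verts)
    (hdn' : d' ∉ ({a, b, c} : Finset E3)) : vol a b c d * vol a b c d' < 0 := by
  classical
  have v1 := K.vol_ne_zero hab hac hbc hK hd hdn
  have v2 := K'.vol_ne_zero hab hac hbc hK' hd' hdn'
  by_contra! hpos
  have hpos' := lt_of_le_of_ne hpos (mul_ne_zero v1 v2).symm
  obtain ⟨ε₁, h1, H1⟩ := exists_mem_convexHull_vol v1 hpos'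
  obtain ⟨ε₂, h2, H2⟩ := exists_mem_convexHull_vol v2 (mul_self_pos.2 v2)
  have hε := lt_min h1 h2
  have m1 := H1 _ hε (min_le_left _ _)
  have m2 := H2 _ hε (min_le_right _ _)
  set ε := min ε₁ ε₂
  have e1 : (K.verts : Set E3) = {a, b, c, d} := by
    rw [K.verts_eq hab hac hbc hK hd hdn]; simp
  have e2 : (K'.verts : Set E3) = {a, b, c, d'} := by
    rw [K'.verts_eq hab hac hbc hK' hd' hdn']; simp
  rw [← e1] at m1
  rw [← e2] at m2
  have hS : K.verts ∩ K'.verts = {a, b, c} := by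
    symm
    refine Finset.eq_of_subset_of_card_le (Finset.subset_inter hK hK') ?_
    rw [card_triple hab hac hbc]
    by_contra! hc
    have c1 : K.verts.card = 4 := K.2.2
    have c2 : K'.verts.card = 4 := K'.2.2
    have s1 := Finset.eq_of_subset_of_card_le
      (Finset.inter_subset_left (s₁ := K.verts) (s₂ := K'.verts)) (by omega)
    have s2 := Finset.eq_of_subset_of_card_le
      (Finset.inter_subset_right (s₁ := K.verts) (s₂ := K'.verts)) (by omega)
    exact hne (Subtype.ext (s1.symm.trans s2))
  have m3 := T.inter_subset_convexHull K.2.1 K'.2.1 ⟨m1, m2⟩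
  change _ ∈ convexHull ℝ ((K.verts : Set E3) ∩ K'.verts) at m3
  rw [← Finset.coe_inter, hS] at m3
  have h0 := ev_eq_zero_of_mem_convexHull (totalDegree_volPoly a b c) (fun x hx => by
    rw [ev_volPoly, vol_eq]
    simp only [Finset.mem_insert, Finset.mem_singleton] at hx
    rcases hx with rfl | rfl | rfl <;> ring) m3
  rw [ev_volPoly] at h0
  have h3 : vol a b c (a + ((1 - ε) / 3) • (b - a) + ((1 - ε) / 3) • (c - a) + ε • (d' - a)) =
      ε * vol a b c d' := by
    simp only [vol_eq, PiLp.add_apply, PiLp.smul_apply, PiLp.sub_apply, smul_eq_mul]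
    ring
  rw [h3] at h0
  exact mul_ne_zero hε.ne' v2 h0

/-! ### Fluxes with prescribed sums on the cells -/

theorem TetMesh.Cell.exists_ordering (K : T.Cell) :
    ∃ p : Fin 4 → E3, K.verts = {p 0, p 1, p 2, p 3} ∧ 0 < vol (p 0) (p 1) (p 2) (p 3) := by
  classical
  obtain ⟨a, b, c, d, hab, hac, had, hbc, hbd, hcd, h⟩ := Finset.card_eq_four.1 K.2.2
  have hK : K.verts = {a, b, c, d} := h
  have hv := K.vol_ne_zero hab hac hbc (by rw [hK]; intro x; simp; tauto) (d := d)
    (by rw [hK]; simp) (by simp [Ne.symm had, Ne.symm hbd, Ne.symm hcd])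
  rcases lt_or_gt_of_ne hv with h0 | h0
  · refine ⟨![b, a, c, d], ?_, ?_⟩
    · rw [hK]; simp [Finset.insert_comm]
    · change 0 < vol b a c d
      rw [vol_swap]; linarith
  · exact ⟨![a, b, c, d], hK, h0⟩

/-- Alternating functions of four points are proportional on the orderings of four points. -/
theorem alternating_mul {F G : E3 → E3 → E3 → E3 → ℝ} (hF : ∀ x y z w, F y x z w = -F x y z w)
    (hF' : ∀ x, F x ∈ altFun) (hG : ∀ x y z w, G y x z w = -G x y z w)
    (hG' : ∀ x, G x ∈ altFun) {a b c d x y z w : E3}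
    (h : ({a, b, c, d} : Finset E3) = {x, y, z, w}) :
    F x y z w * G a b c d = F a b c d * G x y z w := by
  let H : E3 → E3 → E3 → E3 → ℝ := fun x => G a b c d • F x - F a b c d • G x
  have happ : ∀ x y z w, H x y z w = G a b c d * F x y z w - F a b c d * G x y z w :=
    fun _ _ _ _ => rfl
  have h0 : H x y z w = 0 := alternating_eq_zero (H := H) (a := a) (b := b) (c := c) (d := d)
    (fun x y z w => by rw [happ, happ, hF x y z w, hG x y z w]; ring)
    (fun x => Submodule.sub_mem _ (Submodule.smul_mem _ _ (hF' x)) (Submodule.smul_mem _ _ (hG' x)))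
    (by rw [happ]; ring) (by simp [h]) (by simp [h]) (by simp [h]) (by simp [h])
  rw [happ] at h0
  linarith

theorem sign_vol_mul {a b c d x y z w : E3} (h : ({a, b, c, d} : Finset E3) = {x, y, z, w})
    (hpos : 0 < vol x y z w) : vol a b c d = Real.sign (vol a b c d) * vol x y z w := by
  have h1 := alternating_mul (F := fun x y z w => Real.sign (vol x y z w)) (G := vol)
    (fun x y z w => by simp only [vol_swap x y z w, Real.sign_neg])
    (fun x => ⟨fun y z w => by simp only [(vol_mem_altFun x).1 y z w, Real.sign_neg],
      fun y z w => by simp only [(vol_mem_altFun x).2 y z w, Real.sign_neg]⟩)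
    vol_swap vol_mem_altFun h
  rwa [Real.sign_of_pos hpos, one_mul] at h1

/-- Total flux and volume change sign together under reordering, so each cell can be read in an
order adapted to one of its faces. -/
theorem bdry_mul_sign {H : E3 → E3 → E3 → ℝ} (hH : H ∈ altFun) {a b c d x y z w : E3}
    (h : ({a, b, c, d} : Finset E3) = {x, y, z, w}) (hpos : 0 < vol x y z w) :
    bdry H x y z w * Real.sign (vol a b c d) = bdry H a b c d := by
  have h1 := alternating_mul (bdry_swap hH) (bdry_mem_altFun hH) vol_swap vol_mem_altFun h
  rw [sign_vol_mul h hpos, ← mul_assoc] at h1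
  exact mul_right_cancel₀ hpos.ne' h1

/-- The alternating function supported on the orderings of a given face. -/
theorem exists_altFun_support {a b c : E3} (hn : normal a b c ≠ 0) : ∃ H ∈ altFun, 0 < H a b c ∧
    ∀ x y z, ({x, y, z} : Finset E3) ≠ {a, b, c} → H x y z = 0 := by
  classical
  have hm : (fun x y z => normal x y z ⬝ᵥ normal a b c) ∈ altFun := by
    have : (fun x y z => normal x y z ⬝ᵥ normal a b c) =
        ∑ i, normal a b c i • fun x y z => normal x y z i := by
      ext x y z
      simp [dotProduct, Finset.sum_apply, mul_comm]
    rw [this]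
    exact Submodule.sum_mem _ fun i _ => Submodule.smul_mem _ _ (normal_mem_altFun i)
  refine ⟨fun x y z => if ({x, y, z} : Finset E3) = {a, b, c} then
    normal x y z ⬝ᵥ normal a b c else 0, ⟨fun x y z => ?_, fun x y z => ?_⟩, ?_,
    fun x y z h => if_neg h⟩
  · have h1 := hm.1 x y z
    simp only at h1
    simp only [Finset.insert_comm y x]
    split_ifs
    · exact h1
    · simp
  · have h1 := hm.2 x y z
    simp only at h1
    simp only [Finset.pair_comm z y]
    split_ifs
    · exact h1
    · simp
  · simp only [if_true]
    exact lt_of_le_of_ne (Finset.sum_nonneg fun i _ => mul_self_nonneg _)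
      fun h => hn (dotProduct_self_eq_zero.1 h.symm)

theorem TetMesh.finite_cell (T : TetMesh Ω) : Finite T.Cell :=
  (T.finite_faces.subset fun _ h => h.1 : {K | K ∈ T.faces ∧ K.card = 4}.Finite).to_subtype

/-- A piecewise constant function that is orthogonal to all total fluxes agrees on neighbours. -/
theorem TetMesh.eq_of_sum_bdry_eq_zero [Fintype T.Cell] {p : T.Cell → Fin 4 → E3}
    (hp : ∀ K, K.verts = {p K 0, p K 1, p K 2, p K 3})
    (hv : ∀ K, 0 < vol (p K 0) (p K 1) (p K 2) (p K 3)) {y : T.Cell → ℝ}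
    (hy : ∀ H ∈ altFun, ∑ K, y K * bdry H (p K 0) (p K 1) (p K 2) (p K 3) = 0)
    {K K' : T.Cell} {a b c : E3} (hab : a ≠ b) (hac : a ≠ c) (hbc : b ≠ c)
    (hK : {a, b, c} ⊆ K.verts) (hK' : {a, b, c} ⊆ K'.verts) : y K = y K' := by
  classical
  by_cases hne : K = K'
  · rw [hne]
  have hd : ∀ K : T.Cell, ∃ d ∈ K.verts, d ∉ ({a, b, c} : Finset E3) := fun K => by
    by_contra! h
    have h1 := Finset.card_le_card h
    have h2 : K.verts.card = 4 := K.2.2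
    rw [h2, card_triple hab hac hbc] at h1
    omega
  choose d hd hdn using hd
  have hn : normal a b c ≠ 0 := fun h => by
    have := K.vol_ne_zero hab hac hbc hK (hd K) (hdn K)
    rw [vol, h, zero_dotProduct] at this
    exact this rfl
  -- Testing with a flux through this face alone isolates its neighbours, which see it with opposite
  -- orientations.
  obtain ⟨H, hH, hpos, hsupp⟩ := exists_altFun_support hn
  have hbd : ∀ L : T.Cell, {a, b, c} ⊆ L.verts →
      bdry H (p L 0) (p L 1) (p L 2) (p L 3) * Real.sign (vol a b c (d L)) = -H a b c :=
    fun L hL => by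
      have hz : ∀ x y z, d L ∈ ({x, y, z} : Finset E3) → H x y z = 0 := fun x y z h =>
        hsupp x y z fun h' => hdn L (h' ▸ h)
      rw [bdry_mul_sign hH ((L.verts_eq hab hac hbc hL (hd L) (hdn L)).symm.trans (hp L)) (hv L)]
      simp only [bdry]
      rw [hz b c (d L) (by simp), hz a c (d L) (by simp), hz a b (d L) (by simp)]
      ring
  have hbd0 : ∀ L : T.Cell, ¬ {a, b, c} ⊆ L.verts →
      bdry H (p L 0) (p L 1) (p L 2) (p L 3) = 0 := fun L hL => by
    have hz : ∀ i j k, H (p L i) (p L j) (p L k) = 0 := fun i j k =>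
      hsupp _ _ _ fun h' => hL (by
        have hm : ∀ i, p L i ∈ L.verts := fun i => by rw [hp L]; fin_cases i <;> simp
        rw [← h']
        exact triple_subset.2 ⟨hm i, hm j, hm k⟩)
    simp only [bdry, hz]
    ring
  have hneg := fun {L L' : T.Cell} (h : L ≠ L') (hL : {a, b, c} ⊆ L.verts)
    (hL' : {a, b, c} ⊆ L'.verts) =>
    T.vol_mul_vol_neg h hab hac hbc hL hL' (hd L) (hdn L) (hd L') (hdn L')
  have hsum := hy H hH
  -- No third cell contains the face: three nonzero volumes cannot have pairwise opposite signs.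
  rw [Finset.sum_eq_add K K' hne (fun L _ hL => by
    by_cases hL' : {a, b, c} ⊆ L.verts
    · have h1 := hneg hL.1 hL' hK
      have h2 := hneg hL.2 hL' hK'
      have h3 := hneg hne hK hK'
      exfalso
      nlinarith [mul_pos_of_neg_of_neg h1 h2, sq_nonneg (vol a b c (d L))]
    · rw [hbd0 L hL', mul_zero]) (by simp) (by simp)] at hsum
  have h1 := hbd K hK
  have h2 := hbd K' hK'
  rcases mul_neg_iff.1 (hneg hne hK hK') with ⟨h3, h4⟩ | ⟨h3, h4⟩
  · rw [Real.sign_of_pos h3, mul_one] at h1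
    rw [Real.sign_of_neg h4, mul_neg_one, neg_inj] at h2
    rw [h1, h2] at hsum
    exact mul_right_cancel₀ hpos.ne' (by linarith)
  · rw [Real.sign_of_neg h3, mul_neg_one, neg_inj] at h1
    rw [Real.sign_of_pos h4, mul_one] at h2
    rw [h1, h2] at hsum
    exact mul_right_cancel₀ hpos.ne' (by linarith)

/-- There are total fluxes with arbitrary sums on the cells. -/
theorem TetMesh.exists_bdry_eq (T : TetMesh Ω) {p : T.Cell → Fin 4 → E3}
    (hp : ∀ K, K.verts = {p K 0, p K 1, p K 2, p K 3})
    (hv : ∀ K, 0 < vol (p K 0) (p K 1) (p K 2) (p K 3)) (m : T.Cell → ℝ) :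
    ∃ H ∈ altFun, ∀ K, bdry H (p K 0) (p K 1) (p K 2) (p K 3) = m K := by
  classical
  have := T.finite_cell
  have := Fintype.ofFinite T.Cell
  let β : altFun →ₗ[ℝ] T.Cell → ℝ :=
    { toFun := fun H K => bdry H.1 (p K 0) (p K 1) (p K 2) (p K 3)
      map_add' := fun F G => by ext K; simp [bdry]; ring
      map_smul' := fun c F => by ext K; simp [bdry]; ring }
  let B : altFun →ₗ[ℝ] (T.Cell → ℝ) →ₗ[ℝ] ℝ := dotProductBilin ℝ ℝ ∘ₗ β
  have hB : ∀ (H : altFun) (y : T.Cell → ℝ),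
      B H y = ∑ K, bdry H.1 (p K 0) (p K 1) (p K 2) (p K 3) * y K := fun _ _ => rfl
  -- By duality it suffices that a `y` orthogonal to all total fluxes is zero.
  obtain ⟨H, hH⟩ := exists_bilin_eq B (dotProductBilin ℝ ℝ m) (fun y hy => by
    have hy' : ∀ H ∈ altFun, ∑ K, y K * bdry H (p K 0) (p K 1) (p K 2) (p K 3) = 0 :=
      fun H hH => by
        have := hy ⟨H, hH⟩
        rw [hB] at this
        simpa only [mul_comm] using this
    let Y : Finset E3 → ℝ := fun s => if h : ∃ K : T.Cell, s ⊆ K.verts then y h.choose else 0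
    have hY : ∀ (K : T.Cell) (a b c : E3), a ≠ b → a ≠ c → b ≠ c → {a, b, c} ⊆ K.verts →
        Y {a, b, c} = y K := fun K a b c hab hac hbc hK => by
      have h : ∃ K : T.Cell, {a, b, c} ⊆ K.verts := ⟨K, hK⟩
      simp only [Y, dif_pos h]
      exact T.eq_of_sum_bdry_eq_zero hp hv hy' hab hac hbc h.choose_spec hK
    have hV := vol_mem_altFun 0
    have hs := altFun_self hV
    -- Up to a factor, the flux of the position field weighted by `y`; it is well defined on faces
    -- since `y` agrees across them. Its total on a cell is `y K` times the volume, so orthogonality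
    -- reads `∑ y² vol = 0`.
    let F : E3 → E3 → E3 → ℝ := fun a b c => Y {a, b, c} * vol 0 a b c
    have hF : F ∈ altFun := by
      refine ⟨fun a b c => ?_, fun a b c => ?_⟩
      · simp only [F]
        rw [Finset.insert_comm, hV.1 a b c]; ring
      · simp only [F]
        rw [Finset.pair_comm, hV.2 a b c]; ring
    have hFK : ∀ K, ∀ a ∈ K.verts, ∀ b ∈ K.verts, ∀ c ∈ K.verts, F a b c = y K * vol 0 a b c :=
      fun K a ha b hb c hc => by
        simp only [F]
        by_cases hab : a = b
        · rw [hab, (hs _ _).1, mul_zero, mul_zero]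
        by_cases hac : a = c
        · rw [hac, (hs _ _).2.1, mul_zero, mul_zero]
        by_cases hbc : b = c
        · rw [hbc, (hs _ _).2.2, mul_zero, mul_zero]
        rw [hY K a b c hab hac hbc (triple_subset.2 ⟨ha, hb, hc⟩)]
    have hsum := hy' F hF
    have hterm : ∀ K, y K * bdry F (p K 0) (p K 1) (p K 2) (p K 3) =
        y K * y K * vol (p K 0) (p K 1) (p K 2) (p K 3) := fun K => by
      have hm : ∀ i, p K i ∈ K.verts := fun i => by rw [hp K]; fin_cases i <;> simp
      simp only [bdry]
      rw [hFK K _ (hm 1) _ (hm 2) _ (hm 3), hFK K _ (hm 0) _ (hm 2) _ (hm 3),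
        hFK K _ (hm 0) _ (hm 1) _ (hm 3), hFK K _ (hm 0) _ (hm 1) _ (hm 2)]
      simp only [vol_eq, PiLp.zero_apply]
      ring
    simp only [hterm] at hsum
    have hy0 : y = 0 := funext fun K => by
      have := (Finset.sum_eq_zero_iff_of_nonneg fun K _ =>
        mul_nonneg (mul_self_nonneg (y K)) (hv K).le).1 hsum K (Finset.mem_univ K)
      exact mul_self_eq_zero.1 ((mul_eq_zero.1 this).resolve_right (hv K).ne')
    rw [hy0, map_zero])
  refine ⟨H.1, H.2, fun K => ?_⟩
  have h := hH (Pi.single K 1)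
  rw [hB] at h
  simpa [Pi.single_apply, dotProductBilin, dotProduct] using h

/-! ### Surjectivity of the divergence -/

/-- The preimage is `curl (v K) + poincare (u K)`, with `v K` chosen so that the normal moment on
each face against `q` is `H a b c * faceInt a b c q`, independent of the cell. -/
theorem exists_divH_eq (T : TetMesh Ω) {r k : ℕ} (hr : 1 ≤ r) {u : T.Cell → Poly}
    (hu : u ∈ lagrangePlusSpace T k) : ∃ w ∈ gradDivSpace T r k, divH T w = u := by
  choose p hp hv using fun K : T.Cell => K.exists_ordering
  -- The total flux of a curl is zero, so the common fluxes must have the totals of `poincare (u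
  -- K)`. The factor `2` compensates for the area `1 / 2` of the reference triangle.
  obtain ⟨H, hH, hHm⟩ := T.exists_bdry_eq hp hv fun K =>
    2 * bdry (fun a b c => faceFlux (poincare (u K)) a b c 1) (p K 0) (p K 1) (p K 2) (p K 3)
  let N : T.Cell → E3 → E3 → E3 → Poly →ₗ[ℝ] ℝ := fun K a b c =>
    H a b c • faceInt a b c - faceFlux (poincare (u K)) a b c
  have hNapp : ∀ K a b c q, N K a b c q =
      H a b c * faceInt a b c q - faceFlux (poincare (u K)) a b c q := fun _ _ _ _ _ => rfl
  have hloc : ∀ K : T.Cell, ∃ v ∈ nedelecShape r, ∀ x y z : E3, x ≠ y → x ≠ z → y ≠ z →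
      {x, y, z} ⊆ K.verts → ∀ q : Poly, q.totalDegree + 1 ≤ r →
        faceFlux (curl v) x y z q = N K x y z q := fun K => by
    obtain ⟨lam, hlam⟩ := K.exists_barycentric
    refine hlam.exists_flux (hp K) K.2.2 (hv K).ne' (fun q => Submodule.sub_mem _
      (mul_faceInt_mem_altFun hH q) (faceFlux_mem_altFun _ q)) (fun x y z q hq => ?_) ?_ hr
    · rw [hNapp, faceInt_eq_zero hq, faceFlux_eq_zero hq, mul_zero, sub_zero]
    · have h := hHm K
      have h1 : ∀ a b c, faceInt a b c 1 = 1 / 2 := fun a b c => by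
        rw [← C_1, faceInt_C]
      simp only [bdry, hNapp, h1] at h ⊢
      linarith
  choose v hvr hvN using hloc
  have hdiv : ∀ K, div (curl (v K) + poincare (u K)) = u K := fun K => by
    rw [map_add, div_curl, div_poincare, zero_add]
  have hd : divH T (fun K => curl (v K) + poincare (u K)) = u := funext hdiv
  refine ⟨fun K => curl (v K) + poincare (u K), ⟨⟨fun K _ => ?_, ?_⟩, ?_⟩, hd⟩
  · exact Submodule.add_mem_sup (Submodule.mem_map_of_mem (hvr K))
      (Submodule.mem_map_of_mem (hu.1 K (Set.mem_univ K)))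
  · change divH T _ ∈ lagrangeGlue T (k - 1)
    rw [hd]
    exact hu.2
  · intro K K' a b c hab hac hbc hK hK' q hq
    have key : ∀ K : T.Cell, {a, b, c} ⊆ K.verts →
        faceInt a b c (along (normal a b c) (curl (v K) + poincare (u K)) * q) =
          H a b c * faceInt a b c q := fun K hK => by
      rw [← faceFlux_apply, faceFlux_add, hvN K a b c hab hac hbc hK q hq, hNapp]
      ring
    rw [key K hK, key K' hK']

end DivSurjective

/-! ### Assembly of the global complex -/

section Complex

open MvPolynomial

variable {Ω : Set E3} {T : TetMesh Ω}

/-! ### The complex -/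

theorem constH_mem (c : ℝ) (r : ℕ) : constH T c ∈ lagrangeSpace T r :=
  ⟨fun _ _ => mem_lagrangeShape.2 ((totalDegree_C c).trans_le (Nat.zero_le r)),
    fun _ _ => ⟨fun _ _ _ => rfl, fun _ _ _ _ _ _ _ => rfl, fun _ _ _ _ _ _ _ _ _ _ => rfl⟩⟩

theorem gradH_mem {r : ℕ} {u : T.Cell → Poly} (hu : u ∈ lagrangeSpace T r) :
    gradH T u ∈ nedelecSpace T r := by
  refine ⟨fun K _ => grad_mem_nedelecShape (mem_lagrangeShape.1 (hu.1 K (Set.mem_univ K))),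
    mem_nedelecGlue.2 fun K K' => ?_⟩
  change NedelecVanish r _ (grad (u K) - grad (u K'))
  rw [← map_sub]
  exact (mem_lagrangeGlue.1 hu.2 K K').grad

theorem curlH_mem {r k : ℕ} {v : T.Cell → VPoly} (hv : v ∈ nedelecSpace T r) :
    curlH T v ∈ gradDivSpace T r k := by
  have hd : divH T (curlH T v) = 0 := funext fun K => div_curl (v K)
  refine ⟨⟨fun K _ => Submodule.mem_sup_left
    (Submodule.mem_map_of_mem (hv.1 K (Set.mem_univ K))), ?_⟩, mem_normalGlue.2 fun K K' => ?_⟩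
  · change divH T (curlH T v) ∈ lagrangeGlue T (k - 1)
    rw [hd]
    exact Submodule.zero_mem _
  · change NormalVanish r _ (curl (v K) - curl (v K'))
    rw [← map_sub]
    exact (mem_nedelecGlue.1 hv.2 K K').curl

theorem divH_mem {r k : ℕ} {w : T.Cell → VPoly} (hw : w ∈ gradDivSpace T r k) :
    divH T w ∈ lagrangePlusSpace T k := by
  refine ⟨fun K _ => ?_, hw.1.2⟩
  obtain ⟨_, ⟨v, -, rfl⟩, _, ⟨p, hp, rfl⟩, h⟩ :=
    Submodule.mem_sup.1 (hw.1.1 K (Set.mem_univ K))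
  change div (w K) ∈ _
  rw [← h, map_add, div_curl, div_poincare, zero_add]
  exact hp

theorem TetMesh.nonempty_cell (T : TetMesh Ω) (hΩ : IsLipschitzDomain Ω) : Nonempty T.Cell := by
  obtain ⟨x, hx⟩ := hΩ.isConnected.nonempty
  obtain ⟨s, hs, -⟩ := T.exists_minimal_face (subset_closure hx)
  obtain ⟨K, -⟩ := T.exists_cell hs
  exact ⟨K⟩

theorem exists_constH_eq (hΩ : IsLipschitzDomain Ω) {r : ℕ} {u : T.Cell → Poly}
    (hu : u ∈ lagrangeSpace T r) (h : gradH T u = 0) : ∃ c, constH T c = u := by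
  obtain ⟨K₀⟩ := T.nonempty_cell hΩ
  have hc : ∀ K, u K = C (coeff 0 (u K)) := fun K => eq_C_of_grad_eq_zero (congrFun h K)
  refine ⟨coeff 0 (u K₀), funext fun K => ?_⟩
  rw [hc K, ← T.eq_of_agree hΩ (c := fun K => coeff 0 (u K)) (fun K K' a ha ha' => ?_) K₀ K]
  · rfl
  · have := (hu.2 K K').1 a ha ha'
    rwa [hc K, hc K', ev_C, ev_C] at this

/-- Local potentials are shifted by constants to common vertex values, by the first cohomology; the
remaining moments are then forced by those of the gradient. -/
theorem exists_gradH_eq (hΩ : IsLipschitzDomain Ω) [ContractibleSpace Ω] {r : ℕ} (hr : 1 ≤ r)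
    {v : T.Cell → VPoly} (hv : v ∈ nedelecSpace T r) (h : curlH T v = 0) :
    ∃ u ∈ lagrangeSpace T r, gradH T u = v := by
  classical
  choose φ hφ hφv using fun K =>
    exists_grad_eq_of_curl_eq_zero hr (hv.1 K (Set.mem_univ K)) (congrFun h K)
  have hint : ∀ K a b, edgeInt a b (along (tangent a b) (v K)) = ev b (φ K) - ev a (φ K) :=
    fun K a b => by rw [← hφv K, along_grad, edgeInt_dirDeriv]
  obtain ⟨g, hg⟩ := T.exists_potential hΩ (γ := fun K a => ev a (φ K))
    fun K K' a b ha ha' hb hb' => by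
      by_cases hab : a = b
      · rw [hab]; ring
      have := (hv.2 K K').1 a b hab (pair_subset.2 ⟨ha, hb⟩) (pair_subset.2 ⟨ha', hb'⟩) 1
        (by simpa using hr)
      rwa [mul_one, mul_one, hint, hint] at this
  have hne : ∀ K : T.Cell, K.verts.Nonempty := fun K => T.nonempty_of_mem_faces K.2.1
  choose o ho using hne
  -- The constant matches `g` at one vertex of the cell, hence at all of them, since `g` has the
  -- potential differences of `φ K`.
  let u : T.Cell → Poly := fun K => φ K + C (g (o K) - ev (o K) (φ K))
  have hev : ∀ K, ∀ a ∈ K.verts, ev a (u K) = g a := fun K a ha => by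
    have := hg K (o K) (ho K) a ha
    simp only [u, map_add, ev_C]
    linarith
  have hgrad : ∀ K, grad (u K) = v K := fun K => by
    have : grad (C (g (o K) - ev (o K) (φ K))) = 0 := by
      ext1 i
      exact pderiv_C
    simp only [u]
    rw [map_add, this, add_zero, hφv]
  refine ⟨u, ⟨fun K _ => mem_lagrangeShape.2 ?_, mem_lagrangeGlue.2 fun K K' => ?_⟩,
    funext hgrad⟩
  · exact (totalDegree_add _ _).trans (max_le (hφ K) ((totalDegree_C _).trans_le (Nat.zero_le r)))
  · refine LagrangeVanish.of_grad ?_ fun a ha => ?_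
    · rw [map_sub, hgrad, hgrad]
      exact mem_nedelecGlue.1 hv.2 K K'
    · obtain ⟨h1, h2⟩ := Finset.mem_inter.1 ha
      rw [map_sub, hev K a h1, hev K' a h2, sub_self]

end Complex

end QuadDiv

end

theorem mainTheorem1 (Ω : Set QuadDiv.E3) (hΩ : QuadDiv.IsLipschitzDomain Ω)
    (hc : ContractibleSpace Ω) (T : QuadDiv.TetMesh Ω) (r k : ℕ) (hr : 1 ≤ r) (hk : 2 ≤ k) :
    ∃ (h₀ : ∀ c : ℝ, QuadDiv.constH T c ∈ QuadDiv.lagrangeSpace T r)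
      (h₁ : ∀ u ∈ QuadDiv.lagrangeSpace T r, QuadDiv.gradH T u ∈ QuadDiv.nedelecSpace T r)
      (h₂ : ∀ u ∈ QuadDiv.nedelecSpace T r, QuadDiv.curlH T u ∈ QuadDiv.gradDivSpace T r k)
      (h₃ : ∀ u ∈ QuadDiv.gradDivSpace T r k,
        QuadDiv.divH T u ∈ QuadDiv.lagrangePlusSpace T k),
      Function.Injective ((QuadDiv.constH T).codRestrict (QuadDiv.lagrangeSpace T r) h₀) ∧
      Function.Exact ((QuadDiv.constH T).codRestrict (QuadDiv.lagrangeSpace T r) h₀)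
        ((QuadDiv.gradH T).restrict h₁) ∧
      Function.Exact ((QuadDiv.gradH T).restrict h₁) ((QuadDiv.curlH T).restrict h₂) ∧
      Function.Exact ((QuadDiv.curlH T).restrict h₂) ((QuadDiv.divH T).restrict h₃) ∧
      Function.Surjective ((QuadDiv.divH T).restrict h₃) := by
  refine ⟨fun c => QuadDiv.constH_mem c r, fun u => QuadDiv.gradH_mem, fun v => QuadDiv.curlH_mem,
    fun w => QuadDiv.divH_mem, fun c c' h => ?_, fun u => ⟨fun h => ?_, ?_⟩,
    fun v => ⟨fun h => ?_, ?_⟩, fun w => ⟨fun h => ?_, ?_⟩, fun u => ?_⟩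
  · obtain ⟨K⟩ := T.nonempty_cell hΩ
    exact MvPolynomial.C_injective _ _ (congrFun (congrArg Subtype.val h) K)
  · obtain ⟨c, h⟩ := QuadDiv.exists_constH_eq hΩ u.2 (congrArg Subtype.val h)
    exact ⟨c, Subtype.ext h⟩
  · rintro ⟨c, rfl⟩
    exact Subtype.ext (funext fun K => funext fun i => MvPolynomial.pderiv_C)
  · obtain ⟨u, hu, h⟩ := QuadDiv.exists_gradH_eq hΩ hr v.2 (congrArg Subtype.val h)
    exact ⟨⟨u, hu⟩, Subtype.ext h⟩
  · rintro ⟨u, rfl⟩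
    exact Subtype.ext (funext fun K => QuadDiv.curl_grad (u.1 K))
  · obtain ⟨v, hv, h⟩ := QuadDiv.exists_curlH_eq hΩ hr w.2 (congrArg Subtype.val h)
    exact ⟨⟨v, hv⟩, Subtype.ext h⟩
  · rintro ⟨v, rfl⟩
    exact Subtype.ext (funext fun K => QuadDiv.div_curl (v.1 K))
  · obtain ⟨w, hw, h⟩ := QuadDiv.exists_divH_eq T hr u.2
    exact ⟨⟨w, hw⟩, Subtype.ext h⟩
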